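/- **Setting.** Let $(M,g)$ be a smooth 4-dimensional space-time of signature $(+,-,-,-)$ and $F$ a smooth 2-form on $M$ such that the source-free Einstein–Maxwell equations $$R_{ab}=2k\,\phi_{AB}\bar\phi_{A'B'}=k\left(\tfrac14 g_{ab}F_{cd}F^{cd}-F_{ac}F_b{}^{c}\right),\qquad dF=0,\qquad \nabla^aF_{ab}=0$$ hold for some constant $k>0$ (the Ricci tensor is taken with the sign for which positive definite round spheres have positive Ricci tensor). Suppose that $(M,g,F)$ has a smooth past null infinity $\mathcal I^-\cong\mathbb R\times S^2$, with adapted coordinates $(v,r,x^I)$, $I=2,3$, on a neighbourhood of it, as follows. * $v\in\mathbb R$, the $x^I$ are coordinates on $S^2$ (two stereographic charts), $\mathcal I^-=\{r=0\}$ with all $v\in\mathbb R$ and all points of $S^2$ occurring, and an open part of $M$ corresponds to $\{r>0\}$. The coordinate range consists of the neighbourhood of $\mathcal I^-$ swept out by initial segments $0\le r<r_{\max}(v,x)$ of the coordinate lines of $r$. * There is a conformal factor $\Omega>0$ on $\{r>0\}$ such that $\Omega$, the unphysical metric $\hat g=\Omega^2g$ and the components of $F$ extend smoothly through $r=0$,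 with $\Omega=0$ and $\partial\Omega/\partial r=1$ on $\mathcal I^-$. * $\hat g_{rv}=1$ and $\hat g_{rr}=\hat g_{rI}=0$, that is, $\partial/\partial r$ is the null gradient of $v$, so the hypersurfaces $v=\mathrm{const}$ are null and $r$ is an affine parameter along their generators. On $\mathcal I^-$: $\hat g_{vv}=\hat g_{vI}=0$, $\partial_r\hat g_{vv}=0$ (so $\partial/\partial v$ is tangent to the null generators of $\mathcal I^-$, orthogonal to the cuts $v=\mathrm{const}$, and $v$ is an affine parameter), and $-\hat g_{IJ}$ is the unit round metric of $S^2$. **Corollary 1.2.** Suppose that $\Omega$, $\hat g$ and $F$ are analytic in these coordinates on the whole coordinate range, including $\mathcal I^-$, and that $g$ is stationary there with Killing vector $K=\partial/\partial v$, i.e. $\mathcal L_Kg=0$ for $r>0$. Then the Maxwell field is stationary as well: $\mathcal L_KF=0$, i.e. $\partial_vF_{\mu\nu}=0$, at every point with $r>0$ of the coordinate range. -/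

import Mathlib

open scoped Manifold ContDiff

noncomputable section

namespace Electrovac

/-- Coordinate space `ℝ⁴`. Adapted coordinates near past null infinity are ordered as
`(v, r, x², x³) = (y 0, y 1, y 2, y 3)`. -/
abbrev Coord : Type := Fin 4 → ℝ

/-- The partial derivative `∂_i f`. -/
def pd (i : Fin 4) (f : Coord → ℝ) (y : Coord) : ℝ :=
  fderiv ℝ f y (Pi.single i 1)

/-! ### Local formulas for a metric `G` and a 2-form `F` given by their component matrices -/

/-- Christoffel symbols `Γ^a_{bc} = ½ g^{ad} (∂_b g_{dc} + ∂_c g_{db} - ∂_d g_{bc})`. -/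
def christoffel (G : Coord → Matrix (Fin 4) (Fin 4) ℝ) (a b c : Fin 4) (y : Coord) : ℝ :=
  (1 / 2) * ∑ d, (G y)⁻¹ a d *
    (pd b (fun z => G z d c) y + pd c (fun z => G z d b) y - pd d (fun z => G z b c) y)

/-- Ricci tensor `R_{bc} = ∂_a Γ^a_{bc} - ∂_c Γ^a_{ba} + Γ^a_{ad} Γ^d_{bc} - Γ^a_{cd} Γ^d_{ba}`
(the sign for which round spheres with positive definite metric have positive Ricci tensor;
it is unchanged under `g ↦ -g`). -/
def ricci (G : Coord → Matrix (Fin 4) (Fin 4) ℝ) (b c : Fin 4) (y : Coord) : ℝ :=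
  ∑ a, (pd a (christoffel G a b c) y - pd c (christoffel G a b a) y
    + ∑ d, (christoffel G a a d y * christoffel G d b c y
      - christoffel G a c d y * christoffel G d b a y))

/-- `∇_c F_{ab} = ∂_c F_{ab} - Γ^d_{ca} F_{db} - Γ^d_{cb} F_{ad}`. -/
def covDeriv (G F : Coord → Matrix (Fin 4) (Fin 4) ℝ) (c a b : Fin 4) (y : Coord) : ℝ :=
  pd c (fun z => F z a b) y
    - ∑ d, (christoffel G d c a y * F y d b + christoffel G d c b y * F y a d)

/-- The electromagnetic energy tensor `½ (¼ g_{ab} F_{cd} F^{cd} - F_{ac} F_b{}^c)`, which for a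
metric of signature `(+,-,-,-)` is the tensor with spinor form `φ_{AB} φ̄_{A'B'}` where
`F_{ab} = φ_{AB} ε_{A'B'} + φ̄_{A'B'} ε_{AB}`. -/
def emTensor (G F : Coord → Matrix (Fin 4) (Fin 4) ℝ) (a b : Fin 4) (y : Coord) : ℝ :=
  (1 / 2) * ((1 / 4) * G y a b *
      (∑ c, ∑ d, ∑ c', ∑ d', (G y)⁻¹ c c' * (G y)⁻¹ d d' * F y c d * F y c' d')
    - ∑ c, ∑ d, (G y)⁻¹ c d * F y a c * F y b d)

section Manifold

variable {M : Type*} [TopologicalSpace M] [ChartedSpace Coord M]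

/-- Components `T(∂_i, ∂_j)` of a covariant 2-tensor field in the chart `e`, as functions of the
coordinates. -/
def comp (e : OpenPartialHomeomorph M Coord)
    (T : ∀ p : M, LinearMap.BilinForm ℝ (TangentSpace 𝓘(ℝ, Coord) p))
    (y : Coord) : Matrix (Fin 4) (Fin 4) ℝ :=
  fun i j => T (e.symm y)
    (mfderiv 𝓘(ℝ, Coord) 𝓘(ℝ, Coord) e.symm y (Pi.single i (1 : ℝ) : Coord))
    (mfderiv 𝓘(ℝ, Coord) 𝓘(ℝ, Coord) e.symm y (Pi.single j (1 : ℝ) : Coord))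

/-- A covariant 2-tensor field is smooth if its components in all smooth charts are. -/
def IsSmoothTensor (T : ∀ p : M, LinearMap.BilinForm ℝ (TangentSpace 𝓘(ℝ, Coord) p)) : Prop :=
  ∀ e ∈ IsManifold.maximalAtlas 𝓘(ℝ, Coord) ∞ M, ∀ i j,
    ContDiffOn ℝ ∞ (fun y => comp e T y i j) e.target

/-- A smooth Lorentz metric of signature `(+,-,-,-)`. -/
structure IsLorentzMetric
    (g : ∀ p : M, LinearMap.BilinForm ℝ (TangentSpace 𝓘(ℝ, Coord) p)) : Prop where
  smooth : IsSmoothTensor g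
  signature : ∀ p : M, ∃ b : Module.Basis (Fin 4) ℝ (TangentSpace 𝓘(ℝ, Coord) p),
    ∀ i j, g p (b i) (b j) = if i = j then (if i = 0 then 1 else -1) else 0

/-- `(M, g, F)` is an electrovac space-time: `g` is a Lorentz metric, `F` is a 2-form, and the
source-free Einstein-Maxwell equations hold in every smooth chart, `k` being the coupling
constant in `Φ_{ABA'B'} = k φ_{AB} φ̄_{A'B'}`, i.e. `R_{ab} = 2 k φ_{AB} φ̄_{A'B'}` with the sign
convention for the Ricci tensor that is used here. -/
structure IsElectrovac (k : ℝ)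
    (g F : ∀ p : M, LinearMap.BilinForm ℝ (TangentSpace 𝓘(ℝ, Coord) p)) : Prop where
  metric : IsLorentzMetric g
  smooth_field : IsSmoothTensor F
  alternating : ∀ p : M, (F p).IsAlt
  einstein : ∀ e ∈ IsManifold.maximalAtlas 𝓘(ℝ, Coord) ∞ M, ∀ y ∈ e.target, ∀ a b,
    ricci (comp e g) a b y = 2 * k * emTensor (comp e g) (comp e F) a b y
  maxwell_closed : ∀ e ∈ IsManifold.maximalAtlas 𝓘(ℝ, Coord) ∞ M, ∀ y ∈ e.target, ∀ a b c,
    pd a (fun z => comp e F z b c) y + pd b (fun z => comp e F z c a) y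
      + pd c (fun z => comp e F z a b) y = 0
  maxwell_coclosed : ∀ e ∈ IsManifold.maximalAtlas 𝓘(ℝ, Coord) ∞ M, ∀ y ∈ e.target, ∀ b,
    ∑ a, ∑ c, (comp e g y)⁻¹ a c * covDeriv (comp e g) (comp e F) c a b y = 0

/-- The transition map between the two stereographic charts of the 2-sphere (inversion in the unit
circle), extended to `(v, r, x², x³)` by the identity on `v` and `r`. -/
def inversion (y : Coord) : Coord :=
  ![y 0, y 1, y 2 / (y 2 ^ 2 + y 3 ^ 2), y 3 / (y 2 ^ 2 + y 3 ^ 2)]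

/-- A smooth past null infinity `ℐ⁻ ≅ ℝ × S²` of the space-time `(M, g, F)`, together with the
adapted coordinates `(v, r, x^I)` on a neighbourhood of it: `v` is an affine parameter along the
null generators of `ℐ⁻`, the hypersurfaces of constant `v` are null and orthogonal to the cuts
`v = const` of `ℐ⁻`, `r` is the affine parameter along their null generators with `r = 0` on `ℐ⁻`
and `g(dv, dr) = 1`, and `x^I` are coordinates on the sphere that are propagated along the
generators.

The sphere is covered by its two stereographic charts (both defined on all of `ℝ²`), indexed by
`Bool`. The unphysical space-time with its boundary corresponds to the part `0 ≤ r` of the open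
sets `dom s ⊆ ℝ⁴`, the physical one to `0 < r`, and `ℐ⁻` to `r = 0`; the unphysical metric
`Ω² g`, the conformal factor `Ω` and the (conformally invariant) field tensor `F_{ab}` have to
extend smoothly through `r = 0`. -/
structure PastNullInfinity
    (g F : ∀ p : M, LinearMap.BilinForm ℝ (TangentSpace 𝓘(ℝ, Coord) p)) where
  /-- The coordinates `(v, r, x², x³)` on the physical space-time. -/
  chart : Bool → OpenPartialHomeomorph M Coord
  chart_mem : ∀ s, chart s ∈ IsManifold.maximalAtlas 𝓘(ℝ, Coord) ∞ M
  /-- The range of the coordinates, thickened to an open neighbourhood of `r = 0`. -/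
  dom : Bool → Set Coord
  isOpen_dom : ∀ s, IsOpen (dom s)
  /-- All of `ℐ⁻ ≅ ℝ × S²` is there: `v` and the stereographic coordinates are unrestricted. -/
  scri_mem : ∀ s y, y 1 = 0 → y ∈ dom s
  /-- The range of the coordinates consists of initial pieces of the generators that issue from
  `ℐ⁻` into the space-time. -/
  ray_mem : ∀ s, ∀ y ∈ dom s, ∀ t, 0 ≤ t → t ≤ y 1 → Function.update y 1 t ∈ dom s
  target_eq : ∀ s, (chart s).target = dom s ∩ {y | 0 < y 1}
  /-- The two charts overlap off the poles of the sphere. -/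
  overlap : ∀ s, ∀ p ∈ (chart s).source,
    p ∈ (chart (!s)).source ↔ ¬ (chart s p 2 = 0 ∧ chart s p 3 = 0)
  transition : ∀ s, ∀ p ∈ (chart s).source, p ∈ (chart (!s)).source →
    chart (!s) p = inversion (chart s p)
  /-- The conformal factor (relevant only on the range of the coordinates). -/
  Ω : M → ℝ
  Ω_pos : ∀ s, ∀ p ∈ (chart s).source, 0 < Ω p
  /-- `Ω` in the coordinates, extended through `ℐ⁻`. -/
  conf : Bool → Coord → ℝ
  conf_smooth : ∀ s, ContDiffOn ℝ ∞ (conf s) (dom s)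
  conf_eq : ∀ s, ∀ y ∈ (chart s).target, conf s y = Ω ((chart s).symm y)
  /-- The components of the unphysical metric `Ω² g`, extended through `ℐ⁻`. -/
  met : Bool → Coord → Matrix (Fin 4) (Fin 4) ℝ
  met_smooth : ∀ s i j, ContDiffOn ℝ ∞ (fun y => met s y i j) (dom s)
  met_eq : ∀ s, ∀ y ∈ (chart s).target, ∀ i j,
    met s y i j = Ω ((chart s).symm y) ^ 2 * comp (chart s) g y i j
  /-- The components `F_{ab}` of the Maxwell field, extended through `ℐ⁻`. -/
  fld : Bool → Coord → Matrix (Fin 4) (Fin 4) ℝ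
  fld_smooth : ∀ s i j, ContDiffOn ℝ ∞ (fun y => fld s y i j) (dom s)
  fld_eq : ∀ s, ∀ y ∈ (chart s).target, ∀ i j, fld s y i j = comp (chart s) F y i j
  /-- `Ω = 0` on `ℐ⁻`. -/
  conf_scri : ∀ s y, y 1 = 0 → conf s y = 0
  /-- The gauge condition `∂Ω/∂r = 1` on `ℐ⁻`. -/
  conf_deriv_scri : ∀ s y, y 1 = 0 → pd 1 (conf s) y = 1
  /-- `g_{rμ} = δ_μ^v`, i.e. `∂/∂r` is the (null, geodesic) gradient of `v`. -/
  met_r : ∀ s, ∀ y ∈ dom s, 0 ≤ y 1 → ∀ j, met s y 1 j = if j = 0 then 1 else 0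
  /-- On `ℐ⁻` the vector `∂/∂v` is null and orthogonal to the cuts `v = const`. -/
  met_vv_scri : ∀ s y, y 1 = 0 → met s y 0 0 = 0
  met_v2_scri : ∀ s y, y 1 = 0 → met s y 0 2 = 0
  met_v3_scri : ∀ s y, y 1 = 0 → met s y 0 3 = 0
  /-- `v` is an affine parameter along the generators of `ℐ⁻`. -/
  met_vv_deriv_scri : ∀ s y, y 1 = 0 → pd 1 (fun z => met s z 0 0) y = 0
  /-- The cuts of `ℐ⁻` are unit round spheres. -/
  met_22_scri : ∀ s y, y 1 = 0 → met s y 2 2 = -(4 / (1 + y 2 ^ 2 + y 3 ^ 2) ^ 2)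
  met_33_scri : ∀ s y, y 1 = 0 → met s y 3 3 = -(4 / (1 + y 2 ^ 2 + y 3 ^ 2) ^ 2)
  met_23_scri : ∀ s y, y 1 = 0 → met s y 2 3 = 0

namespace PastNullInfinity

variable {g F : ∀ p : M, LinearMap.BilinForm ℝ (TangentSpace 𝓘(ℝ, Coord) p)}

/-- The (unphysical) metric, the conformal factor and the Maxwell field are analytic in the adapted
coordinates, on a neighbourhood of `ℐ⁻` and including `ℐ⁻`. -/
structure IsAnalytic (A : PastNullInfinity g F) : Prop where
  conf : ∀ s, AnalyticOnNhd ℝ (A.conf s) (A.dom s)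
  met : ∀ s i j, AnalyticOnNhd ℝ (fun y => A.met s y i j) (A.dom s)
  fld : ∀ s i j, AnalyticOnNhd ℝ (fun y => A.fld s y i j) (A.dom s)

/-- The covariant 2-tensor field `T` on the physical space-time is invariant under the vector field
`K = ∂/∂v`, i.e. `ℒ_K T = 0` on the range of the adapted coordinates: the components of `ℒ_K T`
for a coordinate vector field `K = ∂/∂v` are `∂_v T_{ij}`. For `T = g` this says that `∂/∂v` is a
Killing vector of the physical metric. -/
def IsStationary (A : PastNullInfinity g F)
    (T : ∀ p : M, LinearMap.BilinForm ℝ (TangentSpace 𝓘(ℝ, Coord) p)) : Prop :=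
  ∀ s, ∀ y ∈ (A.chart s).target, ∀ i j, pd 0 (fun z => comp (A.chart s) T z i j) y = 0

end PastNullInfinity

end Manifold

end Electrovac

end

/-! Write E = F_{rv}, P_I = F_{rI}, Q_I = F_{vI}, B = F_{23}. The Ricci tensor and Ω do not depend
on v, so the Einstein equations make the energy tensor of F stationary. This alone would still allow
F to undergo a duality rotation along v. The proof excludes such a rotation at past null infinity,
and analyticity carries the result along the coordinate lines of r.

Geometry near r = 0. The conformally transformed Einstein equations give successively Ω = r +
O(r^3), ĝ_{vI} = O(r^2) and ĝ_{vv} = r^2 + O(r^3) (`vanishTo_conf_sub`, `vanishTo_met_v`,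
`lead_met_vv`). Then the physical R_{vv} is O(r^3), whereas by the field equations its r^2
coefficient is a positive multiple of |Q|^2. Hence Q = 0 at r = 0: there is no incoming radiation
(`fld_vI_scri`).

Maxwell's equations. Suppose ∂_v P does not vanish, and let r^n f and r^m h be the leading terms of
P and ∂_v P, the orders being taken over both charts. Stationarity of T_{rI} together with
analyticity forces E = B = 0 at r = 0 (`Energy.coulomb`). Integration in r then determines E, B and
Q from P, and ∂_v P = O(r^{n+1}), with a coefficient that is a second order operator on the sphere
applied to f (`Maxwell.lead_dv`). So m ≥ n + 1, and ∂_v^2 P = r^{m+1} j + ... .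

Analysis on the sphere. In the stereographic coordinate z the pairs f, h, j become complex
functions. Stationarity of T_{rr} gives h = i q f and j = (i x - ε q^2) f with real rates q and x,
where ε = 1 if m = n + 1 and ε = 0 otherwise. Put N = n + 1, p = m - n, and let ∂ be the derivative
in z. Stationarity of T_{rI} gives N ∂q/q = p ∂f/f and N ∂x/x = (p+1) ∂f/f. Thus the conjugate of
f^p/q^N is holomorphic and q^{p+1}/x^p is locally constant. The evolution equations give 2pqx = p^2
q^2 + |∇q|^2, so x^2 ≥ q^2/4. Consequently |f|^{4p} q^{-4N} (q^{p+1}/x^p)^{2(2N+1)}, with |f| the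
length for the round metric, extends by zero to a continuous function on the whole sphere. At a
positive maximum it would be a constant times a power of |W| (1+|z|^2)^p with W holomorphic and
without zeros; but the logarithm of this is strictly subharmonic (`LeadingTerms.not_isLocalMax`,
`LeadingTerms.false_of_sphere`). Hence ∂_v P = 0, and the radial Maxwell equations make the other
components stationary too (`Coeffs.dv_eq_zero`). -/

noncomputable section
open scoped Manifold ContDiff
open Set Filter Topology
-- Smooth dependence of integrals on parameters.
namespace Electrovac

/-- The set of parameters for which the whole segment `[0, 1]` of integration lies in an open set
is open. -/
theorem isOpen_forall_Icc {V : Set (Coord × ℝ)} (hV : IsOpen V) :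
    IsOpen {y : Coord | ∀ t ∈ Icc (0 : ℝ) 1, (y, t) ∈ V} := by
  rw [isOpen_iff_mem_nhds]
  intro y hy
  have h : ({y} : Set Coord) ×ˢ Icc (0 : ℝ) 1 ⊆ V := by
    rintro ⟨a, t⟩ ⟨ha, ht⟩
    rw [mem_singleton_iff] at ha
    simp only at ha ht
    subst ha
    exact hy t ht
  obtain ⟨u, v, hu, hv, hyu, hIv, huv⟩ :=
    generalized_tube_lemma isCompact_singleton (isCompact_Icc (a := (0 : ℝ)) (b := 1)) hV h
  filter_upwards [hu.mem_nhds (hyu (mem_singleton y))] with z hz t ht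
  exact huv ⟨hz, hIv ht⟩

/-- Differentiation under the integral sign. A dominating constant exists because the derivative is
bounded on the compact product of a small closed ball around `y` with [0, 1], which lies in `V`. -/
theorem hasFDerivAt_integral_Icc {F : Type} [NormedAddCommGroup F] [NormedSpace ℝ F]
    [CompleteSpace F] {V : Set (Coord × ℝ)} (hV : IsOpen V) {Φ : Coord → ℝ → F}
    (hΦ : ContDiffOn ℝ 1 (fun q : Coord × ℝ => Φ q.1 q.2) V)
    {y : Coord} (hy : ∀ t ∈ Icc (0 : ℝ) 1, (y, t) ∈ V) :
    HasFDerivAt (fun z => ∫ t in (0 : ℝ)..1, Φ z t)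
      (∫ t in (0 : ℝ)..1, (fderiv ℝ (fun q : Coord × ℝ => Φ q.1 q.2) (y, t)).comp
        (ContinuousLinearMap.inl ℝ Coord ℝ)) y := by
  have hU := isOpen_forall_Icc hV
  obtain ⟨ε, hε, hball⟩ := Metric.nhds_basis_closedBall.mem_iff.1 (hU.mem_nhds hy)
  have hK : IsCompact (Metric.closedBall y ε ×ˢ Icc (0 : ℝ) 1) :=
    (isCompact_closedBall y ε).prod isCompact_Icc
  have hKV : Metric.closedBall y ε ×ˢ Icc (0 : ℝ) 1 ⊆ V := fun q hq => hball hq.1 q.2 hq.2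
  have hc' : ContinuousOn (fun q : Coord × ℝ => (fderiv ℝ (fun q : Coord × ℝ => Φ q.1 q.2) q).comp
      (ContinuousLinearMap.inl ℝ Coord ℝ)) V :=
    (hΦ.continuousOn_fderiv_of_isOpen hV le_rfl).clm_comp continuousOn_const
  obtain ⟨C, hC⟩ := hK.exists_bound_of_continuousOn (hc'.mono hKV)
  have hline : ∀ z ∈ Metric.closedBall y ε,
      ContinuousOn (fun t => Φ z t) (Icc (0 : ℝ) 1) := by
    intro z hz
    exact hΦ.continuousOn.comp (f := fun t : ℝ => (z, t)) (by fun_prop)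
      (fun t ht => hball hz t ht)
  have hΙ : uIoc (0 : ℝ) 1 ⊆ Icc 0 1 := by
    rw [uIoc_of_le zero_le_one]; exact Ioc_subset_Icc_self
  have hcl : ContinuousOn (fun t : ℝ => (fderiv ℝ (fun q : Coord × ℝ => Φ q.1 q.2) (y, t)).comp
      (ContinuousLinearMap.inl ℝ Coord ℝ)) (Icc 0 1) :=
    hc'.comp (f := fun t : ℝ => (y, t)) (by fun_prop) (fun t ht => hy t ht)
  refine intervalIntegral.hasFDerivAt_integral_of_dominated_of_fderiv_le
    (s := Metric.ball y ε) (bound := fun _ => C)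
    (F' := fun z t => (fderiv ℝ (fun q : Coord × ℝ => Φ q.1 q.2) (z, t)).comp
        (ContinuousLinearMap.inl ℝ Coord ℝ)) (Metric.ball_mem_nhds y hε) ?_ ?_ ?_ ?_ ?_ ?_
  · filter_upwards [Metric.ball_mem_nhds y hε] with z hz
    exact ((hline z (Metric.ball_subset_closedBall hz)).mono hΙ).aestronglyMeasurable
      measurableSet_uIoc
  · apply ContinuousOn.intervalIntegrable
    rw [uIcc_of_le zero_le_one]
    exact hline y (Metric.mem_closedBall_self hε.le)
  · exact (hcl.mono hΙ).aestronglyMeasurable measurableSet_uIoc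
  · refine Eventually.of_forall fun t ht z hz => ?_
    exact hC (z, t) ⟨Metric.ball_subset_closedBall hz, hΙ ht⟩
  · exact intervalIntegrable_const
  · refine Eventually.of_forall fun t ht z hz => ?_
    have h1 : HasFDerivAt (fun q : Coord × ℝ => Φ q.1 q.2)
        (fderiv ℝ (fun q : Coord × ℝ => Φ q.1 q.2) (z, t)) (z, t) :=
      ((hΦ.differentiableOn one_ne_zero).differentiableAt
        (hV.mem_nhds (hball (Metric.ball_subset_closedBall hz) t (hΙ ht)))).hasFDerivAt
    exact HasFDerivAt.comp (f := fun e : Coord => (e, t)) z h1 (hasFDerivAt_prodMk_left z t)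

/-- Induction on the order of differentiability. The target space is quantified inside the
induction, because the derivative is again such an integral, with values in a space of linear maps.
-/
theorem contDiffOn_integral_Icc_nat {V : Set (Coord × ℝ)} (hV : IsOpen V) (n : ℕ) :
    ∀ {F : Type} [NormedAddCommGroup F] [NormedSpace ℝ F] [CompleteSpace F]
      {Φ : Coord → ℝ → F}, ContDiffOn ℝ ∞ (fun q : Coord × ℝ => Φ q.1 q.2) V →
      ContDiffOn ℝ n (fun z => ∫ t in (0 : ℝ)..1, Φ z t)
        {y : Coord | ∀ t ∈ Icc (0 : ℝ) 1, (y, t) ∈ V} := by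
  have hU := isOpen_forall_Icc hV
  induction n with
  | zero =>
    intro F _ _ _ Φ hΦ
    rw [Nat.cast_zero, contDiffOn_zero]
    intro y hy
    exact (hasFDerivAt_integral_Icc hV (hΦ.of_le (by simp)) hy).continuousAt.continuousWithinAt
  | succ n ih =>
    intro F _ _ _ Φ hΦ
    have hd := fun y hy => hasFDerivAt_integral_Icc (y := y) hV (hΦ.of_le (by simp)) hy
    rw [Nat.cast_succ, contDiffOn_succ_iff_fderiv_of_isOpen hU]
    refine ⟨fun y hy => (hd y hy).differentiableAt.differentiableWithinAt, by simp, ?_⟩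
    have h1 : ContDiffOn ℝ ∞ (fun q : Coord × ℝ =>
        (fderiv ℝ (fun q : Coord × ℝ => Φ q.1 q.2) (q.1, q.2)).comp
          (ContinuousLinearMap.inl ℝ Coord ℝ)) V :=
      (hΦ.fderiv_of_isOpen hV (m := ∞) (by simp)).clm_comp contDiffOn_const
    exact (ih h1).congr fun y hy => (hd y hy).fderiv

theorem contDiffOn_integral_Icc {V : Set (Coord × ℝ)} (hV : IsOpen V) {Φ : Coord → ℝ → ℝ}
    (hΦ : ContDiffOn ℝ ∞ (fun q : Coord × ℝ => Φ q.1 q.2) V) :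
    ContDiffOn ℝ ∞ (fun z => ∫ t in (0 : ℝ)..1, Φ z t)
      {y : Coord | ∀ t ∈ Icc (0 : ℝ) 1, (y, t) ∈ V} :=
  contDiffOn_infty.2 fun n => contDiffOn_integral_Icc_nat hV n hΦ

end Electrovac

end

/-! ### Calculus of leading terms at r = 0. -/

noncomputable section
open scoped Manifold ContDiff
open Set Filter Topology
namespace Electrovac

/-! ### Partial derivatives -/

theorem pd_congr {i : Fin 4} {f g : Coord → ℝ} {y : Coord} (h : f =ᶠ[𝓝 y] g) :
    pd i f y = pd i g y := by
  rw [pd, pd, h.fderiv_eq]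

theorem pd_congr_of_isOpen {O : Set Coord} (hO : IsOpen O) {i : Fin 4} {f g : Coord → ℝ}
    (h : ∀ z ∈ O, f z = g z) {y : Coord} (hy : y ∈ O) : pd i f y = pd i g y :=
  pd_congr (by filter_upwards [hO.mem_nhds hy] with z hz using h z hz)

@[simp] theorem pd_const (i : Fin 4) (a : ℝ) (y : Coord) : pd i (fun _ => a) y = 0 := by
  simp [pd]

theorem pd_coord (i j : Fin 4) (y : Coord) :
    pd i (fun z => z j) y = if j = i then 1 else 0 := by
  have : fderiv ℝ (fun z : Coord => z j) y = ContinuousLinearMap.proj j :=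
    (ContinuousLinearMap.proj (R := ℝ) (φ := fun _ : Fin 4 => ℝ) j).fderiv
  rw [pd, this]
  simp [Pi.single_apply]

theorem pd_add {i : Fin 4} {f g : Coord → ℝ} {y : Coord} (hf : DifferentiableAt ℝ f y)
    (hg : DifferentiableAt ℝ g y) : pd i (fun z => f z + g z) y = pd i f y + pd i g y := by
  simp only [pd]; rw [fderiv_fun_add hf hg]; rfl

theorem pd_sub {i : Fin 4} {f g : Coord → ℝ} {y : Coord} (hf : DifferentiableAt ℝ f y)
    (hg : DifferentiableAt ℝ g y) : pd i (fun z => f z - g z) y = pd i f y - pd i g y := by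
  simp only [pd]; rw [fderiv_fun_sub hf hg]; rfl

theorem pd_neg {i : Fin 4} {f : Coord → ℝ} {y : Coord} :
    pd i (fun z => - f z) y = - pd i f y := by
  simp only [pd]; rw [fderiv_fun_neg]; rfl

theorem pd_mul {i : Fin 4} {f g : Coord → ℝ} {y : Coord} (hf : DifferentiableAt ℝ f y)
    (hg : DifferentiableAt ℝ g y) :
    pd i (fun z => f z * g z) y = f y * pd i g y + pd i f y * g y := by
  simp only [pd]; rw [fderiv_fun_mul hf hg]
  simp [mul_comm]

theorem pd_sum {ι : Type*} {i : Fin 4} (s : Finset ι) {f : ι → Coord → ℝ} {y : Coord}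
    (hf : ∀ a ∈ s, DifferentiableAt ℝ (f a) y) :
    pd i (fun z => ∑ a ∈ s, f a z) y = ∑ a ∈ s, pd i (f a) y := by
  simp only [pd]; rw [fderiv_fun_sum hf]; simp

theorem pd_pow {i : Fin 4} {f : Coord → ℝ} {y : Coord} (hf : DifferentiableAt ℝ f y) (n : ℕ) :
    pd i (fun z => f z ^ n) y = n * f y ^ (n - 1) * pd i f y := by
  simp only [pd]; rw [fderiv_fun_pow n hf]; simp

theorem pd_inv {i : Fin 4} {f : Coord → ℝ} {y : Coord} (hf : DifferentiableAt ℝ f y)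
    (h0 : f y ≠ 0) : pd i (fun z => (f z)⁻¹) y = - pd i f y / f y ^ 2 := by
  have h := (hasDerivAt_inv h0).comp_hasFDerivAt y hf.hasFDerivAt
  have h2 : (fun z => (f z)⁻¹) = (fun x : ℝ => x⁻¹) ∘ f := rfl
  simp only [pd]; rw [h2, h.fderiv]; simp; ring

theorem pd_eq_lineDeriv {i : Fin 4} {f : Coord → ℝ} {y : Coord} (hf : DifferentiableAt ℝ f y) :
    pd i f y = lineDeriv ℝ f y (Pi.single i 1) := (hf.lineDeriv_eq_fderiv).symm

theorem _root_.ContDiffOn.pderiv {O : Set Coord} (hO : IsOpen O) {f : Coord → ℝ} (hf : ContDiffOn ℝ ∞ f O)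
    (i : Fin 4) : ContDiffOn ℝ ∞ (pd i f) O :=
  (hf.fderiv_of_isOpen hO (m := ∞) (by simp)).clm_apply contDiffOn_const

theorem _root_.AnalyticOnNhd.pderiv {O : Set Coord} {f : Coord → ℝ} (hf : AnalyticOnNhd ℝ f O)
    (i : Fin 4) : AnalyticOnNhd ℝ (pd i f) O := fun y hy =>
  ((ContinuousLinearMap.apply ℝ ℝ (Pi.single i 1 : Coord)).analyticAt _).comp (hf.fderiv y hy)

theorem _root_.ContDiffOn.diffAt {O : Set Coord} (hO : IsOpen O) {f : Coord → ℝ}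
    (hf : ContDiffOn ℝ ∞ f O) {y : Coord} (hy : y ∈ O) : DifferentiableAt ℝ f y :=
  (hf.differentiableOn (by simp)).differentiableAt (hO.mem_nhds hy)

theorem pd_comm {O : Set Coord} (hO : IsOpen O) {f : Coord → ℝ} (hf : ContDiffOn ℝ ∞ f O)
    {y : Coord} (hy : y ∈ O) (i j : Fin 4) :
    pd i (pd j f) y = pd j (pd i f) y := by
  have hs : IsSymmSndFDerivAt ℝ f y :=
    (hf.contDiffAt (hO.mem_nhds hy)).isSymmSndFDerivAt (by simp; exact WithTop.coe_le_coe.2 le_top)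
  have hd : DifferentiableAt ℝ (fderiv ℝ f) y :=
    (((hf.fderiv_of_isOpen hO (m := ∞) (by simp)).differentiableOn (by simp)).differentiableAt
      (hO.mem_nhds hy))
  have key : ∀ a b : Fin 4, pd a (pd b f) y
      = fderiv ℝ (fderiv ℝ f) y (Pi.single a 1) (Pi.single b 1) := by
    intro a b
    have : pd b f = fun z => fderiv ℝ f z (Pi.single b 1) := rfl
    rw [this, pd, fderiv_clm_apply hd (differentiableAt_const _)]
    simp
  rw [key, key, hs.eq]

/-! ### Neighbourhoods of `r = 0` and division by powers of `r` -/

/-- An open neighbourhood of `r = 0` that contains, with each point, the coordinate line of `r`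
which joins it to `r = 0`. -/
structure ScriNbhd (D : Set Coord) : Prop where
  isOpen : IsOpen D
  scri_mem : ∀ y : Coord, y 1 = 0 → y ∈ D
  star : ∀ y ∈ D, ∀ t ∈ Icc (0 : ℝ) 1, Function.update y 1 (t * y 1) ∈ D

theorem contDiff_update_scale :
    ContDiff ℝ ∞ (fun q : Coord × ℝ => (Function.update q.1 1 (q.2 * q.1 1) : Coord)) := by
  rw [contDiff_pi]
  intro i
  by_cases hi : i = 1
  · subst hi
    simp only [Function.update_self]
    fun_prop
  · simp only [Function.update_of_ne hi]
    fun_prop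

/-- The largest such neighbourhood in a given open neighbourhood of `r = 0`. -/
theorem scriNbhd_star {O : Set Coord} (hO : IsOpen O) (h : ∀ y : Coord, y 1 = 0 → y ∈ O) :
    ScriNbhd {y | ∀ t ∈ Icc (0 : ℝ) 1, Function.update y 1 (t * y 1) ∈ O} := by
  refine ⟨?_, ?_, ?_⟩
  · exact isOpen_forall_Icc (V := (fun q : Coord × ℝ =>
      (Function.update q.1 1 (q.2 * q.1 1) : Coord)) ⁻¹' O)
      (hO.preimage contDiff_update_scale.continuous)
  · intro y hy t _
    apply h
    simp [hy]
  · intro y hy t ht u hu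
    have := hy (u * t) ⟨mul_nonneg hu.1 ht.1, mul_le_one₀ hu.2 ht.1 ht.2⟩
    simpa [mul_assoc] using this

variable {D : Set Coord}

/-- Hadamard's lemma: the quotient is the integral of ∂_r f over the segment from r = 0 to the given
point, hence smooth. -/
theorem ScriNbhd.exists_eq_mul (hD : ScriNbhd D) {f : Coord → ℝ} (hf : ContDiffOn ℝ ∞ f D)
    (h0 : ∀ y : Coord, y 1 = 0 → f y = 0) :
    ∃ φ : Coord → ℝ, ContDiffOn ℝ ∞ φ D ∧ ∀ y ∈ D, f y = y 1 * φ y := by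
  have hg : ContDiffOn ℝ ∞ (pd 1 f) D := hf.pderiv hD.isOpen 1
  refine ⟨fun y => ∫ t in (0 : ℝ)..1, pd 1 f (Function.update y 1 (t * y 1)), ?_, ?_⟩
  · have hV : IsOpen ((fun q : Coord × ℝ =>
      (Function.update q.1 1 (q.2 * q.1 1) : Coord)) ⁻¹' D) :=
      hD.isOpen.preimage contDiff_update_scale.continuous
    have := contDiffOn_integral_Icc hV
      (Φ := fun y t => pd 1 f (Function.update y 1 (t * y 1)))
      (hg.comp contDiff_update_scale.contDiffOn (fun q hq => hq))
    exact this.mono fun y hy t ht => hD.star y hy t ht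
  · intro y hy
    have hder : ∀ t ∈ uIcc (0 : ℝ) 1, HasDerivAt (fun t : ℝ => f (Function.update y 1 (t * y 1)))
        (y 1 * pd 1 f (Function.update y 1 (t * y 1))) t := by
      intro t ht
      rw [uIcc_of_le zero_le_one] at ht
      have h1 := (hf.diffAt hD.isOpen (hD.star y hy t ht)).hasFDerivAt
      have h2 : HasDerivAt (fun t : ℝ => (Function.update y 1 (t * y 1) : Coord))
          (y 1 • Pi.single 1 1) t := by
        rw [hasDerivAt_pi]
        intro i
        by_cases hi : i = 1
        · subst hi
          simpa using (hasDerivAt_id t).mul_const (y 1)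
        · simpa [Function.update_of_ne hi, hi] using hasDerivAt_const t (y i)
      have h3 := h1.comp_hasDerivAt t h2
      simpa [pd, Function.comp_def] using h3
    have hcont : ContinuousOn (fun t : ℝ => y 1 * pd 1 f (Function.update y 1 (t * y 1)))
        (uIcc (0 : ℝ) 1) := by
      rw [uIcc_of_le zero_le_one]
      refine continuousOn_const.mul (hg.continuousOn.comp (f := fun t : ℝ =>
        (Function.update y 1 (t * y 1) : Coord)) ?_ (fun t ht => hD.star y hy t ht))
      exact (contDiff_update_scale.continuous.comp
        (Continuous.prodMk_right y)).continuousOn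
    have h := intervalIntegral.integral_eq_sub_of_hasDerivAt hder hcont.intervalIntegrable
    rw [intervalIntegral.integral_const_mul] at h
    rw [h]
    simp [h0 (Function.update y 1 0) (by simp)]

/-- Two continuous functions on a neighbourhood of `r = 0` that agree for `r > 0` agree at
`r = 0`. -/
theorem ScriNbhd.eq_scri (hD : ScriNbhd D) {f g : Coord → ℝ} (hf : ContinuousOn f D)
    (hg : ContinuousOn g D) (h : ∀ y ∈ D, 0 < y 1 → f y = g y) {y : Coord} (hy : y 1 = 0) :
    f y = g y := by
  have hc : Continuous (fun t : ℝ => (Function.update y 1 t : Coord)) :=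
    continuous_const.update 1 continuous_id
  have h0 : (Function.update y 1 0 : Coord) = y := by rw [← hy]; simp
  have ht : Tendsto (fun t : ℝ => (Function.update y 1 t : Coord)) (𝓝[>] 0) (𝓝 y) := by
    have := hc.tendsto 0
    rw [h0] at this
    exact this.mono_left nhdsWithin_le_nhds
  have hyD := hD.isOpen.mem_nhds (hD.scri_mem y hy)
  have h1 := (hf.continuousAt hyD).tendsto.comp ht
  have h2 := (hg.continuousAt hyD).tendsto.comp ht
  refine tendsto_nhds_unique_of_eventuallyEq h1 h2 ?_
  filter_upwards [ht.eventually hyD, self_mem_nhdsWithin] with t ht1 ht2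
  exact h _ ht1 (by simpa using ht2)

/-- For `r > 0` the function `f` is `r ^ k` times a function that is smooth up to `r = 0`, where
it takes the values `c`. -/
def Lead (D : Set Coord) (k : ℕ) (f c : Coord → ℝ) : Prop :=
  ∃ φ : Coord → ℝ, ContDiffOn ℝ ∞ φ D ∧ (∀ y ∈ D, 0 < y 1 → f y = y 1 ^ k * φ y) ∧
    ∀ y : Coord, y 1 = 0 → φ y = c y

/-- Derivative along the `i`-th coordinate line; for `i ≠ 1` it only depends on the values at
`r = 0` when it is taken at `r = 0`. -/
def tpd (i : Fin 4) (c : Coord → ℝ) (y : Coord) : ℝ := lineDeriv ℝ c y (Pi.single i 1)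

theorem tpd_eq_pd {i : Fin 4} {c : Coord → ℝ} {y : Coord} (h : DifferentiableAt ℝ c y) :
    tpd i c y = pd i c y := (pd_eq_lineDeriv h).symm

/-- A coordinate line other than that of r stays in the hypersurface r = 0. -/
theorem tpd_congr {i : Fin 4} (hi : i ≠ 1) {c c' : Coord → ℝ}
    (h : ∀ y : Coord, y 1 = 0 → c y = c' y) {y : Coord} (hy : y 1 = 0) :
    tpd i c y = tpd i c' y := by
  have : (fun t : ℝ => c (y + t • (Pi.single i 1 : Coord)))
      = fun t : ℝ => c' (y + t • (Pi.single i 1 : Coord)) := by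
    funext t
    apply h
    simp [hy, Ne.symm hi]
  simp only [tpd, lineDeriv, this]

@[simp] theorem tpd_const (i : Fin 4) (a : ℝ) : tpd i (fun _ => a) = fun _ => 0 := by
  funext y
  simp [tpd, lineDeriv]

theorem Lead.of_smooth {f : Coord → ℝ} (hf : ContDiffOn ℝ ∞ f D) : Lead D 0 f f :=
  ⟨f, hf, fun y _ _ => by simp, fun _ _ => rfl⟩

theorem Lead.const (D : Set Coord) (a : ℝ) : Lead D 0 (fun _ => a) (fun _ => a) :=
  Lead.of_smooth contDiffOn_const

theorem Lead.congr {k : ℕ} {f g c : Coord → ℝ} (hf : Lead D k f c)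
    (h : ∀ y ∈ D, 0 < y 1 → g y = f y) : Lead D k g c := by
  obtain ⟨φ, h1, h2, h3⟩ := hf
  exact ⟨φ, h1, fun y hy h0 => by rw [h y hy h0, h2 y hy h0], h3⟩

theorem Lead.congr_lead {k : ℕ} {f c c' : Coord → ℝ} (hf : Lead D k f c)
    (h : ∀ y : Coord, y 1 = 0 → c' y = c y) : Lead D k f c' := by
  obtain ⟨φ, h1, h2, h3⟩ := hf
  exact ⟨φ, h1, h2, fun y hy => by rw [h y hy, h3 y hy]⟩

theorem Lead.add {k : ℕ} {f g c d : Coord → ℝ} (hf : Lead D k f c) (hg : Lead D k g d) :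
    Lead D k (fun y => f y + g y) (fun y => c y + d y) := by
  obtain ⟨φ, h1, h2, h3⟩ := hf
  obtain ⟨ψ, g1, g2, g3⟩ := hg
  exact ⟨fun y => φ y + ψ y, h1.add g1, fun y hy h0 => by beta_reduce; rw [h2 y hy h0, g2 y hy h0]; ring,
    fun y hy => by beta_reduce; rw [h3 y hy, g3 y hy]⟩

theorem Lead.mul {k l : ℕ} {f g c d : Coord → ℝ} (hf : Lead D k f c) (hg : Lead D l g d) :
    Lead D (k + l) (fun y => f y * g y) (fun y => c y * d y) := by
  obtain ⟨φ, h1, h2, h3⟩ := hf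
  obtain ⟨ψ, g1, g2, g3⟩ := hg
  exact ⟨fun y => φ y * ψ y, h1.mul g1,
    fun y hy h0 => by beta_reduce; rw [h2 y hy h0, g2 y hy h0]; ring, fun y hy => by beta_reduce; rw [h3 y hy, g3 y hy]⟩

theorem Lead.neg {k : ℕ} {f c : Coord → ℝ} (hf : Lead D k f c) :
    Lead D k (fun y => - f y) (fun y => - c y) := by
  obtain ⟨φ, h1, h2, h3⟩ := hf
  exact ⟨fun y => - φ y, h1.neg, fun y hy h0 => by beta_reduce; rw [h2 y hy h0]; ring,
    fun y hy => by beta_reduce; rw [h3 y hy]⟩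

theorem Lead.sub {k : ℕ} {f g c d : Coord → ℝ} (hf : Lead D k f c) (hg : Lead D k g d) :
    Lead D k (fun y => f y - g y) (fun y => c y - d y) := by
  simpa [sub_eq_add_neg] using hf.add hg.neg

theorem Lead.const_mul {k : ℕ} {f c : Coord → ℝ} (a : ℝ) (hf : Lead D k f c) :
    Lead D k (fun y => a * f y) (fun y => a * c y) := by
  have := (Lead.const D a).mul hf
  rwa [zero_add] at this

theorem Lead.pow {k : ℕ} {f c : Coord → ℝ} (hf : Lead D k f c) (n : ℕ) :
    Lead D (k * n) (fun y => f y ^ n) (fun y => c y ^ n) := by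
  induction n with
  | zero => simpa using Lead.const D 1
  | succ n ih => simpa [pow_succ, Nat.mul_succ] using ih.mul hf

theorem Lead.zero (D : Set Coord) (k : ℕ) : Lead D k (fun _ => 0) (fun _ => 0) :=
  ⟨fun _ => 0, contDiffOn_const, fun y _ _ => by simp, fun _ _ => rfl⟩

theorem Lead.div_smooth {k : ℕ} {f g c d : Coord → ℝ} (hf : Lead D k f c)
    (hg : ContDiffOn ℝ ∞ g D) (h0 : ∀ y ∈ D, g y ≠ 0) (hgd : ∀ y : Coord, y 1 = 0 → g y = d y) :
    Lead D k (fun y => f y / g y) (fun y => c y / d y) := by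
  obtain ⟨φ, h1, h2, h3⟩ := hf
  exact ⟨fun y => φ y / g y, h1.div hg h0, fun y hy hr => by beta_reduce; rw [h2 y hy hr]; ring,
    fun y hy => by beta_reduce; rw [h3 y hy, hgd y hy]⟩

theorem Lead.of_le {k l : ℕ} (hl : l < k) {f c : Coord → ℝ} (hf : Lead D k f c) :
    Lead D l f (fun _ => 0) := by
  obtain ⟨φ, h1, h2, h3⟩ := hf
  obtain ⟨j, rfl⟩ := Nat.exists_eq_add_of_lt hl
  refine ⟨fun y => y 1 ^ (j + 1) * φ y, ?_, fun y hy h0 => ?_, fun y hy => by simp [hy]⟩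
  · exact ContDiffOn.mul (by fun_prop) h1
  · rw [h2 y hy h0]; ring

/-- The same, without information on the leading coefficient. -/
theorem Lead.mono {k l : ℕ} (hl : l ≤ k) {f c : Coord → ℝ} (hf : Lead D k f c) :
    ∃ c', Lead D l f c' := by
  rcases hl.lt_or_eq with h | h
  · exact ⟨_, hf.of_le h⟩
  · exact ⟨c, h ▸ hf⟩

/-- The power of r cancels for r > 0, and the quotients agree at r = 0 by continuity. This is how
equations that hold only for r > 0 become equations between leading coefficients. -/
theorem Lead.unique (hD : ScriNbhd D) {k : ℕ} {f c d : Coord → ℝ} (hf : Lead D k f c)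
    (hg : Lead D k f d) {y : Coord} (hy : y 1 = 0) : c y = d y := by
  obtain ⟨φ, h1, h2, h3⟩ := hf
  obtain ⟨ψ, g1, g2, g3⟩ := hg
  rw [← h3 y hy, ← g3 y hy]
  refine hD.eq_scri h1.continuousOn g1.continuousOn (fun z hz h0 => ?_) hy
  have := (h2 z hz h0).symm.trans (g2 z hz h0)
  exact mul_left_cancel₀ (pow_ne_zero k h0.ne') this

theorem Lead.raise (hD : ScriNbhd D) {k : ℕ} {f c : Coord → ℝ} (hf : Lead D k f c)
    (hc : ∀ y : Coord, y 1 = 0 → c y = 0) : ∃ c', Lead D (k + 1) f c' := by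
  obtain ⟨φ, h1, h2, h3⟩ := hf
  obtain ⟨ψ, g1, g2⟩ := hD.exists_eq_mul h1 (fun y hy => by rw [h3 y hy, hc y hy])
  refine ⟨ψ, ψ, g1, fun y hy h0 => ?_, fun _ _ => rfl⟩
  rw [h2 y hy h0, g2 y hy]; ring

theorem ScriNbhd.isOpen_pos (hD : ScriNbhd D) : IsOpen (D ∩ {y | 0 < y 1}) :=
  hD.isOpen.inter (isOpen_lt continuous_const (continuous_apply 1))

theorem Lead.pd_zero (hD : ScriNbhd D) {f c : Coord → ℝ} (hf : Lead D 0 f c) (i : Fin 4) :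
    ∃ c', Lead D 0 (pd i f) c' := by
  obtain ⟨φ, h1, h2, -⟩ := hf
  refine ⟨pd i φ, pd i φ, h1.pderiv hD.isOpen i, fun y hy h0 => ?_, fun _ _ => rfl⟩
  rw [pow_zero, one_mul]
  exact pd_congr_of_isOpen hD.isOpen_pos (fun z hz => by simpa using h2 z hz.1 hz.2) ⟨hy, h0⟩

theorem differentiableAt_coord_pow (j : Fin 4) (k : ℕ) (y : Coord) :
    DifferentiableAt ℝ (fun z : Coord => z j ^ k) y := by fun_prop

theorem Lead.pd_tan (hD : ScriNbhd D) {k : ℕ} {f c : Coord → ℝ} (hf : Lead D k f c) {i : Fin 4}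
    (hi : i ≠ 1) : Lead D k (pd i f) (tpd i c) := by
  obtain ⟨φ, h1, h2, h3⟩ := hf
  refine ⟨pd i φ, h1.pderiv hD.isOpen i, fun y hy h0 => ?_, fun y hy => ?_⟩
  · rw [pd_congr_of_isOpen hD.isOpen_pos (fun z hz => h2 z hz.1 hz.2) ⟨hy, h0⟩,
      pd_mul (differentiableAt_coord_pow 1 k y) (h1.diffAt hD.isOpen hy),
      pd_pow (by fun_prop), pd_coord]
    simp [Ne.symm hi]
  · rw [← tpd_eq_pd (h1.diffAt hD.isOpen (hD.scri_mem y hy))]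
    exact tpd_congr hi h3 hy

theorem Lead.pd_one (hD : ScriNbhd D) {k : ℕ} {f c : Coord → ℝ} (hf : Lead D (k + 1) f c) :
    Lead D k (pd 1 f) (fun y => (k + 1) * c y) := by
  obtain ⟨φ, h1, h2, h3⟩ := hf
  refine ⟨fun y => (k + 1) * φ y + y 1 * pd 1 φ y, ?_, fun y hy h0 => ?_, fun y hy => ?_⟩
  · exact (contDiffOn_const.mul h1).add (ContDiffOn.mul (by fun_prop) (h1.pderiv hD.isOpen 1))
  · rw [pd_congr_of_isOpen hD.isOpen_pos (fun z hz => h2 z hz.1 hz.2) ⟨hy, h0⟩,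
      pd_mul (differentiableAt_coord_pow 1 (k + 1) y) (h1.diffAt hD.isOpen hy),
      pd_pow (by fun_prop), pd_coord]
    simp
    ring
  · simp [hy, h3 y hy]

/-- Integration of an equation `∂_r u = r ^ n w`. -/
theorem Lead.integrate (hD : ScriNbhd D) {n : ℕ} {u w : Coord → ℝ}
    (hu : Lead D 0 u (fun _ => 0)) (hw : Lead D n (pd 1 u) w) :
    Lead D (n + 1) u (fun y => w y / (n + 1)) := by
  -- The order of `u` is raised one by one: if u = c r^(k+1) + ... with k < n, then ∂_r u = (k+1) c
  -- r^k + ... is O(r^n), so c = 0 on r = 0.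
  have key : ∀ k ≤ n, ∃ c, Lead D (k + 1) u c := by
    intro k
    induction k with
    | zero => exact fun _ => hu.raise hD (fun _ _ => rfl)
    | succ k ih =>
      intro hk
      obtain ⟨c, hc⟩ := ih (by omega)
      refine hc.raise hD fun y hy => ?_
      have := (hc.pd_one hD).unique hD (hw.of_le (by omega)) hy
      rcases mul_eq_zero.1 this with h | h
      · exact absurd h (by positivity)
      · exact h
  obtain ⟨c, hc⟩ := key n le_rfl
  refine hc.congr_lead fun y hy => ?_
  rw [← (hc.pd_one hD).unique hD hw hy]
  field_simp

end Electrovac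

end

/-! ### Maxwell's equations near r = 0 and their leading terms. -/

noncomputable section
open scoped Manifold ContDiff
open Set Filter Topology
namespace Electrovac

variable {D : Set Coord}

theorem tpd_neg (i : Fin 4) (c : Coord → ℝ) (y : Coord) :
    tpd i (fun z => - c z) y = - tpd i c y := by
  simp only [tpd, lineDeriv]
  exact deriv.fun_neg

theorem Lead.of_smooth_zero {f : Coord → ℝ} (hf : ContDiffOn ℝ ∞ f D)
    (h : ∀ y : Coord, y 1 = 0 → f y = 0) : Lead D 0 f (fun _ => 0) :=
  (Lead.of_smooth hf).congr_lead fun y hy => (h y hy).symm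

theorem Lead.differentiableAt (hD : ScriNbhd D) {k : ℕ} {f c : Coord → ℝ} (hf : Lead D k f c)
    {y : Coord} (hy : y ∈ D) (h0 : 0 < y 1) : DifferentiableAt ℝ f y := by
  obtain ⟨φ, h1, h2, -⟩ := hf
  have : DifferentiableAt ℝ (fun z : Coord => z 1 ^ k * φ z) y :=
    (differentiableAt_coord_pow 1 k y).mul (h1.diffAt hD.isOpen hy)
  refine this.congr_of_eventuallyEq ?_
  filter_upwards [hD.isOpen_pos.mem_nhds ⟨hy, h0⟩] with z hz using h2 z hz.1 hz.2

/-- The components `F_{rv}, F_{r2}, F_{r3}, F_{v2}, F_{v3}, F_{23}` of a 2-form. -/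
structure Field where
  E : Coord → ℝ
  P2 : Coord → ℝ
  P3 : Coord → ℝ
  Q2 : Coord → ℝ
  Q3 : Coord → ℝ
  B : Coord → ℝ

/-- The derivative of a field along `∂/∂v`. -/
def Field.dv (X : Field) : Field :=
  ⟨pd 0 X.E, pd 0 X.P2, pd 0 X.P3, pd 0 X.Q2, pd 0 X.Q3, pd 0 X.B⟩

/-- Smoothness of all components. -/
structure Field.Smooth (D : Set Coord) (X : Field) : Prop where
  E : ContDiffOn ℝ ∞ X.E D
  P2 : ContDiffOn ℝ ∞ X.P2 D
  P3 : ContDiffOn ℝ ∞ X.P3 D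
  Q2 : ContDiffOn ℝ ∞ X.Q2 D
  Q3 : ContDiffOn ℝ ∞ X.Q3 D
  B : ContDiffOn ℝ ∞ X.B D

/-- A function that is invariant under `∂/∂v` for `r > 0` and vanishes at `r = 0` like `r ^ k`. -/
def Coeff (D : Set Coord) (k : ℕ) (f c : Coord → ℝ) : Prop :=
  Lead D k f c ∧ ∀ y ∈ D, 0 < y 1 → pd 0 f y = 0

/-- The coefficients of the relation between a 2-form and its dual near `r = 0`. -/
structure Coeffs (D : Set Coord) where
  s : Coord → ℝ
  K22 : Coord → ℝ
  K23 : Coord → ℝ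
  K33 : Coord → ℝ
  S2 : Coord → ℝ
  S3 : Coord → ℝ
  A2E : Coord → ℝ
  A22 : Coord → ℝ
  A23 : Coord → ℝ
  A2B : Coord → ℝ
  A3E : Coord → ℝ
  A32 : Coord → ℝ
  A33 : Coord → ℝ
  A3B : Coord → ℝ
  R2 : Coord → ℝ
  R3 : Coord → ℝ
  smooth_s : ContDiffOn ℝ ∞ s D
  pos_s : ∀ y ∈ D, 0 < s y
  dv_s : ∀ y ∈ D, 0 < y 1 → pd 0 s y = 0
  lead_K22 : Coeff D 0 K22 (fun _ => -1)
  lead_K23 : Coeff D 0 K23 (fun _ => 0)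
  lead_K33 : Coeff D 0 K33 (fun _ => -1)
  lead_S2 : Coeff D 1 S2 (fun _ => 0)
  lead_S3 : Coeff D 1 S3 (fun _ => 0)
  lead_A2E : Coeff D 1 A2E (fun _ => 0)
  lead_A3E : Coeff D 1 A3E (fun _ => 0)
  lead_A2B : Coeff D 1 A2B (fun _ => 0)
  lead_A3B : Coeff D 1 A3B (fun _ => 0)
  lead_A22 : Coeff D 2 A22 (fun _ => 1)
  lead_A23 : Coeff D 2 A23 (fun _ => 0)
  lead_A32 : Coeff D 2 A32 (fun _ => 0)
  lead_A33 : Coeff D 2 A33 (fun _ => 1)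
  lead_R2 : Coeff D 1 R2 (fun _ => 0)
  lead_R3 : Coeff D 1 R3 (fun _ => 0)

namespace Coeffs

variable (C : Coeffs D) (X : Field)

/-- The component `*F_{23}` of the dual, as a density. -/
def fluxVR (y : Coord) : ℝ := C.s y * X.E y + (C.S2 y * X.P2 y + C.S3 y * X.P3 y)

/-- In the application the functions `fluxVR`, `fluxV2`, `fluxV3`, `fluxR2`, `fluxR3`, `flux23` are
the densities √det · F^{ab}, with indices raised by the unphysical metric. Only the F_{rI} enter
F^{vI}, since g^{vv} = g^{vI} = 0 and g^{vr} = 1. -/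
def fluxV2 (y : Coord) : ℝ := C.K22 y * X.P2 y + C.K23 y * X.P3 y

def fluxV3 (y : Coord) : ℝ := C.K23 y * X.P2 y + C.K33 y * X.P3 y

def fluxR2 (y : Coord) : ℝ := (C.K22 y * X.Q2 y + C.K23 y * X.Q3 y)
  + ((C.A2E y * X.E y + C.A2B y * X.B y) + (C.A22 y * X.P2 y + C.A23 y * X.P3 y))

def fluxR3 (y : Coord) : ℝ := (C.K23 y * X.Q2 y + C.K33 y * X.Q3 y)
  + ((C.A3E y * X.E y + C.A3B y * X.B y) + (C.A32 y * X.P2 y + C.A33 y * X.P3 y))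

def flux23 (y : Coord) : ℝ := X.B y / C.s y + (C.R2 y * X.P2 y + C.R3 y * X.P3 y)

/-- The source-free Maxwell equations for `r > 0`. -/
structure Maxwell : Prop where
  closed_r23 : ∀ y ∈ D, 0 < y 1 → pd 1 X.B y = pd 2 X.P3 y - pd 3 X.P2 y
  closed_v23 : ∀ y ∈ D, 0 < y 1 → pd 0 X.B y = pd 2 X.Q3 y - pd 3 X.Q2 y
  closed_vr2 : ∀ y ∈ D, 0 < y 1 → pd 1 X.Q2 y = pd 0 X.P2 y - pd 2 X.E y
  closed_vr3 : ∀ y ∈ D, 0 < y 1 → pd 1 X.Q3 y = pd 0 X.P3 y - pd 3 X.E y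
  coclosed_v : ∀ y ∈ D, 0 < y 1 →
    pd 1 (C.fluxVR X) y = -(pd 2 (C.fluxV2 X) y + pd 3 (C.fluxV3 X) y)
  coclosed_r : ∀ y ∈ D, 0 < y 1 →
    pd 0 (C.fluxVR X) y = pd 2 (C.fluxR2 X) y + pd 3 (C.fluxR3 X) y
  coclosed_2 : ∀ y ∈ D, 0 < y 1 →
    pd 1 (C.fluxR2 X) y = -pd 0 (C.fluxV2 X) y + pd 3 (C.flux23 X) y
  coclosed_3 : ∀ y ∈ D, 0 < y 1 →
    pd 1 (C.fluxR3 X) y = -pd 0 (C.fluxV3 X) y - pd 2 (C.flux23 X) y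

variable {C X}

theorem lead_fluxV2 {k : ℕ} {p2 p3 : Coord → ℝ} (h2 : Lead D k X.P2 p2) (h3 : Lead D k X.P3 p3) :
    Lead D k (C.fluxV2 X) (fun y => - p2 y) := by
  have := (C.lead_K22.1.mul h2).add (C.lead_K23.1.mul h3)
  rw [zero_add] at this
  exact this.congr_lead fun y _ => by ring

theorem lead_fluxV3 {k : ℕ} {p2 p3 : Coord → ℝ} (h2 : Lead D k X.P2 p2) (h3 : Lead D k X.P3 p3) :
    Lead D k (C.fluxV3 X) (fun y => - p3 y) := by
  have := (C.lead_K23.1.mul h2).add (C.lead_K33.1.mul h3)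
  rw [zero_add] at this
  exact this.congr_lead fun y _ => by ring

theorem lead_mul_of_one {k : ℕ} {f g c : Coord → ℝ} (hf : Coeff D 1 f (fun _ => 0))
    (hg : Lead D k g c) : Lead D (k + 1) (fun y => f y * g y) (fun _ => 0) := by
  have := hf.1.mul hg
  rw [add_comm 1 k] at this
  exact this.congr_lead fun y _ => by ring

theorem lead_flux23 {k : ℕ} {b p2 p3 : Coord → ℝ} (hB : Lead D (k + 1) X.B b)
    (h2 : Lead D k X.P2 p2) (h3 : Lead D k X.P3 p3) :
    Lead D (k + 1) (C.flux23 X) (fun y => b y / C.s y) := by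
  have := (hB.div_smooth C.smooth_s (fun y hy => (C.pos_s y hy).ne') (fun _ _ => rfl)).add
    ((lead_mul_of_one C.lead_R2 h2).add (lead_mul_of_one C.lead_R3 h3))
  exact this.congr_lead fun y _ => by ring

theorem lead_fluxVR {k : ℕ} {e p2 p3 : Coord → ℝ} (hE : Lead D (k + 1) X.E e)
    (h2 : Lead D k X.P2 p2) (h3 : Lead D k X.P3 p3) :
    Lead D (k + 1) (C.fluxVR X) (fun y => C.s y * e y) := by
  have := ((Lead.of_smooth C.smooth_s).mul hE).add
    (((lead_mul_of_one C.lead_S2 h2).add (lead_mul_of_one C.lead_S3 h3)).congr_lead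
      (c' := fun _ => 0) (fun y _ => by ring) |> fun h => by rwa [← zero_add (k + 1)] at h)
  rw [zero_add] at this
  exact this.congr_lead fun y _ => by ring

theorem lead_E_of_fluxVR {k : ℕ} {u p2 p3 : Coord → ℝ} (hu : Lead D (k + 1) (C.fluxVR X) u)
    (h2 : Lead D k X.P2 p2) (h3 : Lead D k X.P3 p3) :
    Lead D (k + 1) X.E (fun y => u y / C.s y) := by
  have := (hu.sub ((lead_mul_of_one C.lead_S2 h2).add
    (lead_mul_of_one C.lead_S3 h3))).div_smooth C.smooth_s
    (fun y hy => (C.pos_s y hy).ne') (fun _ _ => rfl)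
  refine (this.congr fun y hy _ => ?_).congr_lead fun y _ => by ring
  have := (C.pos_s y hy).ne'
  simp only [fluxVR]
  field_simp
  ring

theorem lead_fluxR2 {k : ℕ} {e b p2 p3 q2 q3 : Coord → ℝ} (hE : Lead D k X.E e)
    (hB : Lead D k X.B b) (h2 : Lead D k X.P2 p2) (h3 : Lead D k X.P3 p3)
    (hq2 : Lead D (k + 1) X.Q2 q2) (hq3 : Lead D (k + 1) X.Q3 q3) :
    Lead D (k + 1) (C.fluxR2 X) (fun y => - q2 y) := by
  have h1 := (C.lead_K22.1.mul hq2).add (C.lead_K23.1.mul hq3)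
  rw [zero_add] at h1
  have h22 := (C.lead_A22.1.mul h2).add (C.lead_A23.1.mul h3)
  have := h1.add (((lead_mul_of_one C.lead_A2E hE).add (lead_mul_of_one C.lead_A2B hB)).add
    (h22.of_le (l := k + 1) (by omega)))
  exact this.congr_lead fun y _ => by ring

theorem lead_fluxR3 {k : ℕ} {e b p2 p3 q2 q3 : Coord → ℝ} (hE : Lead D k X.E e)
    (hB : Lead D k X.B b) (h2 : Lead D k X.P2 p2) (h3 : Lead D k X.P3 p3)
    (hq2 : Lead D (k + 1) X.Q2 q2) (hq3 : Lead D (k + 1) X.Q3 q3) :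
    Lead D (k + 1) (C.fluxR3 X) (fun y => - q3 y) := by
  have h1 := (C.lead_K23.1.mul hq2).add (C.lead_K33.1.mul hq3)
  rw [zero_add] at h1
  have h22 := (C.lead_A32.1.mul h2).add (C.lead_A33.1.mul h3)
  have := h1.add (((lead_mul_of_one C.lead_A3E hE).add (lead_mul_of_one C.lead_A3B hB)).add
    (h22.of_le (l := k + 1) (by omega)))
  exact this.congr_lead fun y _ => by ring

/-- One order beyond `lead_fluxR2`: if E and B start one order, and Q two orders, after P, then
`A22` = r^2 + ... brings the term in P2 to the same order as Q2. This is the source of the zeroth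
order term in the evolution equation. -/
theorem lead_fluxR2' {k : ℕ} {e b p2 p3 q2 q3 : Coord → ℝ} (hE : Lead D (k + 1) X.E e)
    (hB : Lead D (k + 1) X.B b) (h2 : Lead D k X.P2 p2) (h3 : Lead D k X.P3 p3)
    (hq2 : Lead D (k + 2) X.Q2 q2) (hq3 : Lead D (k + 2) X.Q3 q3) :
    Lead D (k + 2) (C.fluxR2 X) (fun y => - q2 y + p2 y) := by
  have h1 := (C.lead_K22.1.mul hq2).add (C.lead_K23.1.mul hq3)
  rw [zero_add] at h1
  have h22 := (C.lead_A22.1.mul h2).add (C.lead_A23.1.mul h3)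
  rw [add_comm 2 k] at h22
  have := h1.add (((lead_mul_of_one C.lead_A2E hE).add (lead_mul_of_one C.lead_A2B hB)).add h22)
  exact this.congr_lead fun y _ => by ring

theorem lead_fluxR3' {k : ℕ} {e b p2 p3 q2 q3 : Coord → ℝ} (hE : Lead D (k + 1) X.E e)
    (hB : Lead D (k + 1) X.B b) (h2 : Lead D k X.P2 p2) (h3 : Lead D k X.P3 p3)
    (hq2 : Lead D (k + 2) X.Q2 q2) (hq3 : Lead D (k + 2) X.Q3 q3) :
    Lead D (k + 2) (C.fluxR3 X) (fun y => - q3 y + p3 y) := by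
  have h1 := (C.lead_K23.1.mul hq2).add (C.lead_K33.1.mul hq3)
  rw [zero_add] at h1
  have h22 := (C.lead_A32.1.mul h2).add (C.lead_A33.1.mul h3)
  rw [add_comm 2 k] at h22
  have := h1.add (((lead_mul_of_one C.lead_A3E hE).add (lead_mul_of_one C.lead_A3B hB)).add h22)
  exact this.congr_lead fun y _ => by ring

theorem _root_.Electrovac.Lead.contDiffOn {k : ℕ} {f c : Coord → ℝ}
    (hf : Lead D k f c) : ContDiffOn ℝ ∞ f (D ∩ {y | 0 < y 1}) := by
  obtain ⟨φ, h1, h2, -⟩ := hf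
  have : ContDiffOn ℝ ∞ (fun z : Coord => z 1 ^ k * φ z) D :=
    ContDiffOn.mul (by fun_prop) h1
  exact (this.mono inter_subset_left).congr fun y hy => h2 y hy.1 hy.2

theorem _root_.Electrovac.Field.Smooth.dv (hD : ScriNbhd D) (hX : X.Smooth D) :
    X.dv.Smooth D where
  E := hX.E.pderiv hD.isOpen 0
  P2 := hX.P2.pderiv hD.isOpen 0
  P3 := hX.P3.pderiv hD.isOpen 0
  Q2 := hX.Q2.pderiv hD.isOpen 0
  Q3 := hX.Q3.pderiv hD.isOpen 0
  B := hX.B.pderiv hD.isOpen 0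

theorem _root_.Electrovac.Coeff.pd_mul (hD : ScriNbhd D) {k : ℕ} {f c g : Coord → ℝ}
    (hf : Coeff D k f c) (hg : ContDiffOn ℝ ∞ g D) {y : Coord} (hy : y ∈ D) (h0 : 0 < y 1) :
    DifferentiableAt ℝ (fun z => f z * g z) y ∧
      pd 0 (fun z => f z * g z) y = f y * pd 0 g y := by
  have h1 := hf.1.differentiableAt hD hy h0
  have h2 := hg.diffAt hD.isOpen hy
  refine ⟨h1.mul h2, ?_⟩
  rw [Electrovac.pd_mul h1 h2, hf.2 y hy h0]
  ring

theorem coeff_s : Coeff D 0 C.s C.s := ⟨Lead.of_smooth C.smooth_s, C.dv_s⟩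

section FluxDv

variable (hX : X.Smooth D) (hD : ScriNbhd D)

include hX hD

theorem fluxV2_dv : ∀ y ∈ D, 0 < y 1 → pd 0 (C.fluxV2 X) y = C.fluxV2 X.dv y := by
  intro y hy h0
  obtain ⟨a1, a2⟩ := C.lead_K22.pd_mul hD hX.P2 hy h0
  obtain ⟨b1, b2⟩ := C.lead_K23.pd_mul hD hX.P3 hy h0
  unfold fluxV2
  rw [pd_add a1 b1, a2, b2]
  rfl

theorem fluxV3_dv : ∀ y ∈ D, 0 < y 1 → pd 0 (C.fluxV3 X) y = C.fluxV3 X.dv y := by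
  intro y hy h0
  obtain ⟨a1, a2⟩ := C.lead_K23.pd_mul hD hX.P2 hy h0
  obtain ⟨b1, b2⟩ := C.lead_K33.pd_mul hD hX.P3 hy h0
  unfold fluxV3
  rw [pd_add a1 b1, a2, b2]
  rfl

theorem fluxVR_dv : ∀ y ∈ D, 0 < y 1 → pd 0 (C.fluxVR X) y = C.fluxVR X.dv y := by
  intro y hy h0
  obtain ⟨a1, a2⟩ := C.coeff_s.pd_mul hD hX.E hy h0
  obtain ⟨b1, b2⟩ := C.lead_S2.pd_mul hD hX.P2 hy h0
  obtain ⟨c1, c2⟩ := C.lead_S3.pd_mul hD hX.P3 hy h0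
  unfold fluxVR
  rw [pd_add a1 (b1.fun_add c1), pd_add b1 c1, a2, b2, c2]
  rfl

theorem fluxR2_dv : ∀ y ∈ D, 0 < y 1 → pd 0 (C.fluxR2 X) y = C.fluxR2 X.dv y := by
  intro y hy h0
  obtain ⟨a1, a2⟩ := C.lead_K22.pd_mul hD hX.Q2 hy h0
  obtain ⟨b1, b2⟩ := C.lead_K23.pd_mul hD hX.Q3 hy h0
  obtain ⟨c1, c2⟩ := C.lead_A2E.pd_mul hD hX.E hy h0
  obtain ⟨d1, d2⟩ := C.lead_A2B.pd_mul hD hX.B hy h0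
  obtain ⟨e1, e2⟩ := C.lead_A22.pd_mul hD hX.P2 hy h0
  obtain ⟨f1, f2⟩ := C.lead_A23.pd_mul hD hX.P3 hy h0
  unfold fluxR2
  rw [pd_add (a1.fun_add b1) ((c1.fun_add d1).fun_add (e1.fun_add f1)), pd_add a1 b1,
    pd_add (c1.fun_add d1) (e1.fun_add f1), pd_add c1 d1, pd_add e1 f1, a2, b2, c2, d2, e2, f2]
  rfl

theorem fluxR3_dv : ∀ y ∈ D, 0 < y 1 → pd 0 (C.fluxR3 X) y = C.fluxR3 X.dv y := by
  intro y hy h0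
  obtain ⟨a1, a2⟩ := C.lead_K23.pd_mul hD hX.Q2 hy h0
  obtain ⟨b1, b2⟩ := C.lead_K33.pd_mul hD hX.Q3 hy h0
  obtain ⟨c1, c2⟩ := C.lead_A3E.pd_mul hD hX.E hy h0
  obtain ⟨d1, d2⟩ := C.lead_A3B.pd_mul hD hX.B hy h0
  obtain ⟨e1, e2⟩ := C.lead_A32.pd_mul hD hX.P2 hy h0
  obtain ⟨f1, f2⟩ := C.lead_A33.pd_mul hD hX.P3 hy h0
  unfold fluxR3
  rw [pd_add (a1.fun_add b1) ((c1.fun_add d1).fun_add (e1.fun_add f1)), pd_add a1 b1,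
    pd_add (c1.fun_add d1) (e1.fun_add f1), pd_add c1 d1, pd_add e1 f1, a2, b2, c2, d2, e2, f2]
  rfl

theorem flux23_dv : ∀ y ∈ D, 0 < y 1 → pd 0 (C.flux23 X) y = C.flux23 X.dv y := by
  intro y hy h0
  have hs := (C.pos_s y hy).ne'
  have s1 := C.smooth_s.diffAt hD.isOpen hy
  have x1 := hX.B.diffAt hD.isOpen hy
  obtain ⟨b1, b2⟩ := C.lead_R2.pd_mul hD hX.P2 hy h0
  obtain ⟨c1, c2⟩ := C.lead_R3.pd_mul hD hX.P3 hy h0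
  have i1 : DifferentiableAt ℝ (fun z => (C.s z)⁻¹) y := s1.inv hs
  -- The division by the stationary density is written as a product, so that the product rule and
  -- `pd_inv` apply.
  have h : C.flux23 X = fun z => X.B z * (C.s z)⁻¹ + (C.R2 z * X.P2 z + C.R3 z * X.P3 z) := by
    funext z
    simp only [flux23, div_eq_mul_inv]
  rw [h, pd_add (x1.fun_mul i1) (b1.fun_add c1), pd_add b1 c1, Electrovac.pd_mul x1 i1, pd_inv s1 hs,
    C.dv_s y hy h0, b2, c2]
  simp [flux23, Field.dv, div_eq_mul_inv]

end FluxDv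

theorem contDiffOn_flux (hX : X.Smooth D) :
    ContDiffOn ℝ ∞ (C.fluxV2 X) (D ∩ {y | 0 < y 1}) ∧
    ContDiffOn ℝ ∞ (C.fluxV3 X) (D ∩ {y | 0 < y 1}) ∧
    ContDiffOn ℝ ∞ (C.fluxVR X) (D ∩ {y | 0 < y 1}) ∧
    ContDiffOn ℝ ∞ (C.fluxR2 X) (D ∩ {y | 0 < y 1}) ∧
    ContDiffOn ℝ ∞ (C.fluxR3 X) (D ∩ {y | 0 < y 1}) ∧
    ContDiffOn ℝ ∞ (C.flux23 X) (D ∩ {y | 0 < y 1}) := by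
  have hE := hX.E.mono (inter_subset_left (t := {y : Coord | 0 < y 1}))
  have hP2 := hX.P2.mono (inter_subset_left (t := {y : Coord | 0 < y 1}))
  have hP3 := hX.P3.mono (inter_subset_left (t := {y : Coord | 0 < y 1}))
  have hQ2 := hX.Q2.mono (inter_subset_left (t := {y : Coord | 0 < y 1}))
  have hQ3 := hX.Q3.mono (inter_subset_left (t := {y : Coord | 0 < y 1}))
  have hB := hX.B.mono (inter_subset_left (t := {y : Coord | 0 < y 1}))
  have hs := C.smooth_s.mono (inter_subset_left (t := {y : Coord | 0 < y 1}))
  have c {k : ℕ} {f c : Coord → ℝ} (h : Coeff D k f c) := h.1.contDiffOn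
  refine ⟨((c C.lead_K22).mul hP2).add ((c C.lead_K23).mul hP3),
    ((c C.lead_K23).mul hP2).add ((c C.lead_K33).mul hP3),
    (hs.mul hE).add (((c C.lead_S2).mul hP2).add ((c C.lead_S3).mul hP3)),
    (((c C.lead_K22).mul hQ2).add ((c C.lead_K23).mul hQ3)).add
      ((((c C.lead_A2E).mul hE).add ((c C.lead_A2B).mul hB)).add
        (((c C.lead_A22).mul hP2).add ((c C.lead_A23).mul hP3))),
    (((c C.lead_K23).mul hQ2).add ((c C.lead_K33).mul hQ3)).add
      ((((c C.lead_A3E).mul hE).add ((c C.lead_A3B).mul hB)).add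
        (((c C.lead_A32).mul hP2).add ((c C.lead_A33).mul hP3))),
    (hB.div hs fun y hy => (C.pos_s y hy.1).ne').add
      (((c C.lead_R2).mul hP2).add ((c C.lead_R3).mul hP3))⟩

theorem pd_flux_dv (hD : ScriNbhd D) {f g : Coord → ℝ} (i : Fin 4)
    (hf : ContDiffOn ℝ ∞ f (D ∩ {y | 0 < y 1})) (h : ∀ y ∈ D, 0 < y 1 → pd 0 f y = g y) :
    ∀ y ∈ D, 0 < y 1 → pd i g y = pd 0 (pd i f) y := by
  intro y hy h0
  rw [← pd_comm hD.isOpen_pos hf ⟨hy, h0⟩ i 0]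
  exact pd_congr_of_isOpen hD.isOpen_pos (fun z hz => (h z hz.1 hz.2).symm) ⟨hy, h0⟩

/-- The derivative along `∂/∂v` of a Maxwell field on a stationary background is a Maxwell
field. -/
theorem Maxwell.dv (hM : C.Maxwell X) (hX : X.Smooth D) (hD : ScriNbhd D) :
    C.Maxwell X.dv := by
  obtain ⟨f1, f2, f3, f4, f5, f6⟩ := contDiffOn_flux (C := C) hX
  have g {f : Coord → ℝ} (h : ContDiffOn ℝ ∞ f D) (i : Fin 4) {y : Coord} (hy : y ∈ D) :
      pd i (pd 0 f) y = pd 0 (pd i f) y := pd_comm hD.isOpen h hy i 0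
  have d {f : Coord → ℝ} (h : ContDiffOn ℝ ∞ f D) (i : Fin 4) {y : Coord} (hy : y ∈ D) :
      DifferentiableAt ℝ (pd i f) y := (h.pderiv hD.isOpen i).diffAt hD.isOpen hy
  have e {f : Coord → ℝ} (h : ContDiffOn ℝ ∞ f (D ∩ {y | 0 < y 1})) (i : Fin 4) {y : Coord}
      (hy : y ∈ D) (h0 : 0 < y 1) : DifferentiableAt ℝ (pd i f) y :=
    (h.pderiv hD.isOpen_pos i).diffAt hD.isOpen_pos ⟨hy, h0⟩
  have key {f f' : Coord → ℝ} (h : ∀ y ∈ D, 0 < y 1 → f y = f' y) {y : Coord} (hy : y ∈ D)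
      (h0 : 0 < y 1) : pd 0 f y = pd 0 f' y :=
    pd_congr_of_isOpen hD.isOpen_pos (fun z hz => h z hz.1 hz.2) ⟨hy, h0⟩
  constructor
  · intro y hy h0
    have := key hM.closed_r23 hy h0
    rw [pd_sub (d hX.P3 2 hy) (d hX.P2 3 hy)] at this
    simpa only [Field.dv, g hX.B 1 hy, g hX.P3 2 hy, g hX.P2 3 hy] using this
  · intro y hy h0
    have := key hM.closed_v23 hy h0
    rw [pd_sub (d hX.Q3 2 hy) (d hX.Q2 3 hy)] at this
    simpa only [Field.dv, g hX.Q3 2 hy, g hX.Q2 3 hy] using this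
  · intro y hy h0
    have := key hM.closed_vr2 hy h0
    rw [pd_sub (d hX.P2 0 hy) (d hX.E 2 hy)] at this
    simpa only [Field.dv, g hX.Q2 1 hy, g hX.E 2 hy] using this
  · intro y hy h0
    have := key hM.closed_vr3 hy h0
    rw [pd_sub (d hX.P3 0 hy) (d hX.E 3 hy)] at this
    simpa only [Field.dv, g hX.Q3 1 hy, g hX.E 3 hy] using this
  · intro y hy h0
    have := key hM.coclosed_v hy h0
    rw [pd_neg, pd_add (e f1 2 hy h0) (e f2 3 hy h0)] at this
    rw [pd_flux_dv hD 1 f3 (fluxVR_dv hX hD) y hy h0,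
      pd_flux_dv hD 2 f1 (fluxV2_dv hX hD) y hy h0, pd_flux_dv hD 3 f2 (fluxV3_dv hX hD) y hy h0]
    exact this
  · intro y hy h0
    have := key hM.coclosed_r hy h0
    rw [pd_add (e f4 2 hy h0) (e f5 3 hy h0)] at this
    rw [pd_flux_dv hD 0 f3 (fluxVR_dv hX hD) y hy h0,
      pd_flux_dv hD 2 f4 (fluxR2_dv hX hD) y hy h0, pd_flux_dv hD 3 f5 (fluxR3_dv hX hD) y hy h0]
    exact this
  · intro y hy h0
    have := key hM.coclosed_2 hy h0
    rw [pd_add (e f1 0 hy h0).fun_neg (e f6 3 hy h0), pd_neg] at this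
    rw [pd_flux_dv hD 1 f4 (fluxR2_dv hX hD) y hy h0,
      pd_flux_dv hD 0 f1 (fluxV2_dv hX hD) y hy h0, pd_flux_dv hD 3 f6 (flux23_dv hX hD) y hy h0]
    exact this
  · intro y hy h0
    have := key hM.coclosed_3 hy h0
    rw [pd_sub (e f2 0 hy h0).fun_neg (e f6 2 hy h0), pd_neg] at this
    rw [pd_flux_dv hD 1 f5 (fluxR3_dv hX hD) y hy h0,
      pd_flux_dv hD 0 f2 (fluxV3_dv hX hD) y hy h0, pd_flux_dv hD 2 f6 (flux23_dv hX hD) y hy h0]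
    exact this

namespace Maxwell

variable (hM : C.Maxwell X) (hX : X.Smooth D) (hD : ScriNbhd D)

-- The equation for ∂_r B contains only P, so B is obtained by integration from r = 0; its leading
-- coefficient is a multiple of the curl of that of P.
include hM hX hD in
theorem lead_B {k : ℕ} {p2 p3 : Coord → ℝ} (h2 : Lead D k X.P2 p2) (h3 : Lead D k X.P3 p3)
    (hB : ∀ y : Coord, y 1 = 0 → X.B y = 0) :
    Lead D (k + 1) X.B (fun y => (tpd 2 p3 y - tpd 3 p2 y) / (k + 1)) := by
  refine (Lead.of_smooth_zero hX.B hB).integrate hD ?_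
  exact ((h3.pd_tan hD (i := 2) (by decide)).sub (h2.pd_tan hD (i := 3) (by decide))).congr
    hM.closed_r23

-- The counterpart of `lead_B` for Gauss's law: the flux F^{vr} is integrated from r = 0 and then
-- solved for E, which brings in the divergence of the leading term of P.
include hM hX hD in
theorem lead_E {k : ℕ} {p2 p3 : Coord → ℝ} (h2 : Lead D k X.P2 p2) (h3 : Lead D k X.P3 p3)
    (hE : ∀ y : Coord, y 1 = 0 → X.E y = 0) :
    Lead D (k + 1) X.E (fun y => (tpd 2 p2 y + tpd 3 p3 y) / (k + 1) / C.s y) := by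
  refine lead_E_of_fluxVR (C := C) ?_ h2 h3
  have h0 : Lead D 0 (C.fluxVR X) (fun _ => 0) := by
    have := ((Lead.of_smooth C.smooth_s).mul (Lead.of_smooth_zero hX.E hE)).add
      (((lead_mul_of_one C.lead_S2 (Lead.of_smooth hX.P2)).add
        (lead_mul_of_one C.lead_S3 (Lead.of_smooth hX.P3))).of_le (l := 0) (by omega))
    exact this.congr_lead fun y _ => by ring
  refine h0.integrate hD ?_
  refine ((((lead_fluxV2 h2 h3).pd_tan hD (i := 2) (by decide)).add
    ((lead_fluxV3 h2 h3).pd_tan hD (i := 3) (by decide))).neg.congr hM.coclosed_v).congr_lead ?_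
  intro y _
  rw [tpd_neg, tpd_neg]
  ring

include hM hX hD in
/-- The evolution along `r = 0` of the leading term of `F_{rI}`. -/
theorem lead_dv {k : ℕ} {p2 p3 e b : Coord → ℝ} (h2 : Lead D k X.P2 p2) (h3 : Lead D k X.P3 p3)
    (hE : Lead D (k + 1) X.E e) (hB : Lead D (k + 1) X.B b)
    (hQ2 : ∀ y : Coord, y 1 = 0 → X.Q2 y = 0) (hQ3 : ∀ y : Coord, y 1 = 0 → X.Q3 y = 0) :
    Lead D (k + 1) (pd 0 X.P2) (fun y => ((k + 2) * p2 y + tpd 2 e y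
      - tpd 3 (fun z => b z / C.s z) y) / 2) ∧
    Lead D (k + 1) (pd 0 X.P3) (fun y => ((k + 2) * p3 y + tpd 3 e y
      + tpd 2 (fun z => b z / C.s z) y) / 2) := by
  have hk : (k : ℝ) + 1 ≠ 0 := by positivity
  have hk2 : ((k + 1 : ℕ) : ℝ) + 1 = k + 2 := by push_cast; ring
  have hk2' : (k : ℝ) + 2 ≠ 0 := by positivity
  have d2 := h2.pd_tan hD (i := 0) (by decide)
  have d3 := h3.pd_tan hD (i := 0) (by decide)
  have E2 := hE.pd_tan hD (i := 2) (by decide)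
  have E3 := hE.pd_tan hD (i := 3) (by decide)
  have hb := lead_flux23 (C := C) hB h2 h3
  have b2 := hb.pd_tan hD (i := 2) (by decide)
  have b3 := hb.pd_tan hD (i := 3) (by decide)
  have z2 := Lead.of_smooth_zero hX.Q2 hQ2
  have z3 := Lead.of_smooth_zero hX.Q3 hQ3
  have q2 := z2.integrate hD
    ((d2.sub (E2.of_le (l := k) (by omega))).congr hM.closed_vr2)
  have q3 := z3.integrate hD
    ((d3.sub (E3.of_le (l := k) (by omega))).congr hM.closed_vr3)
  have v2 := (lead_fluxV2 (C := C) h2 h3).pd_tan hD (i := 0) (by decide)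
  have v3 := (lead_fluxV3 (C := C) h2 h3).pd_tan hD (i := 0) (by decide)
  have hE' := hE.of_le (l := k) (by omega)
  have hB' := hB.of_le (l := k) (by omega)
  have r2 := lead_fluxR2 (C := C) hE' hB' h2 h3 q2 q3
  have r3 := lead_fluxR3 (C := C) hE' hB' h2 h3 q2 q3
  have r20 := r2.of_le (l := 0) (by omega)
  have r30 := r3.of_le (l := 0) (by omega)
  have r2' := r20.integrate hD
    ((v2.neg.add (b3.of_le (l := k) (by omega))).congr hM.coclosed_2)
  have r3' := r30.integrate hD
    ((v3.neg.sub (b2.of_le (l := k) (by omega))).congr hM.coclosed_3)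
  -- First pass, at order k + 1. Integrating the closedness equation gives Q2 the coefficient ∂_v
  -- p2/(k+1). Integrating the dual equation gives the same coefficient to `fluxR2`, whose leading
  -- term is -Q2. The opposite signs force ∂_v p2 = 0.
  have n2 : ∀ y : Coord, y 1 = 0 → tpd 0 p2 y = 0 := by
    intro y hy
    have := r2.unique hD r2' hy
    rw [tpd_neg] at this
    field_simp at this
    linarith
  have n3 : ∀ y : Coord, y 1 = 0 → tpd 0 p3 y = 0 := by
    intro y hy
    have := r3.unique hD r3' hy
    rw [tpd_neg] at this
    field_simp at this
    linarith
  obtain ⟨t2, ht2⟩ := d2.raise hD n2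
  obtain ⟨t3, ht3⟩ := d3.raise hD n3
  -- Second pass, at order k + 2: ∂_v P is now O(r^(k+1)), and comparing the same two expressions
  -- for `fluxR2` and `fluxR3` yields the coefficient of ∂_v P.
  have q2 := z2.integrate hD ((ht2.sub E2).congr hM.closed_vr2)
  have q3 := z3.integrate hD ((ht3.sub E3).congr hM.closed_vr3)
  have w2 := ((lead_fluxV2 (C := C) (X := X.dv) ht2 ht3).congr (fluxV2_dv hX hD)).neg
  have w3 := ((lead_fluxV3 (C := C) (X := X.dv) ht2 ht3).congr (fluxV3_dv hX hD)).neg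
  have r2 := lead_fluxR2' (C := C) hE hB h2 h3 q2 q3
  have r3 := lead_fluxR3' (C := C) hE hB h2 h3 q2 q3
  have r2' := r20.integrate hD ((w2.add b3).congr hM.coclosed_2)
  have r3' := r30.integrate hD ((w3.sub b2).congr hM.coclosed_3)
  refine ⟨ht2.congr_lead fun y hy => ?_, ht3.congr_lead fun y hy => ?_⟩
  · have := r2.unique hD r2' hy
    rw [hk2] at this
    field_simp at this
    linarith
  · have := r3.unique hD r3' hy
    rw [hk2] at this
    field_simp at this
    linarith

end Maxwell
end Coeffs
end Electrovac

end

/-! ### Stationarity of the energy tensor, at leading order. -/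

noncomputable section
open scoped Manifold ContDiff
open Set Filter Topology
namespace Electrovac

variable {D : Set Coord}

theorem Lead.of_le_ite {k l : ℕ} (hl : l ≤ k) {f c : Coord → ℝ} (hf : Lead D k f c) :
    Lead D l f (fun y => (if k = l then 1 else 0) * c y) := by
  rcases hl.lt_or_eq with h | h
  · simpa [h.ne'] using hf.of_le h
  · subst h
    simpa using hf

theorem Lead.cast {k l : ℕ} {f c : Coord → ℝ} (hf : Lead D k f c) (h : k = l) : Lead D l f c :=
  h ▸ hf

theorem Lead.zero_unique (hD : ScriNbhd D) {k : ℕ} {f c : Coord → ℝ} (hf : Lead D k f c)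
    (h : ∀ y ∈ D, 0 < y 1 → f y = 0) {y : Coord} (hy : y 1 = 0) : c y = 0 :=
  hf.unique hD ((Lead.zero D k).congr h) hy

namespace Coeffs

variable {C : Coeffs D} {X : Field}

/-- The components `T_{rr}`, `T_{r2}`, `T_{r3}` of the energy tensor are invariant under
`∂/∂v`. -/
structure Energy (C : Coeffs D) (X : Field) : Prop where
  rr : ∀ y ∈ D, 0 < y 1 →
    pd 0 (fun z => C.fluxV2 X z * X.P2 z + C.fluxV3 X z * X.P3 z) y = 0
  r2 : ∀ y ∈ D, 0 < y 1 →
    pd 0 (fun z => C.fluxVR X z * X.P2 z - C.fluxV3 X z * X.B z) y = 0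
  r3 : ∀ y ∈ D, 0 < y 1 →
    pd 0 (fun z => C.fluxVR X z * X.P3 z + C.fluxV2 X z * X.B z) y = 0

section

variable (hT : C.Energy X) (hX : X.Smooth D) (hD : ScriNbhd D)

include hT hX hD

theorem Energy.dv {y : Coord} (hy : y ∈ D) (h0 : 0 < y 1) :
    ((C.fluxV2 X y * X.dv.P2 y + C.fluxV2 X.dv y * X.P2 y)
      + (C.fluxV3 X y * X.dv.P3 y + C.fluxV3 X.dv y * X.P3 y) = 0) ∧
    ((C.fluxVR X y * X.dv.P2 y + C.fluxVR X.dv y * X.P2 y)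
      - (C.fluxV3 X y * X.dv.B y + C.fluxV3 X.dv y * X.B y) = 0) ∧
    ((C.fluxVR X y * X.dv.P3 y + C.fluxVR X.dv y * X.P3 y)
      + (C.fluxV2 X y * X.dv.B y + C.fluxV2 X.dv y * X.B y) = 0) := by
  obtain ⟨f1, f2, f3, -, -, -⟩ := contDiffOn_flux (C := C) hX
  have d {f : Coord → ℝ} (h : ContDiffOn ℝ ∞ f (D ∩ {y | 0 < y 1})) :
      DifferentiableAt ℝ f y := h.diffAt hD.isOpen_pos ⟨hy, h0⟩
  have d2 := hX.P2.diffAt hD.isOpen hy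
  have d3 := hX.P3.diffAt hD.isOpen hy
  have dB := hX.B.diffAt hD.isOpen hy
  refine ⟨?_, ?_, ?_⟩
  · have := hT.rr y hy h0
    rwa [pd_add ((d f1).fun_mul d2) ((d f2).fun_mul d3), pd_mul (d f1) d2, pd_mul (d f2) d3,
      fluxV2_dv hX hD y hy h0, fluxV3_dv hX hD y hy h0] at this
  · have := hT.r2 y hy h0
    rwa [pd_sub ((d f3).fun_mul d2) ((d f2).fun_mul dB), pd_mul (d f3) d2, pd_mul (d f2) dB,
      fluxVR_dv hX hD y hy h0, fluxV3_dv hX hD y hy h0] at this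
  · have := hT.r3 y hy h0
    rwa [pd_add ((d f3).fun_mul d3) ((d f1).fun_mul dB), pd_mul (d f3) d3, pd_mul (d f1) dB,
      fluxVR_dv hX hD y hy h0, fluxV2_dv hX hD y hy h0] at this

theorem Energy.dv_dv {y : Coord} (hy : y ∈ D) (h0 : 0 < y 1) :
    ((C.fluxV2 X y * X.dv.dv.P2 y + 2 * (C.fluxV2 X.dv y * X.dv.P2 y)
        + C.fluxV2 X.dv.dv y * X.P2 y)
      + (C.fluxV3 X y * X.dv.dv.P3 y + 2 * (C.fluxV3 X.dv y * X.dv.P3 y)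
        + C.fluxV3 X.dv.dv y * X.P3 y) = 0) ∧
    ((C.fluxVR X y * X.dv.dv.P2 y + 2 * (C.fluxVR X.dv y * X.dv.P2 y)
        + C.fluxVR X.dv.dv y * X.P2 y)
      - (C.fluxV3 X y * X.dv.dv.B y + (C.fluxV3 X.dv y * X.dv.B y + C.fluxV3 X.dv y * X.dv.B y)
        + C.fluxV3 X.dv.dv y * X.B y) = 0) ∧
    ((C.fluxVR X y * X.dv.dv.P3 y + 2 * (C.fluxVR X.dv y * X.dv.P3 y)
        + C.fluxVR X.dv.dv y * X.P3 y)
      + (C.fluxV2 X y * X.dv.dv.B y + (C.fluxV2 X.dv y * X.dv.B y + C.fluxV2 X.dv y * X.dv.B y)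
        + C.fluxV2 X.dv.dv y * X.B y) = 0) := by
  have hX' := hX.dv hD
  obtain ⟨f1, f2, f3, -, -, -⟩ := contDiffOn_flux (C := C) hX
  obtain ⟨g1, g2, g3, -, -, -⟩ := contDiffOn_flux (C := C) hX'
  have d {f : Coord → ℝ} (h : ContDiffOn ℝ ∞ f (D ∩ {y | 0 < y 1})) :
      DifferentiableAt ℝ f y := h.diffAt hD.isOpen_pos ⟨hy, h0⟩
  have d2 := hX.P2.diffAt hD.isOpen hy
  have d3 := hX.P3.diffAt hD.isOpen hy
  have dB := hX.B.diffAt hD.isOpen hy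
  have e2 := hX'.P2.diffAt hD.isOpen hy
  have e3 := hX'.P3.diffAt hD.isOpen hy
  have eB := hX'.B.diffAt hD.isOpen hy
  have key {f : Coord → ℝ} (h : ∀ z ∈ D, 0 < z 1 → f z = 0) : pd 0 f y = 0 := by
    rw [pd_congr_of_isOpen hD.isOpen_pos (g := fun _ => 0) (fun z hz => h z hz.1 hz.2) ⟨hy, h0⟩,
      pd_const]
  refine ⟨?_, ?_, ?_⟩
  · have := key fun z hz h => (hT.dv hX hD hz h).1
    rw [pd_add (((d f1).fun_mul e2).fun_add ((d g1).fun_mul d2))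
        (((d f2).fun_mul e3).fun_add ((d g2).fun_mul d3)),
      pd_add ((d f1).fun_mul e2) ((d g1).fun_mul d2),
      pd_add ((d f2).fun_mul e3) ((d g2).fun_mul d3), pd_mul (d f1) e2, pd_mul (d g1) d2,
      pd_mul (d f2) e3, pd_mul (d g2) d3,
      fluxV2_dv hX hD y hy h0, fluxV3_dv hX hD y hy h0,
      fluxV2_dv hX' hD y hy h0, fluxV3_dv hX' hD y hy h0] at this
    simp only [Field.dv] at this ⊢
    linear_combination this
  · have := key fun z hz h => (hT.dv hX hD hz h).2.1
    rw [pd_sub (((d f3).fun_mul e2).fun_add ((d g3).fun_mul d2))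
        (((d f2).fun_mul eB).fun_add ((d g2).fun_mul dB)),
      pd_add ((d f3).fun_mul e2) ((d g3).fun_mul d2),
      pd_add ((d f2).fun_mul eB) ((d g2).fun_mul dB), pd_mul (d f3) e2, pd_mul (d g3) d2,
      pd_mul (d f2) eB, pd_mul (d g2) dB,
      fluxVR_dv hX hD y hy h0, fluxV3_dv hX hD y hy h0,
      fluxVR_dv hX' hD y hy h0, fluxV3_dv hX' hD y hy h0] at this
    simp only [Field.dv] at this ⊢
    linear_combination this
  · have := key fun z hz h => (hT.dv hX hD hz h).2.2
    rw [pd_add (((d f3).fun_mul e3).fun_add ((d g3).fun_mul d3))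
        (((d f1).fun_mul eB).fun_add ((d g1).fun_mul dB)),
      pd_add ((d f3).fun_mul e3) ((d g3).fun_mul d3),
      pd_add ((d f1).fun_mul eB) ((d g1).fun_mul dB), pd_mul (d f3) e3, pd_mul (d g3) d3,
      pd_mul (d f1) eB, pd_mul (d g1) dB,
      fluxVR_dv hX hD y hy h0, fluxV2_dv hX hD y hy h0,
      fluxVR_dv hX' hD y hy h0, fluxV2_dv hX' hD y hy h0] at this
    simp only [Field.dv] at this ⊢
    linear_combination this

/-- A stationary energy tensor forces the Coulomb part of the field at `r = 0` to vanish wherever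
the leading term of the derivative of `F_{rI}` does not. -/
theorem Energy.coulomb {n m : ℕ} {f2 f3 h2 h3 e1 b1 : Coord → ℝ}
    (hf2 : Lead D n X.P2 f2) (hf3 : Lead D n X.P3 f3)
    (hh2 : Lead D m X.dv.P2 h2) (hh3 : Lead D m X.dv.P3 h3)
    (he1 : Lead D (m + 1) X.dv.E e1) (hb1 : Lead D (m + 1) X.dv.B b1)
    {y : Coord} (hy : y 1 = 0) :
    X.E y * (h2 y ^ 2 + h3 y ^ 2) = 0 ∧ X.B y * (h2 y ^ 2 + h3 y ^ 2) = 0 := by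
  have hs := C.pos_s y (hD.scri_mem y hy)
  have v2 := lead_fluxV2 (C := C) hf2 hf3
  have v3 := lead_fluxV3 (C := C) hf2 hf3
  have w2 := lead_fluxV2 (C := C) hh2 hh3
  have w3 := lead_fluxV3 (C := C) hh2 hh3
  have wr := lead_fluxVR (C := C) he1 hh2 hh3
  have vr : Lead D 0 (C.fluxVR X) (fun y => C.s y * X.E y) := by
    have := ((Lead.of_smooth C.smooth_s).mul (Lead.of_smooth hX.E)).add
      (((lead_mul_of_one C.lead_S2 (Lead.of_smooth hX.P2)).add
        (lead_mul_of_one C.lead_S3 (Lead.of_smooth hX.P3))).of_le (l := 0) (by omega))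
    exact this.congr_lead fun y _ => by ring
  have hB := Lead.of_smooth hX.B
  have x2 := (((vr.mul hh2).cast (zero_add m)).add
    ((wr.mul hf2).of_le (l := m) (by omega))).sub
    (((v3.mul hb1).of_le (l := m) (by omega)).add (w3.mul hB))
  have x3 := (((vr.mul hh3).cast (zero_add m)).add
    ((wr.mul hf3).of_le (l := m) (by omega))).add
    (((v2.mul hb1).of_le (l := m) (by omega)).add (w2.mul hB))
  have r2 := x2.zero_unique hD (fun z hz h => (hT.dv hX hD hz h).2.1) hy
  have r3 := x3.zero_unique hD (fun z hz h => (hT.dv hX hD hz h).2.2) hy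
  -- `r2` and `r3` are the linear system sE·h2 + B·h3 = 0, sE·h3 - B·h2 = 0 for (sE, B), whose
  -- determinant is -(h2² + h3²).
  constructor
  · have : C.s y * (X.E y * (h2 y ^ 2 + h3 y ^ 2)) = 0 := by
      linear_combination h2 y * r2 + h3 y * r3
    exact (mul_eq_zero.1 this).resolve_left hs.ne'
  · linear_combination h3 y * r2 - h2 y * r3

/-- Stationarity of the energy tensor for the leading terms at `r = 0`. -/
theorem Energy.lead {n m : ℕ} (hnm : n + 1 ≤ m) {f2 f3 h2 h3 j2 j3 e0 b0 e1 b1 e2 b2 : Coord → ℝ}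
    (hf2 : Lead D n X.P2 f2) (hf3 : Lead D n X.P3 f3)
    (hh2 : Lead D m X.dv.P2 h2) (hh3 : Lead D m X.dv.P3 h3)
    (hj2 : Lead D (m + 1) X.dv.dv.P2 j2) (hj3 : Lead D (m + 1) X.dv.dv.P3 j3)
    (he0 : Lead D (n + 1) X.E e0) (hb0 : Lead D (n + 1) X.B b0)
    (he1 : Lead D (m + 1) X.dv.E e1) (hb1 : Lead D (m + 1) X.dv.B b1)
    (he2 : Lead D (m + 2) X.dv.dv.E e2) (hb2 : Lead D (m + 2) X.dv.dv.B b2)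
    {y : Coord} (hy : y 1 = 0) {ε : ℝ} (hε : ε = if m = n + 1 then 1 else 0) :
    f2 y * h2 y + f3 y * h3 y = 0 ∧
    f2 y * j2 y + f3 y * j3 y + ε * (h2 y ^ 2 + h3 y ^ 2) = 0 ∧
    (C.s y * e1 y * f2 y + b1 y * f3 y + (C.s y * e0 y * h2 y + b0 y * h3 y) = 0) ∧
    (C.s y * e1 y * f3 y - b1 y * f2 y + (C.s y * e0 y * h3 y - b0 y * h2 y) = 0) ∧
    (C.s y * e2 y * f2 y + b2 y * f3 y + 2 * ε * (C.s y * e1 y * h2 y + b1 y * h3 y)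
      + (C.s y * e0 y * j2 y + b0 y * j3 y) = 0) ∧
    (C.s y * e2 y * f3 y - b2 y * f2 y + 2 * ε * (C.s y * e1 y * h3 y - b1 y * h2 y)
      + (C.s y * e0 y * j3 y - b0 y * j2 y) = 0) := by
  have u2 := lead_fluxV2 (C := C) hf2 hf3
  have u3 := lead_fluxV3 (C := C) hf2 hf3
  have ur := lead_fluxVR (C := C) he0 hf2 hf3
  have v2 := lead_fluxV2 (C := C) hh2 hh3
  have v3 := lead_fluxV3 (C := C) hh2 hh3
  have vr := lead_fluxVR (C := C) he1 hh2 hh3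
  have w2 := lead_fluxV2 (C := C) hj2 hj3
  have w3 := lead_fluxV3 (C := C) hj2 hj3
  have wr := lead_fluxVR (C := C) he2 hj2 hj3
  -- Products of two first v-derivatives of P are of order 2m. They contribute at the order n + m +
  -- 1 of the terms with second derivatives exactly if m = n + 1; this is the role of ε.
  have e1 : (if m + m = n + m + 1 then (1 : ℝ) else 0) = ε := by
    rw [hε]; congr 1; simp only [eq_iff_iff]; omega
  have e2 : (if m + 1 + m = n + m + 2 then (1 : ℝ) else 0) = ε := by
    rw [hε]; congr 1; simp only [eq_iff_iff]; omega
  refine ⟨?_, ?_, ?_, ?_, ?_, ?_⟩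
  · have := ((((u2.mul hh2).add ((v2.mul hf2).cast (add_comm m n))).add
      ((u3.mul hh3).add ((v3.mul hf3).cast (add_comm m n))))).zero_unique hD
      (fun z hz h => (hT.dv hX hD hz h).1) hy
    linear_combination (-1 / 2) * this
  · have a (k l : ℕ) : k + (l + 1) = k + l + 1 := rfl
    have := (((((u2.mul hj2).cast (a n m)).add
        (((v2.mul hh2).const_mul 2).of_le_ite (l := n + m + 1) (by omega))).add
        ((w2.mul hf2).cast (by omega))).add
      ((((u3.mul hj3).cast (a n m)).add
        (((v3.mul hh3).const_mul 2).of_le_ite (l := n + m + 1) (by omega))).add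
        ((w3.mul hf3).cast (by omega)))).zero_unique hD
      (fun z hz h => (hT.dv_dv hX hD hz h).1) hy
    rw [e1] at this
    linear_combination (-1 / 2) * this
  · have := (((ur.mul hh2).add ((vr.mul hf2).cast (by omega))).sub
      (((u3.mul hb1).cast (by omega)).add ((v3.mul hb0).cast (by omega)))).zero_unique hD
      (fun z hz h => (hT.dv hX hD hz h).2.1) hy
    linear_combination this
  · have := (((ur.mul hh3).add ((vr.mul hf3).cast (by omega))).add
      (((u2.mul hb1).cast (by omega)).add ((v2.mul hb0).cast (by omega)))).zero_unique hD
      (fun z hz h => (hT.dv hX hD hz h).2.2) hy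
    linear_combination this
  · have b := (v3.mul hb1).of_le_ite (l := n + m + 2) (by omega)
    have e3 : (if m + (m + 1) = n + m + 2 then (1 : ℝ) else 0) = ε := by
      rw [hε]; congr 1; simp only [eq_iff_iff]; omega
    have := (((((ur.mul hj2).cast (l := n + m + 2) (by omega)).add
        (((vr.mul hh2).const_mul 2).of_le_ite (l := n + m + 2) (by omega))).add
        ((wr.mul hf2).cast (by omega))).sub
      ((((u3.mul hb2).cast (l := n + m + 2) (by omega)).add (b.add b)).add
        ((w3.mul hb0).cast (by omega)))).zero_unique hD
      (fun z hz h => (hT.dv_dv hX hD hz h).2.1) hy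
    rw [e2, e3] at this
    linear_combination this
  · have b := (v2.mul hb1).of_le_ite (l := n + m + 2) (by omega)
    have e3 : (if m + (m + 1) = n + m + 2 then (1 : ℝ) else 0) = ε := by
      rw [hε]; congr 1; simp only [eq_iff_iff]; omega
    have := (((((ur.mul hj3).cast (l := n + m + 2) (by omega)).add
        (((vr.mul hh3).const_mul 2).of_le_ite (l := n + m + 2) (by omega))).add
        ((wr.mul hf3).cast (by omega))).add
      ((((u2.mul hb2).cast (l := n + m + 2) (by omega)).add (b.add b)).add
        ((w2.mul hb0).cast (by omega)))).zero_unique hD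
      (fun z hz h => (hT.dv_dv hX hD hz h).2.2) hy
    rw [e2, e3] at this
    linear_combination this

end

end Coeffs
end Electrovac

end

/-! ### The leading terms as complex functions and their rates of rotation. -/

noncomputable section
open scoped ContDiff ComplexConjugate
open Set Filter Topology Complex
namespace Electrovac

/-- The operator `2 ∂/∂z = ∂_x - i ∂_y`. -/
def dz (f : ℂ → ℂ) (z : ℂ) : ℂ := fderiv ℝ f z 1 - I * fderiv ℝ f z I

/-- The operator `2 ∂/∂z̄ = ∂_x + i ∂_y`. -/
def dzb (f : ℂ → ℂ) (z : ℂ) : ℂ := fderiv ℝ f z 1 + I * fderiv ℝ f z I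

theorem dz_congr {f g : ℂ → ℂ} {z : ℂ} (h : f =ᶠ[𝓝 z] g) : dz f z = dz g z := by
  rw [dz, dz, h.fderiv_eq]

theorem dzb_congr {f g : ℂ → ℂ} {z : ℂ} (h : f =ᶠ[𝓝 z] g) : dzb f z = dzb g z := by
  rw [dzb, dzb, h.fderiv_eq]

theorem dz_mul {f g : ℂ → ℂ} {z : ℂ} (hf : DifferentiableAt ℝ f z) (hg : DifferentiableAt ℝ g z) :
    dz (fun w => f w * g w) z = f z * dz g z + dz f z * g z := by
  simp only [dz]; rw [fderiv_fun_mul hf hg]; simp; ring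

theorem dzb_mul {f g : ℂ → ℂ} {z : ℂ} (hf : DifferentiableAt ℝ f z)
    (hg : DifferentiableAt ℝ g z) :
    dzb (fun w => f w * g w) z = f z * dzb g z + dzb f z * g z := by
  simp only [dzb]; rw [fderiv_fun_mul hf hg]; simp; ring

theorem dz_const_mul {f : ℂ → ℂ} {z : ℂ} (a : ℂ) (hf : DifferentiableAt ℝ f z) :
    dz (fun w => a * f w) z = a * dz f z := by
  rw [dz_mul (differentiableAt_const a) hf]; simp [dz]

theorem dzb_const_mul {f : ℂ → ℂ} {z : ℂ} (a : ℂ) (hf : DifferentiableAt ℝ f z) :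
    dzb (fun w => a * f w) z = a * dzb f z := by
  rw [dzb_mul (differentiableAt_const a) hf]; simp [dzb]

theorem dz_sub {f g : ℂ → ℂ} {z : ℂ} (hf : DifferentiableAt ℝ f z) (hg : DifferentiableAt ℝ g z) :
    dz (fun w => f w - g w) z = dz f z - dz g z := by
  simp only [dz]; rw [fderiv_fun_sub hf hg]; simp; ring

theorem fderiv_ofReal_comp {q : ℂ → ℝ} {z : ℂ} (hq : DifferentiableAt ℝ q z) (v : ℂ) :
    fderiv ℝ (fun w => (q w : ℂ)) z v = (fderiv ℝ q z v : ℝ) := by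
  have := (ofRealCLM.hasFDerivAt (x := q z)).comp z hq.hasFDerivAt
  have h2 : (fun w => (q w : ℂ)) = ofRealCLM ∘ q := rfl
  rw [h2, this.fderiv]; rfl

theorem differentiableAt_ofReal_comp {q : ℂ → ℝ} {z : ℂ} (hq : DifferentiableAt ℝ q z) :
    DifferentiableAt ℝ (fun w => (q w : ℂ)) z :=
  (ofRealCLM.differentiableAt (x := q z)).comp z hq

theorem dzb_ofReal {q : ℂ → ℝ} {z : ℂ} (hq : DifferentiableAt ℝ q z) :
    dzb (fun w => (q w : ℂ)) z = conj (dz (fun w => (q w : ℂ)) z) := by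
  simp only [dz, dzb, fderiv_ofReal_comp hq]
  simp

/-- The leading terms `f`, `h`, `j` at past null infinity of `F_{rI}` and its first two
derivatives along `∂/∂v` (as complex functions of the stereographic coordinate), for a Maxwell
field with a stationary energy tensor on a stationary background. -/
structure LeadingTerms (n m : ℕ) (ε : ℝ) (f h j : ℂ → ℂ) : Prop where
  smooth_f : ContDiff ℝ ∞ f
  smooth_h : ContDiff ℝ ∞ h
  smooth_j : ContDiff ℝ ∞ j
  rr : ∀ z, (conj (f z) * h z).re = 0
  rr' : ∀ z, (conj (f z) * j z).re + ε * normSq (h z) = 0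
  rI : ∀ z, dz h z / (m + 1) * conj (f z) + dz f z / (n + 1) * conj (h z) = 0
  rI' : ∀ z, dz j z / (m + 2) * conj (f z) + 2 * ε * (dz h z / (m + 1)) * conj (h z)
    + dz f z / (n + 1) * conj (j z) = 0
  evol : ∀ z, 2 * ε * h z = (n + 2) * f z
    + dzb (fun w => (((1 + normSq w) ^ 2 / 4 : ℝ) : ℂ) * (dz f w / (n + 1))) z
  evol' : ∀ z, 2 * j z = (m + 2) * h z
    + dzb (fun w => (((1 + normSq w) ^ 2 / 4 : ℝ) : ℂ) * (dz h w / (m + 1))) z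

namespace LeadingTerms

variable {n m : ℕ} {ε : ℝ} {f h j : ℂ → ℂ}

/-- The rate of rotation of the leading term. -/
def rate (f h : ℂ → ℂ) (z : ℂ) : ℝ := (conj (f z) * h z).im / normSq (f z)

variable (L : LeadingTerms n m ε f h j)

include L

/-- By `rr` the number conj f · h is purely imaginary: the length of the leading term is stationary,
so it can only rotate. -/
theorem h_eq {z : ℂ} (hf : f z ≠ 0) : h z = I * rate f h z * f z := by
  have h0 : conj (f z) ≠ 0 := by simpa using hf
  have h1 : conj (f z) * h z = I * ((conj (f z) * h z).im : ℂ) := by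
    apply Complex.ext
    · simp only [L.rr z]; simp
    · simp
  apply mul_left_cancel₀ h0
  rw [h1, rate]
  push_cast
  rw [normSq_eq_conj_mul_self]
  field_simp

/-- The real part of conj f · j is prescribed by `rr'`; it gives the centripetal term -ε q², the
imaginary part being free. -/
theorem j_eq {z : ℂ} (hf : f z ≠ 0) :
    j z = (I * rate f j z - ε * rate f h z ^ 2) * f z := by
  have h0 : conj (f z) ≠ 0 := by simpa using hf
  have h2 := L.rr' z
  have h3 : normSq (h z) = rate f h z ^ 2 * normSq (f z) := by
    conv_lhs => rw [L.h_eq hf]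
    simp only [normSq_mul, normSq_I, normSq_ofReal]
    ring
  rw [h3] at h2
  have h1 : conj (f z) * j z
      = I * ((conj (f z) * j z).im : ℂ) - ((ε * (rate f h z ^ 2 * normSq (f z)) : ℝ) : ℂ) := by
    apply Complex.ext
    · simp only [sub_re, I_mul_re, ofReal_im, neg_zero, ofReal_re]; linarith
    · rw [sub_im, ofReal_im, I_mul_im, ofReal_re, sub_zero]
  have h4 : ((conj (f z) * j z).im : ℂ) = rate f j z * (conj (f z) * f z) := by
    have : (normSq (f z) : ℝ) ≠ 0 := by simpa using hf
    rw [← normSq_eq_conj_mul_self, rate]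
    push_cast
    rw [div_mul_cancel₀]
    exact_mod_cast this
  apply mul_left_cancel₀ h0
  rw [h1, h4]
  push_cast
  rw [normSq_eq_conj_mul_self]
  ring

theorem isOpen_ne : IsOpen {z | f z ≠ 0} :=
  isOpen_ne_fun L.smooth_f.continuous continuous_const

omit L in
theorem rate_differentiableAt {g : ℂ → ℂ} (hf : ContDiff ℝ ∞ f) (hg : ContDiff ℝ ∞ g) {z : ℂ}
    (h0 : f z ≠ 0) : DifferentiableAt ℝ (rate f g) z := by
  have df : DifferentiableAt ℝ f z := hf.differentiable (by simp) z
  have dg : DifferentiableAt ℝ g z := hg.differentiable (by simp) z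
  have h1 : DifferentiableAt ℝ (fun w => conj (f w) * g w) z :=
    (conjCLE.differentiableAt.comp z df).mul dg
  have h2 : DifferentiableAt ℝ (fun w => (conj (f w) * g w).im) z :=
    (imCLM.differentiableAt (x := conj (f z) * g z)).comp z h1
  have h3 : DifferentiableAt ℝ (fun w => normSq (f w)) z := by
    have h4 : (fun w => normSq (f w)) = fun w => (f w).re * (f w).re + (f w).im * (f w).im := by
      funext w; rw [normSq_apply]
    have a := (reCLM.differentiableAt (x := f z)).comp z df
    have b := (imCLM.differentiableAt (x := f z)).comp z df
    rw [h4]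
    exact (a.mul a).add (b.mul b)
  have h5 := h2.fun_mul (h3.fun_inv (by simpa using h0))
  have h6 : rate f g = fun w => (conj (f w) * g w).im * (normSq (f w))⁻¹ := by
    funext w
    rw [rate, div_eq_mul_inv]
  rw [h6]
  exact h5

/-- Substituting h = i q f into `rI` leaves a factor conj f, which cancels. -/
theorem dz_h_eq {z : ℂ} (hf : f z ≠ 0) :
    dz h z / (m + 1) = I * rate f h z * (dz f z / (n + 1)) := by
  have h0 : conj (f z) ≠ 0 := by simpa using hf
  have := L.rI z
  rw [show conj (h z) = -(I * rate f h z) * conj (f z) by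
    rw [L.h_eq hf]; simp] at this
  apply mul_right_cancel₀ h0
  linear_combination this

/-- Comparing `dz_h_eq` with the derivative of h = i q f gives N ∂q/q = p ∂f/f with N = n + 1, p = m
- n, wherever q ≠ 0. -/
theorem dz_rate {z : ℂ} (hf : f z ≠ 0) :
    ((n : ℂ) + 1) * f z * dz (fun w => (rate f h w : ℂ)) z
      = ((m : ℂ) - n) * rate f h z * dz f z := by
  have hn : (n : ℂ) + 1 ≠ 0 := by exact_mod_cast n.succ_ne_zero
  have hm' : (m : ℂ) + 1 ≠ 0 := by exact_mod_cast m.succ_ne_zero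
  have dq := differentiableAt_ofReal_comp (rate_differentiableAt L.smooth_f L.smooth_h hf)
  have df : DifferentiableAt ℝ f z := L.smooth_f.differentiable (by simp) z
  have e : h =ᶠ[𝓝 z] fun w => I * ((rate f h w : ℂ) * f w) := by
    filter_upwards [L.isOpen_ne.mem_nhds hf] with w hw
    rw [L.h_eq hw]; ring
  have h1 := L.dz_h_eq hf
  rw [dz_congr e, dz_const_mul _ (dq.fun_mul df), dz_mul dq df] at h1
  field_simp at h1
  linear_combination h1

/-- The analogue for the second derivative, N ∂x/x = (p+1) ∂f/f. The terms quadratic in q cancel by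
`dz_rate`, up to a multiple of ε (m - n - 1), which is zero. -/
theorem dz_rate' (hε : ε = if m = n + 1 then 1 else 0) {z : ℂ} (hf : f z ≠ 0) :
    ((n : ℂ) + 1) * f z * dz (fun w => (rate f j w : ℂ)) z
      = ((m : ℂ) - n + 1) * rate f j z * dz f z := by
  have hn : (n : ℂ) + 1 ≠ 0 := by exact_mod_cast n.succ_ne_zero
  have hm' : (m : ℂ) + 2 ≠ 0 := by exact_mod_cast (m + 1).succ_ne_zero
  have hm1 : (m : ℂ) + 1 ≠ 0 := by exact_mod_cast m.succ_ne_zero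
  have h0 : conj (f z) ≠ 0 := by simpa using hf
  have dq := differentiableAt_ofReal_comp (rate_differentiableAt L.smooth_f L.smooth_h hf)
  have dx := differentiableAt_ofReal_comp (rate_differentiableAt L.smooth_f L.smooth_j hf)
  have df : DifferentiableAt ℝ f z := L.smooth_f.differentiable (by simp) z
  have e : j =ᶠ[𝓝 z] fun w => (I * (rate f j w : ℂ)
      - ε * ((rate f h w : ℂ) * (rate f h w : ℂ))) * f w := by
    filter_upwards [L.isOpen_ne.mem_nhds hf] with w hw
    rw [L.j_eq hw]; ring
  have h1 := L.rI' z
  rw [L.dz_h_eq hf, show conj (h z) = -(I * rate f h z) * conj (f z) by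
    rw [L.h_eq hf]; simp, show conj (j z) = (-(I * rate f j z) - ε * rate f h z ^ 2) * conj (f z) by
    rw [L.j_eq hf]; simp] at h1
  have h2 : dz j z / (m + 2) = dz f z / (n + 1) * (I * rate f j z - ε * rate f h z ^ 2) := by
    apply mul_right_cancel₀ h0
    linear_combination h1 + 2 * ε * (rate f h z) ^ 2 * dz f z / (n + 1) * conj (f z) * I_sq
  have dI := dx.const_mul I
  have dqq := (dq.fun_mul dq).const_mul (ε : ℂ)
  rw [dz_congr e, dz_mul (dI.fun_sub dqq) df, dz_sub dI dqq, dz_const_mul _ dx,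
    dz_const_mul _ (dq.fun_mul dq), dz_mul dq dq] at h2
  have h3 := L.dz_rate hf
  have h4 : (ε : ℂ) * ((m : ℂ) - n - 1) = 0 := by
    rw [hε]
    split_ifs with hc
    · subst hc; push_cast; ring
    · simp
  field_simp at h2
  apply mul_left_cancel₀ I_ne_zero
  linear_combination h2 + 2 * ε * rate f h z * h3 + (rate f h z : ℂ) ^ 2 * dz f z * h4

/-- Since ∂h/(m+1) = i q ∂f/(n+1), the operator in `evol'` is that in `evol` multiplied by i q, plus
a term in which ∂/∂z̄ hits q. Subtracting i q times `evol` leaves 2 x f = p q f + conj(∂q) g, and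
`dz_rate` turns p q g into a multiple of f ∂q. The last term is the squared length of the gradient
of q on the unit sphere. -/
theorem eikonal {z : ℂ} (hf : f z ≠ 0) :
    2 * rate f j z * rate f h z * (((m : ℝ) - n))
      = ((m : ℝ) - n) ^ 2 * rate f h z ^ 2
        + (1 + normSq z) ^ 2 / 4 * normSq (dz (fun w => (rate f h w : ℂ)) z) := by
  have hn : (n : ℂ) + 1 ≠ 0 := by exact_mod_cast n.succ_ne_zero
  have dqr := rate_differentiableAt L.smooth_f L.smooth_h hf
  have dq := differentiableAt_ofReal_comp dqr
  set g : ℂ → ℂ := fun w => (((1 + normSq w) ^ 2 / 4 : ℝ) : ℂ) * (dz f w / (n + 1)) with hg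
  have dg : DifferentiableAt ℝ g z := by
    have h1 : ContDiff ℝ ∞ (dz f) := by
      unfold dz
      have := L.smooth_f.fderiv_right (m := ∞) (by simp)
      exact (this.clm_apply contDiff_const).sub
        (contDiff_const.mul (this.clm_apply contDiff_const))
    have h2 : DifferentiableAt ℝ (fun w : ℂ => (1 + normSq w) ^ 2 / 4) z := by
      have h4 : (fun w : ℂ => (1 + normSq w) ^ 2 / 4)
          = fun w => (1 + (w.re * w.re + w.im * w.im)) ^ 2 / 4 := by
        funext w; rw [normSq_apply]
      have a : DifferentiableAt ℝ (fun w : ℂ => w.re) z := reCLM.differentiableAt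
      have b : DifferentiableAt ℝ (fun w : ℂ => w.im) z := imCLM.differentiableAt
      rw [h4]
      fun_prop
    exact (differentiableAt_ofReal_comp h2).mul
      ((h1.differentiable (by simp) z).fun_mul (differentiableAt_const ((n : ℂ) + 1)⁻¹))
  have e : (fun w => (((1 + normSq w) ^ 2 / 4 : ℝ) : ℂ) * (dz h w / (m + 1)))
      =ᶠ[𝓝 z] fun w => I * ((rate f h w : ℂ) * g w) := by
    filter_upwards [L.isOpen_ne.mem_nhds hf] with w hw
    rw [L.dz_h_eq hw, hg]; ring
  have e1 := L.evol z
  have e2 := L.evol' z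
  rw [dzb_congr e, dzb_const_mul _ (dq.fun_mul dg), dzb_mul dq dg, dzb_ofReal dqr,
    L.j_eq hf] at e2
  rw [L.h_eq hf] at e1 e2
  have h3 := L.dz_rate hf
  have h5 : 2 * rate f j z * f z = ((m : ℂ) - n) * rate f h z * f z
      + conj (dz (fun w => (rate f h w : ℂ)) z) * g z := by
    apply mul_left_cancel₀ I_ne_zero
    linear_combination e2 - I * rate f h z * e1 + 2 * ε * (rate f h z) ^ 2 * f z * I_sq
  have h6 : g z * (((m : ℂ) - n) * rate f h z) = (((1 + normSq z) ^ 2 / 4 : ℝ) : ℂ) *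
      f z * dz (fun w => (rate f h w : ℂ)) z := by
    rw [hg]
    field_simp
    linear_combination (-(((1 + normSq z) ^ 2 / 4 : ℝ) : ℂ)) * h3
  have h7 : (normSq (dz (fun w => (rate f h w : ℂ)) z) : ℂ)
    = conj (dz (fun w => (rate f h w : ℂ)) z) * dz (fun w => (rate f h w : ℂ)) z :=
    normSq_eq_conj_mul_self
  have : ((2 * rate f j z * rate f h z * (((m : ℝ) - n)) : ℝ) : ℂ)
      = (((m : ℝ) - n) ^ 2 * rate f h z ^ 2
        + (1 + normSq z) ^ 2 / 4 * normSq (dz (fun w => (rate f h w : ℂ)) z) : ℝ) := by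
    apply mul_left_cancel₀ hf
    push_cast at h6 ⊢
    rw [h7]
    linear_combination ((m : ℂ) - n) * rate f h z * h5
      + conj (dz (fun w => (rate f h w : ℂ)) z) * h6
  exact_mod_cast this

end LeadingTerms
end Electrovac

end

/-! ### The maximum principle on the sphere. -/

noncomputable section
open scoped ContDiff ComplexConjugate
open Set Filter Topology Complex
namespace Electrovac

/-- A function of the squared lengths of the leading terms that would attain a maximum on the
sphere. -/
def potential (N p : ℕ) (ε a b c : ℝ) : ℝ :=
  a ^ (2 * p) * ((b / a) ^ (2 * N))⁻¹
    * ((b / a) ^ (p + 1) / ((c - ε * b ^ 2 / a) / a) ^ p) ^ (2 * N + 1)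

/-- The square of the length, with respect to the metric of the round sphere (up to a constant),
of the 1-form with components `f`. -/
def sqLen (f : ℂ → ℂ) (z : ℂ) : ℝ := normSq (f z) * (1 + normSq z) ^ 2

theorem one_add_normSq_pos (z : ℂ) : 0 < 1 + normSq z := by
  have := normSq_nonneg z
  linarith

theorem sqLen_pos {f : ℂ → ℂ} {z : ℂ} (h : f z ≠ 0) : 0 < sqLen f z :=
  mul_pos (normSq_pos.2 h) (pow_pos (one_add_normSq_pos z) 2)

theorem sqLen_nonneg (f : ℂ → ℂ) (z : ℂ) : 0 ≤ sqLen f z :=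
  mul_nonneg (normSq_nonneg _) (sq_nonneg _)

theorem sqLen_eq_zero {f : ℂ → ℂ} {z : ℂ} (h : f z = 0) : sqLen f z = 0 := by
  simp [sqLen, h]

theorem continuous_sqLen {f : ℂ → ℂ} (hf : Continuous f) : Continuous (sqLen f) := by
  unfold sqLen
  have h1 : Continuous fun z => normSq (f z) := continuous_normSq.comp hf
  have h2 := continuous_normSq
  fun_prop

namespace LeadingTerms

variable {n m : ℕ} {ε : ℝ} {f h j : ℂ → ℂ}

section

variable (L : LeadingTerms n m ε f h j)

include L

theorem rate_ne_zero {z : ℂ} (hf : f z ≠ 0) (hh : h z ≠ 0) : rate f h z ≠ 0 := by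
  intro h0
  apply hh
  rw [L.h_eq hf, h0]
  simp

/-- The squares of the rates are functions of chart-independent lengths. Hence the potential,
written in these lengths, is a function on the whole sphere. -/
theorem sqLen_div {z : ℂ} (hf : f z ≠ 0) : sqLen h z / sqLen f z = rate f h z ^ 2 := by
  have h1 : normSq (f z) ≠ 0 := by simpa using hf
  have h2 := (one_add_normSq_pos z).ne'
  have h3 : normSq (h z) = rate f h z ^ 2 * normSq (f z) := by
    conv_lhs => rw [L.h_eq hf]
    simp only [normSq_mul, normSq_I, normSq_ofReal]
    ring
  rw [sqLen, sqLen, h3]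
  field_simp

theorem sqLen_div' (hε : ε ^ 2 = ε) {z : ℂ} (hf : f z ≠ 0) :
    (sqLen j z - ε * sqLen h z ^ 2 / sqLen f z) / sqLen f z = rate f j z ^ 2 := by
  have h1 : normSq (f z) ≠ 0 := by simpa using hf
  have h2 := (one_add_normSq_pos z).ne'
  have h4 := L.sqLen_div hf
  have h5 := (sqLen_pos hf).ne'
  have h3 : normSq (j z) = (rate f j z ^ 2 + ε * rate f h z ^ 4) * normSq (f z) := by
    conv_lhs => rw [L.j_eq hf]
    have : I * (rate f j z : ℂ) - ε * rate f h z ^ 2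
      = ((-(ε * rate f h z ^ 2) : ℝ) : ℂ) + ((rate f j z : ℝ) : ℂ) * I := by
      push_cast; ring
    rw [normSq_mul, this, normSq_add_mul_I]
    rw [show (-(ε * rate f h z ^ 2)) ^ 2 = ε ^ 2 * rate f h z ^ 4 by ring, hε]
    ring
  have h6 : sqLen j z = (rate f j z ^ 2 + ε * rate f h z ^ 4) * sqLen f z := by
    rw [sqLen, h3, sqLen]; ring
  have h7 : sqLen h z = rate f h z ^ 2 * sqLen f z := by
    rw [← h4]; field_simp
  rw [h6, h7]
  field_simp
  ring

/-- Dropping the gradient term in `eikonal` gives p q² ≤ 2 q x with p ≥ 1, hence |q| ≤ 2 |x|. -/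
theorem le_rate' (hm : n + 1 ≤ m) {z : ℂ} (hf : f z ≠ 0) (hh : h z ≠ 0) :
    rate f h z ^ 2 / 4 ≤ rate f j z ^ 2 := by
  have h1 := L.eikonal hf
  have hp : (1 : ℝ) ≤ (m : ℝ) - n := by
    have : ((n + 1 : ℕ) : ℝ) ≤ m := by exact_mod_cast hm
    push_cast at this
    linarith
  set p : ℝ := (m : ℝ) - n
  set q := rate f h z
  set x := rate f j z
  have hq : 0 < q ^ 2 := by
    have : q ≠ 0 := L.rate_ne_zero hf hh
    positivity
  have h2 : p ^ 2 * q ^ 2 ≤ 2 * x * q * p := by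
    have : 0 ≤ (1 + normSq z) ^ 2 / 4 * normSq (dz (fun w => (rate f h w : ℂ)) z) :=
      mul_nonneg (by positivity) (normSq_nonneg _)
    linarith
  have h3 : q ^ 2 ≤ 2 * x * q := by
    have h4 : p * (p * q ^ 2) ≤ p * (2 * x * q) := by linarith
    have h5 := le_of_mul_le_mul_left h4 (by linarith)
    nlinarith
  have h4 : q ^ 2 * q ^ 2 ≤ q ^ 2 * (4 * x ^ 2) := by nlinarith
  have := le_of_mul_le_mul_left h4 hq
  linarith

theorem rate'_ne_zero (hm : n + 1 ≤ m) {z : ℂ} (hf : f z ≠ 0) (hh : h z ≠ 0) :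
    rate f j z ≠ 0 := by
  intro h0
  have h1 := L.le_rate' hm hf hh
  rw [h0] at h1
  have : rate f h z ≠ 0 := L.rate_ne_zero hf hh
  have : 0 < rate f h z ^ 2 := by positivity
  linarith

theorem isOpen_ne' : IsOpen {z | f z ≠ 0 ∧ h z ≠ 0} :=
  L.isOpen_ne.inter (isOpen_ne_fun L.smooth_h.continuous continuous_const)

/-- A first integral. -/
theorem fderiv_rates (hm : n + 1 ≤ m) (hε : ε = if m = n + 1 then 1 else 0) {z : ℂ}
    (hf : f z ≠ 0) (hh : h z ≠ 0) :
    fderiv ℝ (fun w => rate f h w ^ (m - n + 1) / rate f j w ^ (m - n)) z = 0 := by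
  have dq := rate_differentiableAt L.smooth_f L.smooth_h hf
  have dx := rate_differentiableAt L.smooth_f L.smooth_j hf
  have hq := L.rate_ne_zero hf hh
  have hx := L.rate'_ne_zero hm hf hh
  have hp : ((m - n : ℕ) : ℂ) = (m : ℂ) - n := by push_cast [Nat.cast_sub (show n ≤ m by omega)]; rfl
  obtain ⟨p, hp'⟩ : ∃ p, m - n = p + 1 := ⟨m - n - 1, by omega⟩
  have hn : (n : ℂ) + 1 ≠ 0 := by exact_mod_cast n.succ_ne_zero
  have h1 := L.dz_rate hf
  have h2 := L.dz_rate' hε hf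
  rw [← hp, hp'] at h1 h2
  -- Here `p` is m - n - 1. The logarithmic derivatives of q and x are both multiples of ∂f/f, in
  -- the ratio p + 1 to p + 2; as q and x are real, this passes to all real derivatives.
  have h3 : ((p : ℂ) + 2) * rate f j z * dz (fun w => (rate f h w : ℂ)) z
      = (p + 1) * rate f h z * dz (fun w => (rate f j w : ℂ)) z := by
    apply mul_left_cancel₀ (mul_ne_zero hn hf)
    push_cast at h1 h2
    linear_combination ((p : ℂ) + 2) * rate f j z * h1 - (p + 1) * rate f h z * h2
  simp only [dz, fderiv_ofReal_comp dq, fderiv_ofReal_comp dx] at h3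
  have h4 := congrArg Complex.re h3
  have h5 := congrArg Complex.im h3
  have key : ∀ v : ℂ, ((p : ℝ) + 2) * rate f j z * fderiv ℝ (rate f h) z v
      = (p + 1) * rate f h z * fderiv ℝ (rate f j) z v := by
    have e1 : ((p : ℝ) + 2) * rate f j z * fderiv ℝ (rate f h) z 1
      = (p + 1) * rate f h z * fderiv ℝ (rate f j) z 1 := by simpa using h4
    have e2 : ((p : ℝ) + 2) * rate f j z * fderiv ℝ (rate f h) z I
      = (p + 1) * rate f h z * fderiv ℝ (rate f j) z I := by simpa using h5
    intro v
    have hv : v = v.re • (1 : ℂ) + v.im • I := by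
      simp [re_add_im]
    rw [hv]
    simp only [map_add, map_smul, smul_eq_mul]
    linear_combination v.re * e1 + v.im * e2
  have hd := (dq.hasFDerivAt.pow (p + 2)).mul
    ((hasDerivAt_inv (pow_ne_zero (p + 1) hx)).comp_hasFDerivAt z (dx.hasFDerivAt.pow (p + 1)))
  have he : (fun w => rate f h w ^ (m - n + 1) / rate f j w ^ (m - n))
      = (fun x => rate f h x ^ (p + 2)) * ((fun x : ℝ => x⁻¹) ∘ fun x => rate f j x ^ (p + 1)) := by
    funext w
    simp [hp', div_eq_mul_inv]
  rw [he, hd.fderiv]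
  ext v
  have k := key v
  simp only [_root_.add_apply, _root_.smul_apply, smul_eq_mul,
    nsmul_eq_mul, Function.comp_apply, _root_.zero_apply, Nat.add_sub_cancel]
  have e1 : p + 2 - 1 = p + 1 := rfl
  rw [e1]
  push_cast
  field_simp
  linear_combination (rate f h z ^ (p + 1) * rate f j z ^ p) * k

/-- The function `conj (f ^ p / q ^ N)` is holomorphic. -/
theorem differentiableAt_holo (hm : n + 1 ≤ m) {z : ℂ} (hf : f z ≠ 0) (hh : h z ≠ 0) :
    DifferentiableAt ℂ (fun w => conj (f w) ^ (m - n) * ((rate f h w : ℂ) ^ (n + 1))⁻¹) z := by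
  have dq := rate_differentiableAt L.smooth_f L.smooth_h hf
  have df : DifferentiableAt ℝ f z := L.smooth_f.differentiable (by simp) z
  have hq : (rate f h z : ℂ) ≠ 0 := by exact_mod_cast L.rate_ne_zero hf hh
  have hp : ((m - n : ℕ) : ℂ) = (m : ℂ) - n := by push_cast [Nat.cast_sub (show n ≤ m by omega)]; rfl
  obtain ⟨p, hp'⟩ : ∃ p, m - n = p + 1 := ⟨m - n - 1, by omega⟩
  have h1 := L.dz_rate hf
  rw [← hp, hp'] at h1
  have hq' := (ofRealCLM.hasFDerivAt (x := rate f h z)).comp z dq.hasFDerivAt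
  have hf' := (conjCLE.hasFDerivAt (x := f z)).comp z df.hasFDerivAt
  have hd := (hf'.pow (p + 1)).mul
    (((hasDerivAt_inv (pow_ne_zero (n + 1) hq)).hasFDerivAt.restrictScalars ℝ).comp z
      (hq'.pow (n + 1)))
  have he : (fun w => conj (f w) ^ (m - n) * ((rate f h w : ℂ) ^ (n + 1))⁻¹)
      = (fun x => (⇑conjCLE ∘ f) x ^ (p + 1)) *
        ((fun x : ℂ => x⁻¹) ∘ fun x => (⇑ofRealCLM ∘ rate f h) x ^ (n + 1)) := by
    funext w
    simp [hp']
  rw [he, differentiableAt_complex_iff_differentiableAt_real]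
  refine ⟨hd.differentiableAt, ?_⟩
  rw [hd.fderiv]
  -- The Cauchy–Riemann equation to be checked is the conjugate of `dz_rate`.
  have h2 := congrArg conj h1
  simp only [dz, fderiv_ofReal_comp dq, map_mul, map_sub, map_add, conj_ofReal, conj_I, map_one,
    map_natCast] at h2
  have e1 : p + 1 - 1 = p := rfl
  have e2 : n + 1 - 1 = n := rfl
  simp only [_root_.add_apply, _root_.smul_apply, smul_eq_mul,
    nsmul_eq_mul, Function.comp_apply, ContinuousLinearMap.comp_apply,
    ContinuousLinearMap.coe_restrictScalars', ofRealCLM_apply,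
    ContinuousLinearEquiv.coe_coe, conjCLE_apply, e1, e2, ContinuousLinearMap.toSpanSingleton_apply]
  push_cast at h2 ⊢
  field_simp
  linear_combination (conj (f z) ^ p * (rate f h z : ℂ) ^ n) * (I * h2
    + (-((n : ℂ) + 1) * conj (f z) * fderiv ℝ (rate f h) z I
      + (p + 1) * rate f h z * conj (fderiv ℝ f z I)) * I_sq)

theorem potential_eq (hε : ε ^ 2 = ε) {z : ℂ} (hf : f z ≠ 0) :
    potential (n + 1) (m - n) ε (sqLen f z) (sqLen h z) (sqLen j z)
      = sqLen f z ^ (2 * (m - n)) * ((rate f h z ^ 2) ^ (2 * (n + 1)))⁻¹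
        * ((rate f h z ^ (m - n + 1) / rate f j z ^ (m - n)) ^ 2) ^ (2 * (n + 1) + 1) := by
  rw [potential, L.sqLen_div hf, L.sqLen_div' hε hf]
  congr 2
  rw [div_pow, ← pow_mul, ← pow_mul, ← pow_mul, ← pow_mul, mul_comm 2, mul_comm 2]

-- With the convention a / 0 = 0 the quotient b / a is zero wherever f or h is, and then so is the
-- whole expression; no case distinction is needed in `potential`.
omit L in
theorem potential_zero {z : ℂ} (hz : f z = 0 ∨ h z = 0) :
    potential (n + 1) (m - n) ε (sqLen f z) (sqLen h z) (sqLen j z) = 0 := by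
  have : sqLen h z / sqLen f z = 0 := by
    rcases hz with hz | hz
    · rw [sqLen_eq_zero hz, div_zero]
    · rw [sqLen_eq_zero hz, zero_div]
  rw [potential, this]
  simp

theorem potential_pos (hm : n + 1 ≤ m) (hε : ε ^ 2 = ε) {z : ℂ} (hf : f z ≠ 0) (hh : h z ≠ 0) :
    0 < potential (n + 1) (m - n) ε (sqLen f z) (sqLen h z) (sqLen j z) := by
  rw [L.potential_eq hε hf]
  have h1 := sqLen_pos hf
  have h2 := L.rate_ne_zero hf hh
  have h3 := L.rate'_ne_zero hm hf hh
  positivity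

/-- By `le_rate'` the square of q^(p+1)/x^p is at most 4^p q². Raised to the power 2N + 1 it
outweighs q^(-4N) and leaves a factor q²; this is why that exponent occurs in `potential`. The bound
vanishes at the zeros of f and h. -/
theorem potential_le (hm : n + 1 ≤ m) (hε : ε ^ 2 = ε) (z : ℂ) :
    potential (n + 1) (m - n) ε (sqLen f z) (sqLen h z) (sqLen j z)
      ≤ 4 ^ ((m - n) * (2 * (n + 1) + 1)) * (sqLen f z ^ (2 * (m - n) - 1) * sqLen h z) := by
  by_cases hz : f z = 0 ∨ h z = 0
  · rw [potential_zero (m := m) (n := n) (ε := ε) (j := j) hz]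
    have := sqLen_nonneg f z
    have := sqLen_nonneg h z
    positivity
  · push Not at hz
    obtain ⟨hf, hh⟩ := hz
    rw [L.potential_eq hε hf]
    have h1 := sqLen_pos hf
    have h2 := L.rate_ne_zero hf hh
    have h3 := L.rate'_ne_zero hm hf hh
    have h4 := L.le_rate' hm hf hh
    have h5 : sqLen h z = rate f h z ^ 2 * sqLen f z := by
      rw [← L.sqLen_div hf]; field_simp
    obtain ⟨p, hp⟩ : ∃ p, m - n = p + 1 := ⟨m - n - 1, by omega⟩
    set q := rate f h z
    set x := rate f j z
    have hq : 0 < q ^ 2 := by positivity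
    have hx : 0 < x ^ 2 := by positivity
    have h6 : (q ^ (m - n + 1) / x ^ (m - n)) ^ 2 ≤ 4 ^ (m - n) * q ^ 2 := by
      have h7 : (q ^ 2) ^ (m - n) ≤ 4 ^ (m - n) * (x ^ 2) ^ (m - n) := by
        rw [← mul_pow]
        exact pow_le_pow_left₀ hq.le (by linarith) _
      rw [div_pow, div_le_iff₀ (by positivity), ← pow_mul, ← pow_mul]
      calc q ^ ((m - n + 1) * 2) = (q ^ 2) ^ (m - n) * q ^ 2 := by
            rw [← pow_mul, ← pow_add]; congr 1; ring
        _ ≤ 4 ^ (m - n) * (x ^ 2) ^ (m - n) * q ^ 2 :=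
            mul_le_mul_of_nonneg_right h7 hq.le
        _ = 4 ^ (m - n) * q ^ 2 * x ^ ((m - n) * 2) := by
            rw [← pow_mul, mul_comm 2]; ring
    calc _ ≤ sqLen f z ^ (2 * (m - n)) * ((q ^ 2) ^ (2 * (n + 1)))⁻¹
        * (4 ^ (m - n) * q ^ 2) ^ (2 * (n + 1) + 1) := by
          apply mul_le_mul_of_nonneg_left _ (by positivity)
          exact pow_le_pow_left₀ (by positivity) h6 _
      _ = _ := by
          have e1 : 2 * (m - n) - 1 = 2 * p + 1 := by omega
          have e2 : 2 * (m - n) = 2 * p + 1 + 1 := by omega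
          have hq' : (q ^ 2) ^ (2 * (n + 1)) ≠ 0 := by positivity
          rw [h5, e1, e2, mul_pow, ← pow_mul, pow_succ (sqLen f z), pow_succ (q ^ 2) (2 * (n + 1))]
          field_simp
          rw [← pow_mul, ← pow_mul]
          ring

/-- At zeros of f or h the function is squeezed between 0 and the bound of `potential_le`; elsewhere
no denominator vanishes, the rates being nonzero. -/
theorem continuous_potential (hm : n + 1 ≤ m) (hε : ε ^ 2 = ε) :
    Continuous fun z => potential (n + 1) (m - n) ε (sqLen f z) (sqLen h z) (sqLen j z) := by
  have cf := continuous_sqLen L.smooth_f.continuous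
  have ch := continuous_sqLen L.smooth_h.continuous
  have cj := continuous_sqLen L.smooth_j.continuous
  rw [continuous_iff_continuousAt]
  intro z
  by_cases hz : f z = 0 ∨ h z = 0
  · have h0 := potential_zero (m := m) (n := n) (ε := ε) (j := j) hz
    rw [ContinuousAt, h0]
    have hc : Continuous fun z => (4 : ℝ) ^ ((m - n) * (2 * (n + 1) + 1)) *
      (sqLen f z ^ (2 * (m - n) - 1) * sqLen h z) := by fun_prop
    have hz0 : (4 : ℝ) ^ ((m - n) * (2 * (n + 1) + 1)) *
      (sqLen f z ^ (2 * (m - n) - 1) * sqLen h z) = 0 := by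
      rcases hz with hz | hz
      · rw [sqLen_eq_zero hz, zero_pow (by omega)]; ring
      · rw [sqLen_eq_zero hz]; ring
    have ht := hc.tendsto z
    rw [hz0] at ht
    refine tendsto_of_tendsto_of_tendsto_of_le_of_le tendsto_const_nhds ht (fun w => ?_)
      (fun w => L.potential_le hm hε w)
    by_cases hw : f w = 0 ∨ h w = 0
    · exact (potential_zero (m := m) (n := n) (ε := ε) (j := j) hw).ge
    · push Not at hw
      exact (L.potential_pos hm hε hw.1 hw.2).le
  · push Not at hz
    obtain ⟨hf, hh⟩ := hz
    have h1 := (sqLen_pos hf).ne'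
    have h2 : sqLen h z / sqLen f z ≠ 0 := div_ne_zero (sqLen_pos hh).ne' h1
    have h3 : (sqLen j z - ε * sqLen h z ^ 2 / sqLen f z) / sqLen f z ≠ 0 := by
      rw [L.sqLen_div' hε hf]
      exact pow_ne_zero 2 (L.rate'_ne_zero hm hf hh)
    have a1 := cf.continuousAt (x := z)
    have a2 := ch.continuousAt (x := z)
    have a3 := cj.continuousAt (x := z)
    unfold potential
    exact ((a1.pow _).mul (((a2.div a1 h1).pow _).inv₀ (pow_ne_zero _ h2))).mul
      ((((a2.div a1 h1).pow _).div ((((a3.sub ((continuousAt_const.mul (a2.pow 2)).div a1 h1))).div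
        a1 h1).pow _) (pow_ne_zero _ h3)).pow _)

/-- The potential has no positive local maximum. -/
theorem not_isLocalMax (hm : n + 1 ≤ m) (hε : ε = if m = n + 1 then 1 else 0) {z₀ : ℂ}
    (hf : f z₀ ≠ 0) (hh : h z₀ ≠ 0) : ¬ IsLocalMax
      (fun z => potential (n + 1) (m - n) ε (sqLen f z) (sqLen h z) (sqLen j z)) z₀ := by
  intro hmax
  have hε2 : ε ^ 2 = ε := by rw [hε]; split_ifs <;> norm_num
  set N := n + 1 with hN
  set p := m - n with hp
  obtain ⟨r, hr, hball⟩ := Metric.isOpen_iff.1 L.isOpen_ne' z₀ ⟨hf, hh⟩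
  -- On a ball without zeros of f and h the last factor of the potential is constant, so a maximum
  -- of the potential is one of |W| (1 + |z|²)^p, with W holomorphic.
  have hconst : ∀ z ∈ Metric.ball z₀ r,
      rate f h z ^ (p + 1) / rate f j z ^ p = rate f h z₀ ^ (p + 1) / rate f j z₀ ^ p := by
    intro z hz
    refine Metric.isOpen_ball.is_const_of_fderiv_eq_zero
      (convex_ball z₀ r).isPreconnected (fun w hw => ?_) (fun w hw => ?_) hz
      (Metric.mem_ball_self hr) (𝕜 := ℝ) (f := fun w => rate f h w ^ (p + 1) / rate f j w ^ p)
    · obtain ⟨w1, w2⟩ := hball hw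
      have dq := rate_differentiableAt L.smooth_f L.smooth_h w1
      have dx := rate_differentiableAt L.smooth_f L.smooth_j w1
      have := (dq.fun_pow (p + 1)).fun_mul
        ((dx.fun_pow p).fun_inv (pow_ne_zero p (L.rate'_ne_zero hm w1 w2)))
      simp only [← div_eq_mul_inv] at this
      exact this.differentiableWithinAt
    · obtain ⟨w1, w2⟩ := hball hw
      exact L.fderiv_rates hm hε w1 w2
  have hc0 : 0 < ((rate f h z₀ ^ (p + 1) / rate f j z₀ ^ p) ^ 2) ^ (2 * N + 1) := by
    have h2 := L.rate_ne_zero hf hh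
    have h3 := L.rate'_ne_zero hm hf hh
    positivity
  set W : ℂ → ℂ := fun w => conj (f w) ^ p * ((rate f h w : ℂ) ^ N)⁻¹ with hW
  have hnorm : ∀ w, (‖W w‖ * (1 + normSq w) ^ p) ^ 4
      = sqLen f w ^ (2 * p) * ((rate f h w ^ 2) ^ (2 * N))⁻¹ := by
    intro w
    have e1 : ‖f w‖ ^ 2 = normSq (f w) := (normSq_eq_norm_sq _).symm
    have e2 : |rate f h w| ^ 4 = rate f h w ^ 4 := by
      rw [← abs_pow]; exact abs_of_nonneg (by positivity)
    rw [hW, sqLen, ← e1]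
    simp only [norm_mul, norm_pow, norm_inv, RCLike.norm_conj, Complex.norm_real, Real.norm_eq_abs]
    rw [mul_pow, mul_pow, inv_pow, ← pow_mul, ← pow_mul, ← pow_mul, mul_pow, ← pow_mul, ← pow_mul,
      ← pow_mul, show N * 4 = 4 * N by ring, pow_mul |rate f h w|, e2, ← pow_mul,
      show 2 * (2 * N) = 4 * N by ring, show p * 4 = 2 * (2 * p) by ring]
    ring
  have hWmax : ∀ᶠ w in 𝓝 z₀, ‖W w‖ * (1 + normSq w) ^ p ≤ ‖W z₀‖ * (1 + normSq z₀) ^ p := by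
    filter_upwards [hmax, Metric.ball_mem_nhds z₀ hr] with w hw hwb
    rw [L.potential_eq hε2 (hball hwb).1, L.potential_eq hε2 hf, hconst w hwb] at hw
    have := le_of_mul_le_mul_right hw hc0
    rw [← hnorm, ← hnorm] at this
    have h1 := (one_add_normSq_pos z₀).le
    exact le_of_pow_le_pow_left₀ (by norm_num) (by positivity) this
  -- Lagrange's identity, the sharp form of the Cauchy–Schwarz inequality: equality holds only at w
  -- = z₀.
  have hcs : ∀ w : ℂ, ‖1 + conj z₀ * w‖ ^ 2 = (1 + normSq z₀) * (1 + normSq w)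
      - normSq (w - z₀) := by
    intro w
    rw [← normSq_eq_norm_sq]
    simp only [normSq_apply, add_re, add_im, mul_re, mul_im, conj_re, conj_im, one_re, one_im,
      sub_re, sub_im]
    ring
  -- A holomorphic minorant: |G| is at most (1 + |z₀|²)^p |W| (1 + |w|²)^p, with equality at z₀, so
  -- |G| also has a maximum there. By the maximum modulus principle G is constant near z₀, which
  -- contradicts the strict inequality at w ≠ z₀.
  set G : ℂ → ℂ := fun w => W w * (1 + conj z₀ * w) ^ (2 * p) with hG
  have hGn : ∀ w, ‖G w‖ = ‖W w‖ * (‖1 + conj z₀ * w‖ ^ 2) ^ p := by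
    intro w
    rw [hG]
    simp only [norm_mul, norm_pow]
    rw [pow_mul]
  have hG0 : ‖G z₀‖ = ‖W z₀‖ * (1 + normSq z₀) ^ p * (1 + normSq z₀) ^ p := by
    rw [hGn, hcs, sub_self, map_zero, sub_zero, mul_pow]; ring
  have hGle : ∀ w, ‖G w‖ ≤ ‖W w‖ * (1 + normSq w) ^ p * (1 + normSq z₀) ^ p := by
    intro w
    rw [hGn, mul_assoc, ← mul_pow]
    apply mul_le_mul_of_nonneg_left _ (norm_nonneg _)
    apply pow_le_pow_left₀ (by positivity)
    rw [hcs]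
    have := normSq_nonneg (w - z₀)
    linarith
  have hGd : ∀ᶠ w in 𝓝 z₀, DifferentiableAt ℂ G w := by
    filter_upwards [Metric.ball_mem_nhds z₀ hr] with w hw
    exact (L.differentiableAt_holo hm (hball hw).1 (hball hw).2).mul
      (((differentiableAt_const _).add ((differentiableAt_const _).mul differentiableAt_id)).pow _)
  have hGmax : IsLocalMax (norm ∘ G) z₀ := by
    filter_upwards [hWmax] with w hw
    have h1 := one_add_normSq_pos z₀
    calc ‖G w‖ ≤ _ := hGle w
      _ ≤ _ := mul_le_mul_of_nonneg_right hw (by positivity)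
      _ = ‖G z₀‖ := hG0.symm
  have hev := Complex.eventually_eq_of_isLocalMax_norm hGd hGmax
  have hall := (hev.and hWmax).and (Metric.ball_mem_nhds z₀ hr)
  have hne : ∀ᶠ w in 𝓝[≠] z₀, w ≠ z₀ := self_mem_nhdsWithin
  obtain ⟨w, ⟨⟨hw1, hw2⟩, hw3⟩, hw4⟩ := ((hall.filter_mono nhdsWithin_le_nhds).and hne).exists
  have hWw : 0 < ‖W w‖ := by
    rw [norm_pos_iff, hW]
    have h1 : conj (f w) ≠ 0 := by simpa using (hball hw3).1
    have h2 : (rate f h w : ℂ) ≠ 0 := by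
      exact_mod_cast L.rate_ne_zero (hball hw3).1 (hball hw3).2
    exact mul_ne_zero (pow_ne_zero _ h1) (inv_ne_zero (pow_ne_zero _ h2))
  have hlt : ‖G w‖ < ‖W w‖ * (1 + normSq w) ^ p * (1 + normSq z₀) ^ p := by
    rw [hGn, mul_assoc, ← mul_pow]
    apply mul_lt_mul_of_pos_left _ hWw
    apply pow_lt_pow_left₀ _ (by positivity) (by omega)
    rw [hcs]
    have : 0 < normSq (w - z₀) := normSq_pos.2 (sub_ne_zero.2 hw4)
    linarith
  have h1 := one_add_normSq_pos z₀
  have hle : ‖W w‖ * (1 + normSq w) ^ p * (1 + normSq z₀) ^ p ≤ ‖G z₀‖ := by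
    rw [hG0]
    exact mul_le_mul_of_nonneg_right hw2 (by positivity)
  rw [hw1] at hlt
  linarith

end

/-- There are no non-trivial leading terms on the sphere. -/
theorem false_of_sphere {f h j : Bool → ℂ → ℂ} (hm : n + 1 ≤ m)
    (hε : ε = if m = n + 1 then 1 else 0) (L : ∀ s, LeadingTerms n m ε (f s) (h s) (j s))
    (tf : ∀ s z, z ≠ 0 → sqLen (f s) z = sqLen (f (!s)) (conj z)⁻¹)
    (th : ∀ s z, z ≠ 0 → sqLen (h s) z = sqLen (h (!s)) (conj z)⁻¹)
    (tj : ∀ s z, z ≠ 0 → sqLen (j s) z = sqLen (j (!s)) (conj z)⁻¹)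
    {s₁ : Bool} {z₁ : ℂ} (hf : f s₁ z₁ ≠ 0) (hh : h s₁ z₁ ≠ 0) : False := by
  have hε2 : ε ^ 2 = ε := by rw [hε]; split_ifs <;> norm_num
  set Ψ : Bool → ℂ → ℝ := fun s z =>
    potential (n + 1) (m - n) ε (sqLen (f s) z) (sqLen (h s) z) (sqLen (j s) z) with hΨ
  have hc : ∀ s, Continuous (Ψ s) := fun s => (L s).continuous_potential hm hε2
  have ht : ∀ s z, z ≠ 0 → Ψ s z = Ψ (!s) (conj z)⁻¹ := by
    intro s z hz
    simp only [hΨ, tf s z hz, th s z hz, tj s z hz]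
  -- The closed unit discs of the two charts cover the sphere, so the larger of the two maxima on
  -- these discs is a global maximum.
  have hex : ∀ s, ∃ z₀, ∀ z ∈ Metric.closedBall (0 : ℂ) 1, Ψ s z ≤ Ψ s z₀ := by
    intro s
    obtain ⟨z₀, -, h0⟩ := (isCompact_closedBall (0 : ℂ) 1).exists_isMaxOn
      (Metric.nonempty_closedBall.2 zero_le_one) (hc s).continuousOn
    exact ⟨z₀, fun z hz => h0 hz⟩
  choose w hw using hex
  obtain ⟨s₀, hs₀⟩ : ∃ s₀, ∀ s, Ψ s (w s) ≤ Ψ s₀ (w s₀) := by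
    rcases le_total (Ψ true (w true)) (Ψ false (w false)) with h | h
    · exact ⟨false, fun s => by cases s <;> simp [h]⟩
    · exact ⟨true, fun s => by cases s <;> simp [h]⟩
  have hmax : ∀ s z, Ψ s z ≤ Ψ s₀ (w s₀) := by
    intro s z
    by_cases hz : ‖z‖ ≤ 1
    · exact (hw s z (by simpa using hz)).trans (hs₀ s)
    · push Not at hz
      have hz0 : z ≠ 0 := by
        rintro rfl
        simp at hz
        linarith
      rw [ht s z hz0]
      refine (hw (!s) _ ?_).trans (hs₀ _)
      simp only [mem_closedBall_zero_iff, norm_inv, RCLike.norm_conj]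
      exact inv_le_one_of_one_le₀ hz.le
  have hpos : 0 < Ψ s₀ (w s₀) :=
    ((L s₁).potential_pos hm hε2 hf hh).trans_le (hmax s₁ z₁)
  have hfh : f s₀ (w s₀) ≠ 0 ∧ h s₀ (w s₀) ≠ 0 := by
    by_contra hcon
    have : f s₀ (w s₀) = 0 ∨ h s₀ (w s₀) = 0 := by tauto
    exact hpos.ne' (potential_zero this)
  exact (L s₀).not_isLocalMax hm hε hfh.1 hfh.2 (Eventually.of_forall (hmax s₀))

end LeadingTerms
end Electrovac

end

/-! ### From real components at r = 0 to complex leading terms. -/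

noncomputable section
open scoped Manifold ContDiff ComplexConjugate
open Set Filter Topology Complex
namespace Electrovac

variable {D : Set Coord}

/-- The point of `r = 0` with given `v` and stereographic coordinate. -/
def scriPt (v : ℝ) (z : ℂ) : Coord := ![v, 0, z.re, z.im]

@[simp] theorem scriPt_one (v : ℝ) (z : ℂ) : scriPt v z 1 = 0 := rfl
@[simp] theorem scriPt_two (v : ℝ) (z : ℂ) : scriPt v z 2 = z.re := rfl
@[simp] theorem scriPt_three (v : ℝ) (z : ℂ) : scriPt v z 3 = z.im := rfl

theorem contDiff_scriPt (v : ℝ) : ContDiff ℝ ∞ (scriPt v) := by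
  rw [contDiff_pi]
  intro i
  fin_cases i
  · exact contDiff_const
  · exact contDiff_const
  · exact reCLM.contDiff
  · exact imCLM.contDiff

theorem eq_scriPt {y : Coord} (hy : y 1 = 0) : y = scriPt (y 0) ⟨y 2, y 3⟩ := by
  funext i
  fin_cases i <;> simp [scriPt, hy]

/-- A pair of functions on `r = 0` as a complex function of the stereographic coordinate. -/
def toComplex (v : ℝ) (a b : Coord → ℝ) (z : ℂ) : ℂ := ⟨a (scriPt v z), b (scriPt v z)⟩

theorem Lead.contDiff_scriPt (hD : ScriNbhd D) {k : ℕ} {f c : Coord → ℝ} (hf : Lead D k f c)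
    (v : ℝ) : ContDiff ℝ ∞ fun z => c (scriPt v z) := by
  obtain ⟨φ, h1, -, h3⟩ := hf
  have := h1.comp_contDiff (Electrovac.contDiff_scriPt v) fun z => hD.scri_mem _ rfl
  have e : (fun z => c (scriPt v z)) = φ ∘ scriPt v := funext fun z => (h3 _ rfl).symm
  rwa [e]

theorem toComplex_eq (v : ℝ) (a b : Coord → ℝ) : toComplex v a b
    = fun z => ((a (scriPt v z) : ℝ) : ℂ) + I * ((b (scriPt v z) : ℝ) : ℂ) := by
  funext z
  apply Complex.ext <;> simp [toComplex]

theorem contDiff_toComplex {v : ℝ} {a b : Coord → ℝ} (ha : ContDiff ℝ ∞ fun z => a (scriPt v z))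
    (hb : ContDiff ℝ ∞ fun z => b (scriPt v z)) : ContDiff ℝ ∞ (toComplex v a b) := by
  rw [toComplex_eq]
  exact (ofRealCLM.contDiff.comp ha).add (contDiff_const.mul (ofRealCLM.contDiff.comp hb))

theorem fderiv_scriPt_one {v : ℝ} {a : Coord → ℝ} {z : ℂ}
    (ha : ContDiff ℝ ∞ fun z => a (scriPt v z)) :
    fderiv ℝ (fun z => a (scriPt v z)) z 1 = tpd 2 a (scriPt v z) := by
  rw [← (ha.differentiable (by simp) z).lineDeriv_eq_fderiv, tpd, lineDeriv, lineDeriv]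
  congr 1
  funext t
  congr 1
  funext i
  fin_cases i <;> simp [scriPt]

theorem fderiv_scriPt_I {v : ℝ} {a : Coord → ℝ} {z : ℂ}
    (ha : ContDiff ℝ ∞ fun z => a (scriPt v z)) :
    fderiv ℝ (fun z => a (scriPt v z)) z I = tpd 3 a (scriPt v z) := by
  rw [← (ha.differentiable (by simp) z).lineDeriv_eq_fderiv, tpd, lineDeriv, lineDeriv]
  congr 1
  funext t
  congr 1
  funext i
  fin_cases i <;> simp [scriPt]

theorem fderiv_toComplex {v : ℝ} {a b : Coord → ℝ} {z : ℂ}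
    (ha : ContDiff ℝ ∞ fun z => a (scriPt v z)) (hb : ContDiff ℝ ∞ fun z => b (scriPt v z)) :
    fderiv ℝ (toComplex v a b) z 1 = ⟨tpd 2 a (scriPt v z), tpd 2 b (scriPt v z)⟩ ∧
    fderiv ℝ (toComplex v a b) z I = ⟨tpd 3 a (scriPt v z), tpd 3 b (scriPt v z)⟩ := by
  have da := ha.differentiable (by simp) z
  have db := hb.differentiable (by simp) z
  rw [toComplex_eq, fderiv_fun_add (differentiableAt_ofReal_comp da)
    ((differentiableAt_const I).fun_mul (differentiableAt_ofReal_comp db)),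
    fderiv_const_mul (differentiableAt_ofReal_comp db)]
  constructor
  · simp only [_root_.add_apply, _root_.smul_apply, smul_eq_mul, fderiv_ofReal_comp da,
      fderiv_ofReal_comp db, fderiv_scriPt_one ha, fderiv_scriPt_one hb]
    apply Complex.ext <;> simp
  · simp only [_root_.add_apply, _root_.smul_apply, smul_eq_mul, fderiv_ofReal_comp da,
      fderiv_ofReal_comp db, fderiv_scriPt_I ha, fderiv_scriPt_I hb]
    apply Complex.ext <;> simp

theorem dz_toComplex {v : ℝ} {a b : Coord → ℝ} {z : ℂ}
    (ha : ContDiff ℝ ∞ fun z => a (scriPt v z)) (hb : ContDiff ℝ ∞ fun z => b (scriPt v z)) :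
    dz (toComplex v a b) z = ⟨tpd 2 a (scriPt v z) + tpd 3 b (scriPt v z),
      tpd 2 b (scriPt v z) - tpd 3 a (scriPt v z)⟩ := by
  obtain ⟨h1, h2⟩ := fderiv_toComplex (z := z) ha hb
  rw [dz, h1, h2]
  apply Complex.ext <;> simp

theorem dzb_toComplex {v : ℝ} {a b : Coord → ℝ} {z : ℂ}
    (ha : ContDiff ℝ ∞ fun z => a (scriPt v z)) (hb : ContDiff ℝ ∞ fun z => b (scriPt v z)) :
    dzb (toComplex v a b) z = ⟨tpd 2 a (scriPt v z) - tpd 3 b (scriPt v z),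
      tpd 2 b (scriPt v z) + tpd 3 a (scriPt v z)⟩ := by
  obtain ⟨h1, h2⟩ := fderiv_toComplex (z := z) ha hb
  rw [dzb, h1, h2]
  apply Complex.ext <;> simp
  ring

theorem pd_zero_scri (hD : ScriNbhd D) {f : Coord → ℝ} (hf : ContDiffOn ℝ ∞ f D)
    (h : ∀ y : Coord, y 1 = 0 → f y = 0) (y : Coord) (hy : y 1 = 0) : pd 0 f y = 0 := by
  rw [← tpd_eq_pd (hf.diffAt hD.isOpen (hD.scri_mem y hy)),
    tpd_congr (c' := fun _ => 0) (by decide) h hy, tpd_const]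

namespace Coeffs

variable {C : Coeffs D} {X : Field}

/-- Divergence and curl of P are the real and imaginary parts of `dz` applied to p2 + i p3; the
weight is the reciprocal of the area density of the unit sphere. The second component carries a
division by `C.s` because B enters the evolution through B / s. -/
theorem div_toComplex (hs : ∀ y : Coord, y 1 = 0 → C.s y = 4 / (1 + y 2 ^ 2 + y 3 ^ 2) ^ 2)
    {v : ℝ} {k : ℕ} {p2 p3 : Coord → ℝ}
    (h2 : ContDiff ℝ ∞ fun z => p2 (scriPt v z)) (h3 : ContDiff ℝ ∞ fun z => p3 (scriPt v z)) :
    toComplex v (fun y => (tpd 2 p2 y + tpd 3 p3 y) / (k + 1) / C.s y)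
      (fun y => (tpd 2 p3 y - tpd 3 p2 y) / (k + 1) / C.s y)
    = fun w => (((1 + normSq w) ^ 2 / 4 : ℝ) : ℂ) * (dz (toComplex v p2 p3) w / (k + 1)) := by
  funext w
  have h0 : 0 < 1 + w.re ^ 2 + w.im ^ 2 := by positivity
  have hk : (k : ℝ) + 1 ≠ 0 := by positivity
  have e : ((k : ℂ) + 1) = ((k + 1 : ℝ) : ℂ) := by push_cast; rfl
  rw [dz_toComplex h2 h3, toComplex, hs _ rfl, e]
  apply Complex.ext
  · rw [re_ofReal_mul, div_ofReal_re]
    simp only [scriPt_two, scriPt_three, normSq_apply]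
    field_simp
    ring
  · rw [im_ofReal_mul, div_ofReal_im]
    simp only [scriPt_two, scriPt_three, normSq_apply]
    field_simp
    ring

variable (hM : C.Maxwell X) (hT : C.Energy X) (hX : X.Smooth D) (hD : ScriNbhd D)
  (hs : ∀ y : Coord, y 1 = 0 → C.s y = 4 / (1 + y 2 ^ 2 + y 3 ^ 2) ^ 2)
  (hE : ∀ y : Coord, y 1 = 0 → X.E y = 0) (hB : ∀ y : Coord, y 1 = 0 → X.B y = 0)
  (hQ2 : ∀ y : Coord, y 1 = 0 → X.Q2 y = 0) (hQ3 : ∀ y : Coord, y 1 = 0 → X.Q3 y = 0)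

include hM hX hD hs hE hB hQ2 hQ3 in
/-- The evolution equation in complex form. -/
theorem Maxwell.evol {k : ℕ} {p2 p3 : Coord → ℝ} (h2 : Lead D k X.P2 p2) (h3 : Lead D k X.P3 p3) :
    ∃ q2 q3, Lead D (k + 1) X.dv.P2 q2 ∧ Lead D (k + 1) X.dv.P3 q3 ∧
      ∀ v z, 2 * toComplex v q2 q3 z = (k + 2) * toComplex v p2 p3 z
        + dzb (fun w => (((1 + normSq w) ^ 2 / 4 : ℝ) : ℂ) *
          (dz (toComplex v p2 p3) w / (k + 1))) z := by
  have e := hM.lead_E hX hD h2 h3 hE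
  have b := hM.lead_B hX hD h2 h3 hB
  obtain ⟨q2, q3⟩ := hM.lead_dv hX hD h2 h3 e b hQ2 hQ3
  refine ⟨_, _, q2, q3, fun v z => ?_⟩
  have bs := lead_flux23 (C := C) b h2 h3
  rw [← div_toComplex hs (h2.contDiff_scriPt hD v) (h3.contDiff_scriPt hD v),
    dzb_toComplex (e.contDiff_scriPt hD v) (bs.contDiff_scriPt hD v)]
  apply Complex.ext
  · simp [toComplex]; ring
  · simp [toComplex]; ring

include hM hT hX hD hs hE hB hQ2 hQ3 in
/-- The leading terms of a Maxwell field with stationary energy tensor. -/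
theorem leadingTerms {n m : ℕ} (hnm : n + 1 ≤ m) {f2 f3 h2 h3 : Coord → ℝ}
    (hf2 : Lead D n X.P2 f2) (hf3 : Lead D n X.P3 f3)
    (hh2 : Lead D m X.dv.P2 h2) (hh3 : Lead D m X.dv.P3 h3) :
    ∃ j2 j3, Lead D (m + 1) X.dv.dv.P2 j2 ∧ Lead D (m + 1) X.dv.dv.P3 j3 ∧
      ∀ v, LeadingTerms n m (if m = n + 1 then 1 else 0)
        (toComplex v f2 f3) (toComplex v h2 h3) (toComplex v j2 j3) := by
  have hX' := hX.dv hD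
  have hX'' := hX'.dv hD
  have hM' := hM.dv hX hD
  have hM'' := hM'.dv hX' hD
  have hE' : ∀ y : Coord, y 1 = 0 → X.dv.E y = 0 := pd_zero_scri hD hX.E hE
  have hB' : ∀ y : Coord, y 1 = 0 → X.dv.B y = 0 := pd_zero_scri hD hX.B hB
  have hQ2' : ∀ y : Coord, y 1 = 0 → X.dv.Q2 y = 0 := pd_zero_scri hD hX.Q2 hQ2
  have hQ3' : ∀ y : Coord, y 1 = 0 → X.dv.Q3 y = 0 := pd_zero_scri hD hX.Q3 hQ3
  have hE'' : ∀ y : Coord, y 1 = 0 → X.dv.dv.E y = 0 := pd_zero_scri hD hX'.E hE'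
  have hB'' : ∀ y : Coord, y 1 = 0 → X.dv.dv.B y = 0 := pd_zero_scri hD hX'.B hB'
  obtain ⟨q2, q3, hq2, hq3, ev⟩ := hM.evol hX hD hs hE hB hQ2 hQ3 hf2 hf3
  obtain ⟨j2, j3, hj2, hj3, ev'⟩ := hM'.evol hX' hD hs hE' hB' hQ2' hQ3' hh2 hh3
  refine ⟨j2, j3, hj2, hj3, fun v => ?_⟩
  have he0 := hM.lead_E hX hD hf2 hf3 hE
  have hb0 := hM.lead_B hX hD hf2 hf3 hB
  have he1 := hM'.lead_E hX' hD hh2 hh3 hE'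
  have hb1 := hM'.lead_B hX' hD hh2 hh3 hB'
  have he2 := hM''.lead_E hX'' hD hj2 hj3 hE''
  have hb2 := hM''.lead_B hX'' hD hj2 hj3 hB''
  have key := fun z => hT.lead hX hD hnm hf2 hf3 hh2 hh3 hj2 hj3 he0 hb0 he1 hb1 he2 hb2
    (scriPt_one v z) rfl
  have sf2 := hf2.contDiff_scriPt hD v
  have sf3 := hf3.contDiff_scriPt hD v
  have sh2 := hh2.contDiff_scriPt hD v
  have sh3 := hh3.contDiff_scriPt hD v
  have sj2 := hj2.contDiff_scriPt hD v
  have sj3 := hj3.contDiff_scriPt hD v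
  -- The real part keeps the cancelling factors s and 1/s in order to match the shape of the
  -- coefficients in `key`.
  have dzdiv {p2 p3 : Coord → ℝ} (k : ℕ) (z : ℂ) (h2 : ContDiff ℝ ∞ fun z => p2 (scriPt v z))
      (h3 : ContDiff ℝ ∞ fun z => p3 (scriPt v z)) : dz (toComplex v p2 p3) z / (k + 1)
      = ⟨C.s (scriPt v z) * ((tpd 2 p2 (scriPt v z) + tpd 3 p3 (scriPt v z)) / (k + 1)
          / C.s (scriPt v z)),
        (tpd 2 p3 (scriPt v z) - tpd 3 p2 (scriPt v z)) / (k + 1)⟩ := by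
    have e : ((k : ℂ) + 1) = ((k + 1 : ℝ) : ℂ) := by push_cast; rfl
    have := (C.pos_s _ (hD.scri_mem _ (scriPt_one v z))).ne'
    rw [dz_toComplex h2 h3, e]
    apply Complex.ext
    · rw [div_ofReal_re]
      field_simp
    · rw [div_ofReal_im]
  have d0 := fun z => dzdiv n z sf2 sf3
  have d1 := fun z => dzdiv m z sh2 sh3
  have d2 := fun z => dzdiv (m + 1) z sj2 sj3
  constructor
  · exact contDiff_toComplex sf2 sf3
  · exact contDiff_toComplex sh2 sh3
  · exact contDiff_toComplex sj2 sj3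
  · intro z
    have := (key z).1
    simp [toComplex]
    linear_combination this
  · intro z
    have := (key z).2.1
    simp only [toComplex, mul_re, conj_re, conj_im, normSq_apply]
    linear_combination this
  · intro z
    obtain ⟨-, -, k3, k4, -, -⟩ := key z
    rw [d0, d1]
    apply Complex.ext
    · simp [toComplex]
      linear_combination k3
    · simp [toComplex]
      linear_combination -k4
  · intro z
    obtain ⟨-, -, -, -, k3, k4⟩ := key z
    push_cast at k3 k4
    rw [show (m : ℂ) + 2 = ((m + 1 : ℕ) : ℂ) + 1 by push_cast; ring, d0, d1, d2]
    set ε : ℝ := if m = n + 1 then 1 else 0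
    apply Complex.ext
    · simp [toComplex]
      linear_combination k3
    · simp [toComplex]
      linear_combination -k4
  · intro z
    -- The coefficient of r^(n+1) in ∂_v P is the leading term h if m = n + 1 and zero if m is
    -- larger; hence the left-hand side 2 ε h of `evol`.
    have e2 := (hh2.of_le_ite hnm).unique hD hq2 (scriPt_one v z)
    have e3 := (hh3.of_le_ite hnm).unique hD hq3 (scriPt_one v z)
    rw [← ev v z]
    set ε : ℝ := if m = n + 1 then 1 else 0
    apply Complex.ext
    · simp [toComplex]
      linear_combination 2 * e2
    · simp [toComplex]
      linear_combination 2 * e3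
  · exact fun z => ev' v z

end Coeffs
end Electrovac

end

/-! ### Analytic functions and their order of vanishing at r = 0. -/

noncomputable section
open scoped Manifold ContDiff ComplexConjugate
open Set Filter Topology Complex
namespace Electrovac

variable {D O : Set Coord}

/-! ### Vanishing order of analytic functions at `r = 0` -/

theorem continuous_update_one (y : Coord) :
    Continuous (fun t : ℝ => (Function.update y 1 t : Coord)) :=
  continuous_const.update 1 continuous_id

theorem analyticAt_update_one (y : Coord) (t : ℝ) :
    AnalyticAt ℝ (fun t : ℝ => (Function.update y 1 t : Coord)) t := by
  rw [analyticAt_pi_iff]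
  intro i
  by_cases hi : i = 1
  · subst hi
    simp only [Function.update_self]
    exact analyticAt_id
  · simpa [hi] using analyticAt_const

theorem analyticAt_update_zero (y : Coord) :
    AnalyticAt ℝ (fun z : Coord => (Function.update z 1 0 : Coord)) y := by
  rw [analyticAt_pi_iff]
  intro i
  by_cases hi : i = 1
  · subst hi
    simpa using analyticAt_const
  · simp only [Function.update_of_ne hi]
    exact (ContinuousLinearMap.proj (R := ℝ) (φ := fun _ : Fin 4 => ℝ) i).analyticAt y

/-- An analytic function that vanishes to infinite order at `r = 0` vanishes. -/
theorem eq_zero_of_lead (hD : ScriNbhd D) {f : Coord → ℝ} (hf : AnalyticOnNhd ℝ f O)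
    (hray : ∀ y ∈ O, ∀ t, 0 ≤ t → t ≤ y 1 → Function.update y 1 t ∈ O)
    (h : ∀ k, ∃ c, Lead D k f c) {y : Coord} (hy : y ∈ O) (h0 : 0 < y 1) : f y = 0 := by
  have hu : AnalyticOnNhd ℝ (fun t : ℝ => f (Function.update y 1 t)) (Icc 0 (y 1)) := fun t ht =>
    (hf _ (hray y hy t ht.1 ht.2)).comp (f := fun t : ℝ => (Function.update y 1 t : Coord))
      (analyticAt_update_one y t)
  -- Otherwise f = t^n g along the ray with g(0) ≠ 0, and vanishing to order n + 1 would give g(0) =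
  -- 0.
  have hz : ∀ᶠ t in 𝓝 (0 : ℝ), f (Function.update y 1 t) = 0 := by
    by_contra hcon
    have ha := hu 0 ⟨le_rfl, h0.le⟩
    obtain ⟨n, g, hg, hg0, hfg⟩ := ha.exists_eventuallyEq_pow_smul_nonzero_iff.2 hcon
    obtain ⟨c, hc⟩ := h (n + 1)
    obtain ⟨φ, h1, h2, -⟩ := hc
    have hyD : Function.update y 1 0 ∈ D := hD.scri_mem _ (by simp)
    have hmem : ∀ᶠ t in 𝓝 (0 : ℝ), Function.update y 1 t ∈ D :=
      (continuous_update_one y).continuousAt.eventually (hD.isOpen.mem_nhds hyD)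
    have hφ : Tendsto (fun t : ℝ => t * φ (Function.update y 1 t)) (𝓝[>] 0) (𝓝 0) := by
      have h3 := (h1.continuousOn.continuousAt (hD.isOpen.mem_nhds hyD)).comp (x := (0 : ℝ))
        (f := fun t : ℝ => (Function.update y 1 t : Coord)) (continuous_update_one y).continuousAt
      have := continuousAt_id.mul h3
      have h4 := this.tendsto
      rw [Pi.mul_apply, id, zero_mul] at h4
      exact h4.mono_left nhdsWithin_le_nhds
    refine hg0 (tendsto_nhds_unique (hg.continuousAt.tendsto.mono_left nhdsWithin_le_nhds)
      (hφ.congr' ?_))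
    filter_upwards [hfg.filter_mono nhdsWithin_le_nhds, hmem.filter_mono nhdsWithin_le_nhds,
      self_mem_nhdsWithin] with t t1 t2 t3
    have t3 : 0 < t := t3
    rw [h2 _ t2 (by simpa using t3)] at t1
    simp only [Function.update_self, sub_zero, smul_eq_mul] at t1
    rw [pow_succ, mul_assoc] at t1
    exact mul_left_cancel₀ (pow_ne_zero n t3.ne') t1
  -- The identity theorem along the ray, which stays in `O` by `hray` though it may leave `D`.
  have := hu.eqOn_zero_of_preconnected_of_eventuallyEq_zero isPreconnected_Icc
    (z₀ := 0) ⟨le_rfl, h0.le⟩ hz (x := y 1) ⟨h0.le, le_rfl⟩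
  simpa using this

/-- A family of analytic functions either vanishes or has a well-defined vanishing order at
`r = 0`. -/
theorem eq_zero_or_exists_lead {ι : Type*} {D O : ι → Set Coord} {f : ι → Coord → ℝ}
    (hD : ∀ i, ScriNbhd (D i)) (hDO : ∀ i, D i ⊆ O i)
    (hf : ∀ i, AnalyticOnNhd ℝ (f i) (O i))
    (hray : ∀ i, ∀ y ∈ O i, ∀ t, 0 ≤ t → t ≤ y 1 → Function.update y 1 t ∈ O i) :
    (∀ i, ∀ y ∈ O i, 0 < y 1 → f i y = 0) ∨
    ∃ n, ∃ c : ι → Coord → ℝ, (∀ i, Lead (D i) n (f i) (c i)) ∧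
      ∃ i y, y 1 = 0 ∧ c i y ≠ 0 := by
  by_cases hcon : ∃ n, ∃ c : ι → Coord → ℝ, (∀ i, Lead (D i) n (f i) (c i)) ∧
      ∃ i y, y 1 = 0 ∧ c i y ≠ 0
  · exact Or.inr hcon
  left
  have key : ∀ n, ∃ c : ι → Coord → ℝ, ∀ i, Lead (D i) n (f i) (c i) := by
    intro n
    induction n with
    | zero => exact ⟨f, fun i => Lead.of_smooth ((hf i).mono (hDO i)).contDiffOn_of_completeSpace⟩
    | succ n ih =>
      obtain ⟨c, hc⟩ := ih
      have : ∀ i, ∃ c', Lead (D i) (n + 1) (f i) c' := fun i =>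
        (hc i).raise (hD i) fun y hy => by
          by_contra h
          exact hcon ⟨n, c, hc, i, y, hy, h⟩
      choose c' hc' using this
      exact ⟨c', hc'⟩
  intro i y hy h0
  refine eq_zero_of_lead (hD i) (hf i) (hray i) (fun k => ?_) hy h0
  obtain ⟨c, hc⟩ := key k
  exact ⟨_, hc i⟩

/-- For k = 0 the leading coefficient is a nonzero multiple of the n-th r-derivative at r = 0; so it
inherits analyticity. -/
theorem Lead.iterate_pd_one (hD : ScriNbhd D) {f c : Coord → ℝ} (n k : ℕ)
    (hf : Lead D (n + k) f c) : ∃ a : ℝ, a ≠ 0 ∧ Lead D k ((pd 1)^[n] f) (fun y => a * c y) := by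
  induction n generalizing k with
  | zero => exact ⟨1, one_ne_zero, by simpa using hf⟩
  | succ n ih =>
    obtain ⟨a, ha, h⟩ := ih (k + 1) (hf.cast (by omega))
    refine ⟨(k + 1) * a, by positivity, ?_⟩
    rw [Function.iterate_succ_apply']
    exact (h.pd_one hD).congr_lead fun y _ => by ring

/-- The leading term of an analytic function is analytic. -/
theorem Lead.analytic (hD : ScriNbhd D) (hDO : D ⊆ O) {f c : Coord → ℝ}
    (hf : AnalyticOnNhd ℝ f O) {n : ℕ} (hc : Lead D n f c) :
    AnalyticOnNhd ℝ (fun y : Coord => c (Function.update y 1 0)) univ := by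
  have ha : AnalyticOnNhd ℝ ((pd 1)^[n] f) O := by
    clear hc
    induction n with
    | zero => exact hf
    | succ n ih => rw [Function.iterate_succ_apply']; exact ih.pderiv 1
  obtain ⟨a, ha0, h⟩ := hc.iterate_pd_one hD n 0
  have h' := Lead.of_smooth (ha.mono hDO).contDiffOn_of_completeSpace
  have e : (fun y : Coord => c (Function.update y 1 0))
      = fun y => a⁻¹ * ((pd 1)^[n] f) (Function.update y 1 0) := by
    funext y
    rw [h'.unique hD h (by simp)]
    field_simp
  rw [e]
  intro y _
  exact analyticAt_const.mul ((ha _ (hDO (hD.scri_mem _ (by simp)))).comp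
    (analyticAt_update_zero y))

/-- The ring of functions that are analytic on `r = 0` has no zero divisors. -/
theorem eq_zero_of_mul_eq_zero {u w : Coord → ℝ}
    (hu : AnalyticOnNhd ℝ (fun y : Coord => u (Function.update y 1 0)) univ)
    (hw : AnalyticOnNhd ℝ (fun y : Coord => w (Function.update y 1 0)) univ)
    (h : ∀ y : Coord, y 1 = 0 → u y * w y = 0) {y₀ : Coord} (h0 : y₀ 1 = 0) (hw0 : w y₀ ≠ 0)
    {y : Coord} (hy : y 1 = 0) : u y = 0 := by
  have e {y : Coord} (hy : y 1 = 0) : Function.update y 1 0 = y := by rw [← hy]; simp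
  have hev : ∀ᶠ z in 𝓝 y₀, u (Function.update z 1 0) = 0 := by
    have : ∀ᶠ z in 𝓝 y₀, w (Function.update z 1 0) ≠ 0 :=
      (hw y₀ trivial).continuousAt.eventually_ne (by rwa [e h0])
    filter_upwards [this] with z hz
    exact (mul_eq_zero.1 (h _ (by simp))).resolve_right hz
  have := hu.eqOn_zero_of_preconnected_of_eventuallyEq_zero isPreconnected_univ
    (z₀ := y₀) trivial hev (x := y) trivial
  simpa [e hy] using this

end Electrovac

end

/-! ### The transition between the two stereographic charts. -/

noncomputable section
open scoped Manifold ContDiff ComplexConjugate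
open Set Filter Topology Complex
namespace Electrovac

/-! ### The field in the two stereographic charts -/

theorem continuousAt_inversion {y : Coord} (hy : y 2 ^ 2 + y 3 ^ 2 ≠ 0) :
    ContinuousAt inversion y := by
  have c : ∀ i : Fin 4, ContinuousAt (fun z : Coord => z i) y :=
    fun i => (continuous_apply i).continuousAt
  have hc : ContinuousAt (fun z : Coord => z 2 ^ 2 + z 3 ^ 2) y := ((c 2).pow 2).add ((c 3).pow 2)
  rw [continuousAt_pi]
  intro i
  fin_cases i
  · exact c 0
  · exact c 1
  · exact (c 2).div hc hy
  · exact (c 3).div hc hy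

theorem inversion_scriPt (v : ℝ) (z : ℂ) : inversion (scriPt v z) = scriPt v (conj z)⁻¹ := by
  funext i
  fin_cases i
  · rfl
  · rfl
  · simp [inversion, scriPt, normSq_apply, sq]
  · simp [inversion, scriPt, normSq_apply, sq]

/-- The transformation law for the components `F_{rI}` under the transition between the two
stereographic charts. -/
def Transforms (O : Bool → Set Coord) (X : Bool → Field) : Prop :=
  ∀ s, ∀ y ∈ O s, 0 < y 1 → y 2 ^ 2 + y 3 ^ 2 ≠ 0 → inversion y ∈ O (!s) ∧
    (X s).P2 y = ((y 3 ^ 2 - y 2 ^ 2) / (y 2 ^ 2 + y 3 ^ 2) ^ 2) * (X (!s)).P2 (inversion y)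
      + (-2 * y 2 * y 3 / (y 2 ^ 2 + y 3 ^ 2) ^ 2) * (X (!s)).P3 (inversion y) ∧
    (X s).P3 y = (-2 * y 2 * y 3 / (y 2 ^ 2 + y 3 ^ 2) ^ 2) * (X (!s)).P2 (inversion y)
      + ((y 2 ^ 2 - y 3 ^ 2) / (y 2 ^ 2 + y 3 ^ 2) ^ 2) * (X (!s)).P3 (inversion y)

variable {D O : Bool → Set Coord} {X : Bool → Field}

/-- The inversion commutes with translations in v, and the coefficients of the transformation law do
not depend on v. -/
theorem Transforms.dv (hO : ∀ s, IsOpen (O s)) (hP2 : ∀ s, ContDiffOn ℝ ∞ (X s).P2 (O s))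
    (hP3 : ∀ s, ContDiffOn ℝ ∞ (X s).P3 (O s)) (hX : Transforms O X) :
    Transforms O fun s => (X s).dv := by
  intro s y hy h0 hy0
  have hi := (hX s y hy h0 hy0).1
  have e : ∀ t : ℝ, inversion (y + t • (Pi.single 0 1 : Coord))
      = inversion y + t • (Pi.single 0 1 : Coord) := by
    intro t
    funext i
    fin_cases i <;> simp [inversion]
  have hev : ∀ᶠ t in 𝓝 (0 : ℝ), y + t • (Pi.single 0 1 : Coord) ∈ O s := by
    have hc : Continuous fun t : ℝ => y + t • (Pi.single 0 1 : Coord) := by fun_prop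
    exact hc.continuousAt.eventually ((hO s).mem_nhds (by simpa using hy))
  have d2 := (hP2 (!s)).diffAt (hO _) hi
  have d3 := (hP3 (!s)).diffAt (hO _) hi
  have key (a b : ℝ) {f : Coord → ℝ} (hf : DifferentiableAt ℝ f y)
      (h : ∀ᶠ t in 𝓝 (0 : ℝ), f (y + t • (Pi.single 0 1 : Coord))
        = a * (X (!s)).P2 (inversion (y + t • (Pi.single 0 1 : Coord)))
          + b * (X (!s)).P3 (inversion (y + t • (Pi.single 0 1 : Coord)))) :
      pd 0 f y = a * pd 0 (X (!s)).P2 (inversion y) + b * pd 0 (X (!s)).P3 (inversion y) := by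
    have h2 := (d2.hasFDerivAt.hasLineDerivAt (Pi.single 0 1 : Coord)).const_mul a
    have h3 := (d3.hasFDerivAt.hasLineDerivAt (Pi.single 0 1 : Coord)).const_mul b
    have h1 := hf.hasFDerivAt.hasLineDerivAt (Pi.single 0 1 : Coord)
    refine HasDerivAt.unique h1 ((h2.add h3).congr_of_eventuallyEq ?_)
    filter_upwards [h] with t ht
    rw [ht, e]
    rfl
  refine ⟨hi, key _ _ ((hP2 s).diffAt (hO _) hy) ?_, key _ _ ((hP3 s).diffAt (hO _) hy) ?_⟩
  · filter_upwards [hev] with t ht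
    have := (hX s _ ht (by simpa using h0) (by simpa using hy0)).2.1
    simpa using this
  · filter_upwards [hev] with t ht
    have := (hX s _ ht (by simpa using h0) (by simpa using hy0)).2.2
    simpa using this

/-- The length of the leading term of `F_{rI}` is invariant. -/
theorem Transforms.sqLen (hD : ∀ s, ScriNbhd (D s)) (hDO : ∀ s, D s ⊆ O s)
    (hX : Transforms O X) {n : ℕ} {p2 p3 : Bool → Coord → ℝ}
    (h2 : ∀ s, Lead (D s) n (X s).P2 (p2 s)) (h3 : ∀ s, Lead (D s) n (X s).P3 (p3 s))
    (v : ℝ) (s : Bool) (z : ℂ) (hz : z ≠ 0) :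
    sqLen (toComplex v (p2 s) (p3 s)) z
      = sqLen (toComplex v (p2 (!s)) (p3 (!s))) (conj z)⁻¹ := by
  set y := scriPt v z with hydef
  have hy0 : y 2 ^ 2 + y 3 ^ 2 ≠ 0 := by
    have := normSq_pos.2 hz
    rw [normSq_apply] at this
    simp only [hydef, scriPt_two, scriPt_three]
    nlinarith
  obtain ⟨φ2, s2, e2, l2⟩ := h2 s
  obtain ⟨φ3, s3, e3, l3⟩ := h3 s
  obtain ⟨ψ2, t2, g2, m2⟩ := h2 (!s)
  obtain ⟨ψ3, t3, g3, m3⟩ := h3 (!s)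
  have hyD : y ∈ D s := (hD s).scri_mem _ rfl
  have hiD : inversion y ∈ D (!s) := (hD (!s)).scri_mem _ rfl
  have c0 : ContinuousAt (fun t : ℝ => (Function.update y 1 t : Coord)) 0 :=
    (continuous_update_one y).continuousAt
  have u0 : Function.update y 1 0 = y := by
    rw [show (0 : ℝ) = y 1 from rfl]; simp
  have ci : ContinuousAt (fun t : ℝ => inversion (Function.update y 1 t)) 0 :=
    ContinuousAt.comp (g := inversion) (by rw [u0]; exact continuousAt_inversion hy0) c0
  have hφ {φ : Coord → ℝ} (h : ContDiffOn ℝ ∞ φ (D s)) :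
      Tendsto (fun t : ℝ => φ (Function.update y 1 t)) (𝓝[>] 0) (𝓝 (φ y)) := by
    have := ContinuousAt.comp (g := φ)
      (by rw [u0]; exact h.continuousOn.continuousAt ((hD s).isOpen.mem_nhds hyD)) c0
    have := this.tendsto
    simp only [Function.comp_def, u0] at this
    exact this.mono_left nhdsWithin_le_nhds
  have hψ {ψ : Coord → ℝ} (h : ContDiffOn ℝ ∞ ψ (D (!s))) :
      Tendsto (fun t : ℝ => ψ (inversion (Function.update y 1 t))) (𝓝[>] 0)
        (𝓝 (ψ (inversion y))) := by
    have := ContinuousAt.comp (g := ψ) (x := (0 : ℝ))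
      (f := fun t : ℝ => inversion (Function.update y 1 t))
      (by rw [u0]; exact h.continuousOn.continuousAt ((hD (!s)).isOpen.mem_nhds hiD)) ci
    have := this.tendsto
    simp only [Function.comp_def, u0] at this
    exact this.mono_left nhdsWithin_le_nhds
  -- The matrix of the transformation is 1/|z|² times a reflection, so the sum of squares scales by
  -- 1/|z|⁴. The relation is proved for r > 0 and passed to the limit r → 0.
  have ev : ∀ᶠ t in 𝓝[>] (0 : ℝ), φ2 (Function.update y 1 t) ^ 2 + φ3 (Function.update y 1 t) ^ 2
      = (ψ2 (inversion (Function.update y 1 t)) ^ 2 + ψ3 (inversion (Function.update y 1 t)) ^ 2)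
        / (y 2 ^ 2 + y 3 ^ 2) ^ 2 := by
    have m1 : ∀ᶠ t in 𝓝[>] (0 : ℝ), Function.update y 1 t ∈ D s :=
      (c0.eventually (by beta_reduce; rw [u0]; exact (hD s).isOpen.mem_nhds hyD)).filter_mono
        nhdsWithin_le_nhds
    have m2 : ∀ᶠ t in 𝓝[>] (0 : ℝ), inversion (Function.update y 1 t) ∈ D (!s) :=
      (ci.eventually (by beta_reduce; rw [u0]; exact (hD (!s)).isOpen.mem_nhds hiD)).filter_mono
        nhdsWithin_le_nhds
    filter_upwards [m1, m2, self_mem_nhdsWithin] with t w1 w2 w3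
    have w3 : 0 < t := w3
    obtain ⟨-, x2, x3⟩ := hX s _ (hDO s w1) (by simpa using w3) (by simpa using hy0)
    rw [e2 _ w1 (by simpa using w3), g2 _ w2 (by simpa [inversion] using w3),
      g3 _ w2 (by simpa [inversion] using w3)] at x2
    rw [e3 _ w1 (by simpa using w3), g2 _ w2 (by simpa [inversion] using w3),
      g3 _ w2 (by simpa [inversion] using w3)] at x3
    have r1 : inversion (Function.update y 1 t) 1 = t := by simp [inversion]
    have r2 : Function.update y 1 t 2 = y 2 := by simp
    have r3 : Function.update y 1 t 3 = y 3 := by simp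
    rw [r1, r2, r3, Function.update_self] at x2 x3
    have ht : t ^ n ≠ 0 := pow_ne_zero n w3.ne'
    generalize φ2 (Function.update y 1 t) = a2 at *
    generalize φ3 (Function.update y 1 t) = a3 at *
    generalize ψ2 (inversion (Function.update y 1 t)) = b2 at *
    generalize ψ3 (inversion (Function.update y 1 t)) = b3 at *
    have y2 : a2 = ((y 3 ^ 2 - y 2 ^ 2) / (y 2 ^ 2 + y 3 ^ 2) ^ 2) * b2
        + (-2 * y 2 * y 3 / (y 2 ^ 2 + y 3 ^ 2) ^ 2) * b3 := by
      apply mul_left_cancel₀ ht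
      linear_combination x2
    have y3 : a3 = (-2 * y 2 * y 3 / (y 2 ^ 2 + y 3 ^ 2) ^ 2) * b2
        + ((y 2 ^ 2 - y 3 ^ 2) / (y 2 ^ 2 + y 3 ^ 2) ^ 2) * b3 := by
      apply mul_left_cancel₀ ht
      linear_combination x3
    rw [y2, y3]
    field_simp
    ring
  have lim := tendsto_nhds_unique_of_eventuallyEq
    (((hφ s2).pow 2).add ((hφ s3).pow 2))
    ((((hψ t2).pow 2).add ((hψ t3).pow 2)).div_const _) ev
  rw [l2 y rfl, l3 y rfl, m2 _ rfl, m3 _ rfl, hydef, inversion_scriPt] at lim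
  have hn : normSq z = z.re ^ 2 + z.im ^ 2 := by rw [normSq_apply]; ring
  have hz' := normSq_pos.2 hz
  simp only [Electrovac.sqLen, toComplex, normSq_mk, map_inv₀, normSq_conj]
  simp only [scriPt_two, scriPt_three, ← hn] at lim
  rw [← sq, ← sq, ← sq, ← sq, lim]
  field_simp
  ring

end Electrovac

end

/-! ### Stationarity of Maxwell fields with stationary energy tensor. -/

noncomputable section
open scoped Manifold ContDiff ComplexConjugate
open Set Filter Topology Complex
namespace Electrovac

/-- Analyticity of all components. -/
structure Field.Analytic (O : Set Coord) (X : Field) : Prop where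
  E : AnalyticOnNhd ℝ X.E O
  P2 : AnalyticOnNhd ℝ X.P2 O
  P3 : AnalyticOnNhd ℝ X.P3 O
  Q2 : AnalyticOnNhd ℝ X.Q2 O
  Q3 : AnalyticOnNhd ℝ X.Q3 O
  B : AnalyticOnNhd ℝ X.B O

theorem Field.Analytic.dv {O : Set Coord} {X : Field} (h : X.Analytic O) : X.dv.Analytic O :=
  ⟨h.E.pderiv 0, h.P2.pderiv 0, h.P3.pderiv 0, h.Q2.pderiv 0, h.Q3.pderiv 0, h.B.pderiv 0⟩

theorem Field.Analytic.smooth {D O : Set Coord} {X : Field} (h : X.Analytic O) (hDO : D ⊆ O) :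
    X.Smooth D :=
  ⟨(h.E.mono hDO).contDiffOn_of_completeSpace, (h.P2.mono hDO).contDiffOn_of_completeSpace,
    (h.P3.mono hDO).contDiffOn_of_completeSpace, (h.Q2.mono hDO).contDiffOn_of_completeSpace,
    (h.Q3.mono hDO).contDiffOn_of_completeSpace, (h.B.mono hDO).contDiffOn_of_completeSpace⟩

namespace Coeffs

section

variable {D : Set Coord} {C : Coeffs D} {X : Field}
  (hM : C.Maxwell X) (hX : X.Smooth D) (hD : ScriNbhd D)
  (hQ2 : ∀ y : Coord, y 1 = 0 → X.Q2 y = 0) (hQ3 : ∀ y : Coord, y 1 = 0 → X.Q3 y = 0)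

include hM hX hD hQ2 hQ3

/-- ∂_v B is the curl of Q, which involves only derivatives tangent to r = 0, where Q vanishes. -/
theorem Maxwell.dv_B_scri {y : Coord} (hy : y 1 = 0) : X.dv.B y = 0 := by
  have h := hD.eq_scri (hX.B.pderiv hD.isOpen 0).continuousOn
    ((hX.Q3.pderiv hD.isOpen 2).continuousOn.sub (hX.Q2.pderiv hD.isOpen 3).continuousOn)
    hM.closed_v23 hy
  have e {f : Coord → ℝ} (hf : ContDiffOn ℝ ∞ f D) (h0 : ∀ y : Coord, y 1 = 0 → f y = 0)
      {i : Fin 4} (hi : i ≠ 1) : pd i f y = 0 := by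
    rw [← tpd_eq_pd (hf.diffAt hD.isOpen (hD.scri_mem y hy)),
      tpd_congr (c' := fun _ => 0) hi h0 hy, tpd_const]
  rw [Pi.sub_apply, e hX.Q3 hQ3 (by decide), e hX.Q2 hQ2 (by decide), sub_zero] at h
  exact h

/-- The fluxes F^{rI} vanish at r = 0, as Q does and all their other coefficients are O(r). The
remaining Maxwell equation then reads s ∂_v E = 0 there. -/
theorem Maxwell.dv_E_scri {y : Coord} (hy : y 1 = 0) : X.dv.E y = 0 := by
  have hX' := hX.dv hD
  have z2 := Lead.of_smooth_zero hX.Q2 hQ2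
  have z3 := Lead.of_smooth_zero hX.Q3 hQ3
  have p2 := Lead.of_smooth hX.P2
  have p3 := Lead.of_smooth hX.P3
  have e := Lead.of_smooth hX.E
  have b := Lead.of_smooth hX.B
  have r2 : Lead D 0 (C.fluxR2 X) (fun _ => 0) := by
    have := ((C.lead_K22.1.mul z2).add (C.lead_K23.1.mul z3)).add
      ((((lead_mul_of_one C.lead_A2E e).add (lead_mul_of_one C.lead_A2B b)).of_le
        (l := 0) (by omega)).add
        (((C.lead_A22.1.mul p2).add (C.lead_A23.1.mul p3)).of_le (l := 0) (by omega)))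
    exact this.congr_lead fun y _ => by ring
  have r3 : Lead D 0 (C.fluxR3 X) (fun _ => 0) := by
    have := ((C.lead_K23.1.mul z2).add (C.lead_K33.1.mul z3)).add
      ((((lead_mul_of_one C.lead_A3E e).add (lead_mul_of_one C.lead_A3B b)).of_le
        (l := 0) (by omega)).add
        (((C.lead_A32.1.mul p2).add (C.lead_A33.1.mul p3)).of_le (l := 0) (by omega)))
    exact this.congr_lead fun y _ => by ring
  have h1 := ((r2.pd_tan hD (i := 2) (by decide)).add
    (r3.pd_tan hD (i := 3) (by decide))).congr fun y hy h0 =>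
      (fluxVR_dv hX hD y hy h0).symm.trans (hM.coclosed_r y hy h0)
  have h2 := ((Lead.of_smooth C.smooth_s).mul (Lead.of_smooth hX'.E)).add
    (((lead_mul_of_one C.lead_S2 (Lead.of_smooth hX'.P2)).add
      (lead_mul_of_one C.lead_S3 (Lead.of_smooth hX'.P3))).of_le (l := 0) (by omega))
  have := h2.unique hD h1 hy
  simp only [tpd_const, add_zero] at this
  exact (mul_eq_zero.1 this).resolve_left (C.pos_s y (hD.scri_mem y hy)).ne'

end

section

variable {D O : Bool → Set Coord} (hD : ∀ s, ScriNbhd (D s)) (hDO : ∀ s, D s ⊆ O s)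
  (hO : ∀ s, IsOpen (O s))
  (hray : ∀ s, ∀ y ∈ O s, ∀ t, 0 ≤ t → t ≤ y 1 → Function.update y 1 t ∈ O s)
  {C : ∀ s, Coeffs (D s)} {X : Bool → Field} (hX : ∀ s, (X s).Analytic (O s))
  (hM : ∀ s, (C s).Maxwell (X s)) (hT : ∀ s, (C s).Energy (X s))
  (hs : ∀ s, ∀ y : Coord, y 1 = 0 → (C s).s y = 4 / (1 + y 2 ^ 2 + y 3 ^ 2) ^ 2)
  (hQ2 : ∀ s, ∀ y : Coord, y 1 = 0 → (X s).Q2 y = 0)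
  (hQ3 : ∀ s, ∀ y : Coord, y 1 = 0 → (X s).Q3 y = 0) (hXX : Transforms O X)

include hD hDO hO hray hX hM hT hs hQ2 hQ3 hXX in
/-- On a stationary background, the components `F_{rI}` of a Maxwell field with a stationary energy
tensor are stationary. -/
theorem dv_P_eq_zero : ∀ s, ∀ y ∈ O s, 0 < y 1 → (X s).dv.P2 y = 0 ∧ (X s).dv.P3 y = 0 := by
  have hS := fun s => (hX s).smooth (hDO s)
  have hS' := fun s => (hS s).dv (hD s)
  have hM' := fun s => (hM s).dv (hS s) (hD s)
  have smooth_O {f : Coord → ℝ} {s : Bool} (h : AnalyticOnNhd ℝ f (O s)) :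
    ContDiffOn ℝ ∞ f (O s) := h.contDiffOn_of_completeSpace
  have hXX' := hXX.dv hO (fun s => smooth_O (hX s).P2) (fun s => smooth_O (hX s).P3)
  have hXX'' := hXX'.dv hO (fun s => smooth_O (hX s).dv.P2) (fun s => smooth_O (hX s).dv.P3)
  have hE' : ∀ s, ∀ y : Coord, y 1 = 0 → (X s).dv.E y = 0 := fun s y hy =>
    (hM s).dv_E_scri (hS s) (hD s) (hQ2 s) (hQ3 s) hy
  have hB' : ∀ s, ∀ y : Coord, y 1 = 0 → (X s).dv.B y = 0 := fun s y hy =>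
    (hM s).dv_B_scri (hS s) (hD s) (hQ2 s) (hQ3 s) hy
  -- One order of vanishing is taken for both charts and both components at once. The second Boolean
  -- selects the component: `true` for P2, `false` for P3.
  have dich := fun (Y : Bool → Field) (hY : ∀ s, (Y s).Analytic (O s)) =>
    eq_zero_or_exists_lead (ι := Bool × Bool)
    (D := fun i => D i.1) (O := fun i => O i.1)
    (f := fun i => if i.2 then (Y i.1).P2 else (Y i.1).P3)
    (fun i => hD i.1) (fun i => hDO i.1)
    (fun i => by split_ifs; exacts [(hY i.1).P2, (hY i.1).P3]) (fun i => hray i.1)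
  rcases dich _ (fun s => (hX s).dv) with h0 | ⟨m, h, hh, ⟨sh, bh⟩, yh, hyh, hne⟩
  · exact fun s y hy hr => ⟨by simpa using h0 (s, true) y hy hr,
      by simpa using h0 (s, false) y hy hr⟩
  exfalso
  have hh2 : ∀ s, Lead (D s) m (X s).dv.P2 (h (s, true)) := fun s => by simpa using hh (s, true)
  have hh3 : ∀ s, Lead (D s) m (X s).dv.P3 (h (s, false)) := fun s => by simpa using hh (s, false)
  rcases dich _ hX with h0 | ⟨n, f, hf, ⟨sf, bf⟩, yf, hyf, hnef⟩
  · have hP2 : ∀ s, Lead (D s) m (X s).dv.P2 (fun _ => 0) := fun s =>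
      (Lead.zero (D s) m).congr fun y hy hr => by
        have := pd_congr_of_isOpen (i := 0) (hD s).isOpen_pos (f := (X s).P2) (g := fun _ => 0)
          (fun z hz => by simpa using h0 (s, true) z (hDO s hz.1) hz.2) ⟨hy, hr⟩
        rw [pd_const] at this
        exact this
    have hP3 : ∀ s, Lead (D s) m (X s).dv.P3 (fun _ => 0) := fun s =>
      (Lead.zero (D s) m).congr fun y hy hr => by
        have := pd_congr_of_isOpen (i := 0) (hD s).isOpen_pos (f := (X s).P3) (g := fun _ => 0)
          (fun z hz => by simpa using h0 (s, false) z (hDO s hz.1) hz.2) ⟨hy, hr⟩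
        rw [pd_const] at this
        exact this
    cases bh
    · exact hne ((hh3 sh).unique (hD sh) (hP3 sh) hyh)
    · exact hne ((hh2 sh).unique (hD sh) (hP2 sh) hyh)
  have hf2 : ∀ s, Lead (D s) n (X s).P2 (f (s, true)) := fun s => by simpa using hf (s, true)
  have hf3 : ∀ s, Lead (D s) n (X s).P3 (f (s, false)) := fun s => by simpa using hf (s, false)
  -- non-vanishing at some point of each chart
  have sq_ne (g : Bool × Bool → Coord → ℝ) {s b : Bool} {y : Coord} (hg : g (s, b) y ≠ 0) :
      g (s, true) y ^ 2 + g (s, false) y ^ 2 ≠ 0 := by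
    cases b
    · have := sq_nonneg (g (s, true) y)
      have : 0 < g (s, false) y ^ 2 := by positivity
      linarith
    · have := sq_nonneg (g (s, false) y)
      have : 0 < g (s, true) y ^ 2 := by positivity
      linarith
  have an (Y : Bool → Field) (hY : ∀ s, (Y s).Analytic (O s)) {k : ℕ} {g : Bool × Bool → Coord → ℝ}
      (g2 : ∀ s, Lead (D s) k (Y s).P2 (g (s, true)))
      (g3 : ∀ s, Lead (D s) k (Y s).P3 (g (s, false))) (s : Bool) : AnalyticOnNhd ℝ (fun y : Coord =>
        (fun z => g (s, true) z ^ 2 + g (s, false) z ^ 2) (Function.update y 1 0)) univ :=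
    (((g2 s).analytic (hD s) (hDO s) (hY s).P2).pow 2).add
      (((g3 s).analytic (hD s) (hDO s) (hY s).P3).pow 2)
  have anh := an _ (fun s => (hX s).dv) hh2 hh3
  have anf := an _ hX hf2 hf3
  have both (Y : Bool → Field) (hY : ∀ s, (Y s).Analytic (O s)) (tY : Transforms O Y) {k : ℕ}
      {g : Bool × Bool → Coord → ℝ} (g2 : ∀ s, Lead (D s) k (Y s).P2 (g (s, true)))
      (g3 : ∀ s, Lead (D s) k (Y s).P3 (g (s, false))) {s b : Bool} {y : Coord} (hy : y 1 = 0)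
      (hg : g (s, b) y ≠ 0) (s' : Bool) :
      ∃ z : Coord, z 1 = 0 ∧ g (s', true) z ^ 2 + g (s', false) z ^ 2 ≠ 0 := by
    by_cases hss : s' = s
    · subst hss
      exact ⟨y, hy, sq_ne g hg⟩
    have hss' : s' = !s := by cases s <;> cases s' <;> simp_all
    subst hss'
    have hc : Continuous (toComplex (y 0) (g (s, true)) (g (s, false))) :=
      (contDiff_toComplex ((g2 s).contDiff_scriPt (hD s) _)
        ((g3 s).contDiff_scriPt (hD s) _)).continuous
    have hc0 : toComplex (y 0) (g (s, true)) (g (s, false)) ⟨y 2, y 3⟩ ≠ 0 := by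
      intro hcon
      have h1 := congrArg re hcon
      have h2 := congrArg im hcon
      simp only [toComplex, ← eq_scriPt hy, zero_re, zero_im] at h1 h2
      exact sq_ne g hg (by rw [h1, h2]; ring)
    have hev := hc.continuousAt.eventually_ne hc0
    -- The point is moved off the pole z = 0, into the overlap of the charts, where lengths can be
    -- compared.
    have h0 : ∀ᶠ z in 𝓝[≠] (⟨y 2, y 3⟩ : ℂ), z ≠ 0 := by
      by_cases hz : (⟨y 2, y 3⟩ : ℂ) = 0
      · rw [hz]; exact self_mem_nhdsWithin
      · exact (continuousAt_id.eventually_ne hz).filter_mono nhdsWithin_le_nhds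
    obtain ⟨z, hz1, hz2⟩ := ((hev.filter_mono nhdsWithin_le_nhds).and h0).exists
    have := tY.sqLen hD hDO (p2 := fun s => g (s, true)) (p3 := fun s => g (s, false))
      g2 g3 (y 0) s z hz2
    refine ⟨scriPt (y 0) (conj z)⁻¹, rfl, fun hcon => ?_⟩
    have h1 := sqLen_pos hz1
    rw [this, Electrovac.sqLen, toComplex, normSq_mk, ← sq, ← sq, hcon] at h1
    simp at h1
  -- the Coulomb part vanishes
  have hEB : ∀ s, (∀ y : Coord, y 1 = 0 → (X s).E y = 0) ∧
      ∀ y : Coord, y 1 = 0 → (X s).B y = 0 := by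
    intro s
    obtain ⟨z, hz, hz0⟩ := both _ (fun s => (hX s).dv) hXX' hh2 hh3 hyh hne s
    have key := fun y hy => (hT s).coulomb (hS s) (hD s) (hf2 s) (hf3 s) (hh2 s) (hh3 s)
      ((hM' s).lead_E (hS' s) (hD s) (hh2 s) (hh3 s) (hE' s))
      ((hM' s).lead_B (hS' s) (hD s) (hh2 s) (hh3 s) (hB' s)) (y := y) hy
    exact ⟨fun y hy => eq_zero_of_mul_eq_zero
        ((Lead.of_smooth (hS s).E).analytic (hD s) (hDO s) (hX s).E) (anh s)
        (fun y hy => (key y hy).1) hz hz0 hy,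
      fun y hy => eq_zero_of_mul_eq_zero
        ((Lead.of_smooth (hS s).B).analytic (hD s) (hDO s) (hX s).B) (anh s)
        (fun y hy => (key y hy).2) hz hz0 hy⟩
  -- With E = B = 0 at r = 0 the evolution equation makes ∂_v P of order n + 1, while m is its exact
  -- order.
  have hnm : n + 1 ≤ m := by
    by_contra hcon
    obtain ⟨q2, q3, hq2, hq3, -⟩ := (hM sh).evol (hS sh) (hD sh) (hs sh) (hEB sh).1 (hEB sh).2
      (hQ2 sh) (hQ3 sh) (hf2 sh) (hf3 sh)
    cases bh
    · exact hne ((hh3 sh).unique (hD sh) (hq3.of_le (by omega)) hyh)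
    · exact hne ((hh2 sh).unique (hD sh) (hq2.of_le (by omega)) hyh)
  -- Neither leading term vanishes identically, and analytic functions have no zero divisors, so
  -- both are nonzero at a common point.
  obtain ⟨z, hz, hz0⟩ : ∃ z : Coord, z 1 = 0 ∧
      (f (sh, true) z ^ 2 + f (sh, false) z ^ 2) * (h (sh, true) z ^ 2 + h (sh, false) z ^ 2)
        ≠ 0 := by
    by_contra hcon
    push Not at hcon
    obtain ⟨w, hw, hw0⟩ := both _ hX hXX hf2 hf3 hyf hnef sh
    exact hw0 (eq_zero_of_mul_eq_zero (anf sh) (anh sh) hcon hyh (sq_ne h hne) hw)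
  have hL := fun s => leadingTerms (hM s) (hT s) (hS s) (hD s) (hs s) (hEB s).1 (hEB s).2
    (hQ2 s) (hQ3 s) hnm (hf2 s) (hf3 s) (hh2 s) (hh3 s)
  choose j2 j3 hj2 hj3 L using hL
  have ne0 (g : Bool × Bool → Coord → ℝ) (hg : g (sh, true) z ^ 2 + g (sh, false) z ^ 2 ≠ 0) :
      toComplex (z 0) (g (sh, true)) (g (sh, false)) ⟨z 2, z 3⟩ ≠ 0 := by
    intro hcon
    have h1 := congrArg re hcon
    have h2 := congrArg im hcon
    simp only [toComplex, ← eq_scriPt hz, zero_re, zero_im] at h1 h2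
    exact hg (by rw [h1, h2]; ring)
  exact LeadingTerms.false_of_sphere hnm rfl (fun s => L s (z 0))
    (hXX.sqLen hD hDO (p2 := fun s => f (s, true)) (p3 := fun s => f (s, false)) hf2 hf3 (z 0))
    (hXX'.sqLen hD hDO (p2 := fun s => h (s, true)) (p3 := fun s => h (s, false)) hh2 hh3 (z 0))
    (hXX''.sqLen hD hDO hj2 hj3 (z 0))
    (ne0 f (left_ne_zero_of_mul hz0)) (ne0 h (right_ne_zero_of_mul hz0))

include hD hDO hO hray hX hM hT hs hQ2 hQ3 hXX in
/-- On a stationary background, a Maxwell field with a stationary energy tensor is stationary. -/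
theorem dv_eq_zero (s : Bool) {y : Coord} (hy : y ∈ O s) (hr : 0 < y 1) :
    (X s).dv.E y = 0 ∧ (X s).dv.P2 y = 0 ∧ (X s).dv.P3 y = 0 ∧ (X s).dv.Q2 y = 0 ∧
      (X s).dv.Q3 y = 0 ∧ (X s).dv.B y = 0 := by
  have h0 := dv_P_eq_zero hD hDO hO hray hX hM hT hs hQ2 hQ3 hXX s
  have hS := (hX s).smooth (hDO s)
  have hS' := hS.dv (hD s)
  have hM' := (hM s).dv hS (hD s)
  have h2 : ∀ k, Lead (D s) k (X s).dv.P2 (fun _ => 0) := fun k =>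
    (Lead.zero _ k).congr fun z hz h => (h0 z (hDO s hz) h).1
  have h3 : ∀ k, Lead (D s) k (X s).dv.P3 (fun _ => 0) := fun k =>
    (Lead.zero _ k).congr fun z hz h => (h0 z (hDO s hz) h).2
  -- ∂_v F is itself a Maxwell field whose components P vanish to every order. Radial integration
  -- from r = 0 therefore makes E, B and Q vanish to every order, and by analyticity they vanish.
  have hE := fun k => hM'.lead_E hS' (hD s) (h2 k) (h3 k) fun y hy =>
    (hM s).dv_E_scri hS (hD s) (hQ2 s) (hQ3 s) hy
  have hB := fun k => hM'.lead_B hS' (hD s) (h2 k) (h3 k) fun y hy =>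
    (hM s).dv_B_scri hS (hD s) (hQ2 s) (hQ3 s) hy
  have hq2 := fun k : ℕ => (Lead.of_smooth_zero hS'.Q2 (pd_zero_scri (hD s) hS.Q2 (hQ2 s))).integrate
    (hD s) (((((h2 (k + 1)).pd_tan (hD s) (i := 0) (by decide))).sub
      ((hE k).pd_tan (hD s) (i := 2) (by decide))).congr hM'.closed_vr2)
  have hq3 := fun k : ℕ => (Lead.of_smooth_zero hS'.Q3 (pd_zero_scri (hD s) hS.Q3 (hQ3 s))).integrate
    (hD s) (((((h3 (k + 1)).pd_tan (hD s) (i := 0) (by decide))).sub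
      ((hE k).pd_tan (hD s) (i := 3) (by decide))).congr hM'.closed_vr3)
  have key {f : Coord → ℝ} (hf : AnalyticOnNhd ℝ f (O s)) (h : ∀ k, ∃ c, Lead (D s) k f c) :
      f y = 0 := eq_zero_of_lead (hD s) hf (hray s) h hy hr
  exact ⟨key (hX s).dv.E fun k => (hE k).mono (by omega), (h0 y hy hr).1, (h0 y hy hr).2,
    key (hX s).dv.Q2 fun k => (hq2 k).mono (by omega),
    key (hX s).dv.Q3 fun k => (hq3 k).mono (by omega),
    key (hX s).dv.B fun k => (hB k).mono (by omega)⟩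

end

end Coeffs
end Electrovac

end

/-! ### Tensor calculus in components. -/

noncomputable section
open scoped Manifold ContDiff
open Set Filter Topology
namespace Electrovac

/-! ### Metrics given by their components -/

/-- `g` is a smooth field of symmetric matrices on `U` with inverse `H`. -/
structure MetricOn (U : Set Coord) (g H : Coord → Matrix (Fin 4) (Fin 4) ℝ) : Prop where
  isOpen : IsOpen U
  smooth : ∀ i j, ContDiffOn ℝ ∞ (fun y => g y i j) U
  smooth_inv : ∀ i j, ContDiffOn ℝ ∞ (fun y => H y i j) U
  symm : ∀ y ∈ U, ∀ i j, g y i j = g y j i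
  mul_inv : ∀ y ∈ U, g y * H y = 1

/-- Christoffel symbols of the first kind `½ (∂_b g_{dc} + ∂_c g_{db} - ∂_d g_{bc})`. -/
def christoffelFirst (g : Coord → Matrix (Fin 4) (Fin 4) ℝ) (d b c : Fin 4) (y : Coord) : ℝ :=
  (1 / 2) * (pd b (fun z => g z d c) y + pd c (fun z => g z d b) y - pd d (fun z => g z b c) y)

namespace MetricOn

variable {U : Set Coord} {g H : Coord → Matrix (Fin 4) (Fin 4) ℝ} (m : MetricOn U g H)
  {y : Coord} (hy : y ∈ U)

include m hy

theorem inv_eq : (g y)⁻¹ = H y := Matrix.inv_eq_right_inv (m.mul_inv y hy)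

theorem inv_mul : H y * g y = 1 := mul_eq_one_comm.1 (m.mul_inv y hy)

theorem symm_inv (i j : Fin 4) : H y i j = H y j i := by
  have h : (g y).transpose = g y := by
    ext a b
    exact m.symm y hy b a
  have h2 := Matrix.transpose_nonsing_inv (g y)
  rw [h, m.inv_eq hy] at h2
  exact congrFun (congrFun h2 j) i

theorem contract (x : Fin 4 → ℝ) (a : Fin 4) : ∑ e, g y a e * ∑ d, H y e d * x d = x a := by
  have : (g y).mulVec ((H y).mulVec x) = x := by
    rw [Matrix.mulVec_mulVec, m.mul_inv y hy, Matrix.one_mulVec]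
  exact congrFun this a

theorem contract_inv (x : Fin 4 → ℝ) (a : Fin 4) :
    ∑ e, H y a e * ∑ d, g y e d * x d = x a := by
  have : (H y).mulVec ((g y).mulVec x) = x := by
    rw [Matrix.mulVec_mulVec, m.inv_mul hy, Matrix.one_mulVec]
  exact congrFun this a

theorem pd_symm (c i j : Fin 4) : pd c (fun z => g z i j) y = pd c (fun z => g z j i) y :=
  pd_congr_of_isOpen m.isOpen (fun z hz => m.symm z hz i j) hy

theorem christoffel_eq (a b c : Fin 4) :
    christoffel g a b c y = ∑ d, H y a d * christoffelFirst g d b c y := by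
  rw [christoffel, m.inv_eq hy, Finset.mul_sum]
  refine Finset.sum_congr rfl fun d _ => ?_
  rw [christoffelFirst]; ring

theorem christoffel_symm (a b c : Fin 4) : christoffel g a b c y = christoffel g a c b y := by
  rw [m.christoffel_eq hy, m.christoffel_eq hy]
  refine Finset.sum_congr rfl fun d _ => ?_
  rw [christoffelFirst, christoffelFirst, m.pd_symm hy d b c]; ring

theorem lower_christoffel (e b c : Fin 4) :
    ∑ a, g y e a * christoffel g a b c y = christoffelFirst g e b c y := by
  simp only [m.christoffel_eq hy]
  exact m.contract hy (fun d => christoffelFirst g d b c y) e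

/-- Metric compatibility ∇g = 0. -/
theorem pd_metric (c a b : Fin 4) : pd c (fun z => g z a b) y
    = ∑ d, g y b d * christoffel g d c a y + ∑ d, g y a d * christoffel g d c b y := by
  rw [m.lower_christoffel hy, m.lower_christoffel hy, christoffelFirst, christoffelFirst,
    m.pd_symm hy c b a, m.pd_symm hy a b c, m.pd_symm hy b a c]
  ring

/-- ∇g⁻¹ = 0, obtained by differentiating g H = 1, inserting `pd_metric` and contracting with H. -/
theorem pd_inv (c a b : Fin 4) : pd c (fun z => H z a b) y
    = - (∑ d, christoffel g a c d y * H y d b + ∑ d, christoffel g b c d y * H y d a) := by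
  have dg := fun i j => (m.smooth i j).diffAt m.isOpen hy
  have dH := fun i j => (m.smooth_inv i j).diffAt m.isOpen hy
  have h1 : ∀ a, ∑ e, (g y a e * pd c (fun z => H z e b) y
      + pd c (fun z => g z a e) y * H y e b) = 0 := by
    intro a
    have h := pd_congr_of_isOpen (i := c) m.isOpen (f := fun z => ∑ e, g z a e * H z e b)
      (g := fun _ => (1 : Matrix (Fin 4) (Fin 4) ℝ) a b)
      (fun z hz => by rw [← m.mul_inv z hz, Matrix.mul_apply]) hy
    rw [pd_const, pd_sum _ fun e _ => (dg a e).fun_mul (dH e b)] at h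
    rw [← h]
    exact Finset.sum_congr rfl fun e _ => (pd_mul (dg a e) (dH e b)).symm
  have h2 : ∀ a, ∑ e, pd c (fun z => g z a e) y * H y e b
      = christoffel g b c a y + ∑ d, g y a d * ∑ e, christoffel g d c e y * H y e b := by
    intro a
    have e1 : ∀ e, pd c (fun z => g z a e) y * H y e b
        = H y b e * ∑ d, g y e d * christoffel g d c a y
          + ∑ d, g y a d * (christoffel g d c e y * H y e b) := by
      intro e
      rw [m.pd_metric hy, m.symm_inv hy b e, add_mul, Finset.sum_mul, Finset.sum_mul,
        Finset.mul_sum]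
      congr 1
      · exact Finset.sum_congr rfl fun d _ => by ring
      · exact Finset.sum_congr rfl fun d _ => by ring
    rw [Finset.sum_congr rfl fun e _ => e1 e, Finset.sum_add_distrib,
      m.contract_inv hy (fun d => christoffel g d c a y), Finset.sum_comm]
    simp only [Finset.mul_sum]
  have h3 : ∀ a, ∑ e, g y a e * (pd c (fun z => H z e b) y
      + (∑ d, christoffel g e c d y * H y d b + ∑ d, H y e d * christoffel g b c d y)) = 0 := by
    intro a
    have := h1 a
    rw [Finset.sum_add_distrib, h2] at this
    simp only [mul_add, Finset.sum_add_distrib]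
    rw [m.contract hy (fun d => christoffel g b c d y)]
    linarith
  have h4 := m.contract_inv hy (fun e => pd c (fun z => H z e b) y
      + (∑ d, christoffel g e c d y * H y d b + ∑ d, H y e d * christoffel g b c d y)) a
  simp only [h3] at h4
  simp only [mul_zero, Finset.sum_const_zero] at h4
  have h5 : ∑ d, H y a d * christoffel g b c d y = ∑ d, christoffel g b c d y * H y d a :=
    Finset.sum_congr rfl fun d _ => by rw [m.symm_inv hy a d]; ring
  rw [h5] at h4
  linarith

theorem trace_christoffel (c : Fin 4) : ∑ a, christoffel g a a c y
    = (1 / 2) * ∑ a, ∑ d, H y a d * pd c (fun z => g z a d) y := by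
  simp only [m.christoffel_eq hy, christoffelFirst]
  have h1 : ∑ a, ∑ d, H y a d * pd a (fun z => g z d c) y
      = ∑ a, ∑ d, H y a d * pd d (fun z => g z a c) y := by
    rw [Finset.sum_comm]
    exact Finset.sum_congr rfl fun d _ => Finset.sum_congr rfl fun a _ => by
      rw [m.symm_inv hy a d]
  have h2 : ∀ a d, H y a d * (1 / 2 * (pd a (fun z => g z d c) y + pd c (fun z => g z d a) y
      - pd d (fun z => g z a c) y)) = (1 / 2) * (H y a d * pd c (fun z => g z a d) y)
      + (1 / 2) * (H y a d * pd a (fun z => g z d c) y)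
      - (1 / 2) * (H y a d * pd d (fun z => g z a c) y) := by
    intro a d
    rw [m.pd_symm hy c d a]; ring
  simp only [h2, Finset.sum_add_distrib, Finset.sum_sub_distrib, ← Finset.mul_sum, h1]
  ring

end MetricOn

end Electrovac

end

/-! ### Index algebra for divergences and conformal changes. -/

noncomputable section
open scoped Manifold ContDiff
open Set Filter Topology
namespace Electrovac

theorem sum_rotate {ι : Type*} [Fintype ι] (f : ι → ι → ι → ℝ) :
    ∑ a, ∑ b, ∑ c, f a b c = ∑ c, ∑ a, ∑ b, f a b c := by
  rw [Finset.sum_congr rfl fun a _ => Finset.sum_comm, Finset.sum_comm]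

/-- The index manipulations behind the divergence form of Maxwell's equations. -/
theorem divergence_algebra {H F : Fin 4 → Fin 4 → ℝ} {Γ dF : Fin 4 → Fin 4 → Fin 4 → ℝ}
    (hH : ∀ a b, H a b = H b a) (hF : ∀ a b, F a b = - F b a)
    (hΓ : ∀ a b c, Γ a b c = Γ a c b) (b : Fin 4) :
    ∑ a, ((∑ e, Γ e e a) * (∑ c, ∑ d, H a c * H b d * F c d)
      + ∑ c, ∑ d, (-(∑ e, Γ a a e * H e c + ∑ e, Γ c a e * H e a) * H b d * F c d
        - H a c * (∑ e, Γ b a e * H e d + ∑ e, Γ d a e * H e b) * F c d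
        + H a c * H b d * dF a c d))
    = ∑ e, H b e * ∑ a, ∑ c, H a c *
      (dF a c e - ∑ d, (Γ d a c * F d e + Γ d a e * F c d)) := by
  -- This term cancels against the derivative of the density.
  have l1 : ∑ a, ∑ c, ∑ d, (∑ e, Γ a a e * H e c) * H b d * F c d
      = ∑ a, (∑ e, Γ e e a) * (∑ c, ∑ d, H a c * H b d * F c d) := by
    simp only [Finset.sum_mul, Finset.mul_sum]
    have : ∀ a, ∑ c, ∑ d, ∑ e, Γ a a e * H e c * H b d * F c d
        = ∑ e, ∑ c, ∑ d, Γ a a e * H e c * H b d * F c d := fun a => sum_rotate _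
    rw [Finset.sum_congr rfl fun a _ => this a, Finset.sum_comm]
    refine Finset.sum_congr rfl fun a _ => ?_
    rw [← sum_rotate]
    exact Finset.sum_congr rfl fun c _ => Finset.sum_congr rfl fun d _ =>
      Finset.sum_congr rfl fun e _ => by ring
  have l2 : ∑ a, ∑ c, ∑ d, (∑ e, Γ c a e * H e a) * H b d * F c d
      = ∑ e, H b e * ∑ a, ∑ c, H a c * ∑ d, Γ d a c * F d e := by
    simp only [Finset.sum_mul, Finset.mul_sum]
    have : ∀ a, ∑ c, ∑ d, ∑ e, Γ c a e * H e a * H b d * F c d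
        = ∑ d, ∑ e, ∑ c, Γ c a e * H e a * H b d * F c d := fun a => (sum_rotate _).symm
    rw [Finset.sum_congr rfl fun a _ => this a, Finset.sum_comm]
    refine Finset.sum_congr rfl fun d _ => Finset.sum_congr rfl fun a _ =>
      Finset.sum_congr rfl fun e _ => Finset.sum_congr rfl fun c _ => ?_
    rw [hH e a]; ring
  have l3 : ∑ a, ∑ c, ∑ d, H a c * (∑ e, Γ d a e * H e b) * F c d
      = ∑ e, H b e * ∑ a, ∑ c, H a c * ∑ d, Γ d a e * F c d := by
    simp only [Finset.sum_mul, Finset.mul_sum]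
    have : ∀ a, ∑ c, ∑ d, ∑ e, H a c * (Γ d a e * H e b) * F c d
        = ∑ e, ∑ c, ∑ d, H a c * (Γ d a e * H e b) * F c d := fun a => sum_rotate _
    rw [Finset.sum_congr rfl fun a _ => this a, Finset.sum_comm]
    refine Finset.sum_congr rfl fun d _ => Finset.sum_congr rfl fun a _ =>
      Finset.sum_congr rfl fun e _ => Finset.sum_congr rfl fun c _ => ?_
    rw [hH d b]; ring
  -- A symmetric index pair of Γ contracted with the antisymmetric F: the sum equals its own
  -- negative.
  have l4 : ∑ a, ∑ c, ∑ d, H a c * (∑ e, Γ b a e * H e d) * F c d = 0 := by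
    simp only [Finset.sum_mul, Finset.mul_sum]
    have h1 : ∑ a, ∑ c, ∑ d, ∑ e, H a c * (Γ b a e * H e d) * F c d
        = ∑ a, ∑ e, ∑ c, ∑ d, H a c * (Γ b a e * H e d) * F c d :=
      Finset.sum_congr rfl fun a _ => sum_rotate _
    have h2 : ∑ a, ∑ e, ∑ c, ∑ d, H a c * (Γ b a e * H e d) * F c d
        = - ∑ a, ∑ e, ∑ c, ∑ d, H a c * (Γ b a e * H e d) * F c d := by
      conv_lhs => rw [Finset.sum_comm]
      rw [← Finset.sum_neg_distrib]
      refine Finset.sum_congr rfl fun a _ => ?_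
      rw [← Finset.sum_neg_distrib]
      refine Finset.sum_congr rfl fun e _ => ?_
      rw [Finset.sum_comm, ← Finset.sum_neg_distrib]
      refine Finset.sum_congr rfl fun c _ => ?_
      rw [← Finset.sum_neg_distrib]
      refine Finset.sum_congr rfl fun d _ => ?_
      rw [hF d c, hΓ b e a]; ring
    linarith
  have l5 : ∑ a, ∑ c, ∑ d, H a c * H b d * dF a c d
      = ∑ e, H b e * ∑ a, ∑ c, H a c * dF a c e := by
    simp only [Finset.mul_sum]
    rw [sum_rotate]
    exact Finset.sum_congr rfl fun d _ => Finset.sum_congr rfl fun a _ =>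
      Finset.sum_congr rfl fun c _ => by ring
  have r : ∀ e, H b e * ∑ a, ∑ c, H a c * (dF a c e - ∑ d, (Γ d a c * F d e + Γ d a e * F c d))
      = H b e * ∑ a, ∑ c, H a c * dF a c e - H b e * ∑ a, ∑ c, H a c * ∑ d, Γ d a c * F d e
        - H b e * ∑ a, ∑ c, H a c * ∑ d, Γ d a e * F c d := by
    intro e
    simp only [mul_sub, Finset.sum_sub_distrib, Finset.sum_add_distrib, mul_add]
    ring
  rw [Finset.sum_congr rfl fun e _ => r e]
  simp only [Finset.sum_sub_distrib, Finset.sum_add_distrib, add_mul, neg_mul, mul_add, neg_add,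
    Finset.sum_neg_distrib]
  rw [l1, l2, l3, l4, l5]
  ring

/-- The index manipulations behind the conformal transformation of the Ricci tensor. -/
theorem conformal_algebra {g : Fin 4 → Fin 4 → ℝ} {Γ : Fin 4 → Fin 4 → Fin 4 → ℝ} {u U : Fin 4 → ℝ}
    (hg : ∀ a b, g a b = g b a) (hΓ : ∀ a b c, Γ a b c = Γ a c b)
    (hU : ∀ a, ∑ d, g a d * U d = u a) {C : Fin 4 → Fin 4 → Fin 4 → ℝ}
    (hC : ∀ a b c, C a b c
      = -(if a = b then u c else 0) - (if a = c then u b else 0) + g b c * U a) (b c : Fin 4) :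
    ∑ a, ∑ d, ((Γ a a d + C a a d) * (Γ d b c + C d b c)
      - (Γ a c d + C a c d) * (Γ d b a + C d b a))
    = ∑ a, ∑ d, (Γ a a d * Γ d b c - Γ a c d * Γ d b a) - 2 * ∑ d, u d * Γ d b c
      + g b c * ∑ d, (∑ a, Γ a a d) * U d
      - ∑ d, U d * (∑ a, g b a * Γ a c d + ∑ a, g c a * Γ a b d)
      + 2 * u b * u c - 2 * g b c * ∑ d, u d * U d := by
  -- The factor 4 is the dimension; the two other contributions of u cancel.
  have tr : ∀ d, ∑ a, C a a d = -4 * u d := by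
    intro d
    simp only [hC, if_true, Finset.sum_add_distrib, Finset.sum_sub_distrib,
      Finset.sum_neg_distrib, Finset.sum_const, Finset.card_univ, Fintype.card_fin,
      Finset.sum_ite_eq', Finset.mem_univ]
    rw [Finset.sum_congr rfl fun a _ => by rw [hg a d], hU]
    simp
  have lin : ∀ (x : Fin 4 → ℝ), ∑ d, x d * C d b c
      = -(x b * u c) - x c * u b + g b c * ∑ d, x d * U d := by
    intro x
    simp only [hC, mul_add, mul_sub, mul_neg, mul_ite, mul_zero, Finset.sum_add_distrib,
      Finset.sum_sub_distrib, Finset.sum_neg_distrib, Finset.sum_ite_eq', Finset.mem_univ, if_true,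
      Finset.mul_sum]
    congr 1
    exact Finset.sum_congr rfl fun d _ => by ring
  have s1 : ∑ a, ∑ d, Γ a a d * C d b c = -((∑ a, Γ a a b) * u c) - (∑ a, Γ a a c) * u b
      + g b c * ∑ d, (∑ a, Γ a a d) * U d := by
    rw [Finset.sum_comm, ← lin fun d => ∑ a, Γ a a d]
    simp only [Finset.sum_mul]
  have s2 : ∑ a, ∑ d, C a a d * Γ d b c = -4 * ∑ d, u d * Γ d b c := by
    rw [Finset.sum_comm, Finset.mul_sum]
    exact Finset.sum_congr rfl fun d _ => by rw [← Finset.sum_mul, tr]; ring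
  have s5 : ∑ a, ∑ d, C a a d * C d b c = 8 * (u b * u c) - 4 * (g b c * ∑ d, u d * U d) := by
    rw [Finset.sum_comm]
    have : ∀ d, ∑ a, C a a d * C d b c = (-4 * u d) * C d b c := fun d => by
      rw [← Finset.sum_mul, tr]
    rw [Finset.sum_congr rfl fun d _ => this d, lin (fun d => -4 * u d)]
    rw [Finset.mul_sum, Finset.mul_sum, Finset.mul_sum]
    rw [Finset.sum_congr rfl fun d _ => show g b c * (-4 * u d * U d)
      = -(4 * (g b c * (u d * U d))) by ring, Finset.sum_neg_distrib]
    ring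
  have lin' : ∀ (e : Fin 4) (x : Fin 4 → Fin 4 → ℝ), ∑ a, ∑ d, x a d * C d e a
      = -(∑ a, x a e * u a) - (∑ a, x a a) * u e + ∑ d, U d * ∑ a, g e a * x a d := by
    intro e x
    simp only [hC, mul_add, mul_sub, mul_neg, mul_ite, mul_zero, Finset.sum_add_distrib,
      Finset.sum_sub_distrib, Finset.sum_neg_distrib, Finset.sum_ite_eq', Finset.mem_univ, if_true,
      Finset.mul_sum, Finset.sum_mul]
    congr 1
    rw [Finset.sum_comm]
    exact Finset.sum_congr rfl fun d _ => Finset.sum_congr rfl fun a _ => by ring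
  have s3 : ∑ a, ∑ d, Γ a c d * C d b a = -(∑ d, u d * Γ d b c) - (∑ a, Γ a a c) * u b
      + ∑ d, U d * ∑ a, g b a * Γ a c d := by
    rw [lin' b fun a d => Γ a c d]
    congr 2
    · congr 1
      exact Finset.sum_congr rfl fun a _ => by rw [hΓ a c b]; ring
    · congr 1
      exact Finset.sum_congr rfl fun a _ => by rw [hΓ a c a]
  have s4 : ∑ a, ∑ d, C a c d * Γ d b a = -(∑ d, u d * Γ d b c) - (∑ a, Γ a a b) * u c
      + ∑ d, U d * ∑ a, g c a * Γ a b d := by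
    rw [Finset.sum_comm, Finset.sum_congr rfl fun d _ => Finset.sum_congr rfl fun a _ =>
      mul_comm (C a c d) (Γ d b a), lin' c fun d a => Γ d b a]
    congr 2
    · congr 1
      exact Finset.sum_congr rfl fun a _ => by ring
    · congr 1
      exact Finset.sum_congr rfl fun a _ => by rw [hΓ a b a]
  have s6 : ∑ a, ∑ d, C a c d * C d b a = 6 * (u b * u c) - 2 * (g b c * ∑ d, u d * U d) := by
    rw [lin' b fun a d => C a c d]
    have h1 : ∑ a, C a c b * u a = -(2 * (u b * u c)) + g b c * ∑ d, u d * U d := by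
      have h := lin u
      rw [Finset.sum_congr rfl fun a _ => show C a c b * u a = u a * C a b c by
        rw [hC, hC, hg c b]; ring, h]
      ring
    have h2 : ∑ a, C a c a = -4 * u c := by
      rw [← tr]
      exact Finset.sum_congr rfl fun a _ => by rw [hC, hC, hg c a]; ring
    have h3 : ∀ d, ∑ a, g b a * C a c d = -(g b c * u d) - g b d * u c + g c d * u b := by
      intro d
      simp only [hC, mul_add, mul_sub, mul_neg, mul_ite, mul_zero, Finset.sum_add_distrib,
        Finset.sum_sub_distrib, Finset.sum_neg_distrib, Finset.sum_ite_eq', Finset.mem_univ,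
        if_true]
      rw [← hU b, Finset.mul_sum]
      congr 1
      exact Finset.sum_congr rfl fun a _ => by ring
    have h4 : ∑ d, U d * ∑ a, g b a * C a c d = -(g b c * ∑ d, u d * U d) := by
      rw [Finset.sum_congr rfl fun d _ => by rw [h3]]
      rw [Finset.sum_congr rfl fun d _ => show U d * (-(g b c * u d) - g b d * u c + g c d * u b)
        = -(g b c * (u d * U d)) - u c * (g b d * U d) + u b * (g c d * U d) by ring]
      simp only [Finset.sum_add_distrib, Finset.sum_sub_distrib, Finset.sum_neg_distrib,
        ← Finset.mul_sum, hU]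
      ring
    rw [h1, h2, h4]
    ring
  have e : ∀ a d, (Γ a a d + C a a d) * (Γ d b c + C d b c)
      - (Γ a c d + C a c d) * (Γ d b a + C d b a)
      = (Γ a a d * Γ d b c - Γ a c d * Γ d b a) + Γ a a d * C d b c + C a a d * Γ d b c
        + C a a d * C d b c - Γ a c d * C d b a - C a c d * Γ d b a - C a c d * C d b a := by
    intro a d; ring
  rw [Finset.sum_congr rfl fun a _ => Finset.sum_congr rfl fun d _ => e a d]
  simp only [Finset.sum_add_distrib, Finset.sum_sub_distrib] at s1 s2 s3 s4 s5 s6 ⊢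
  rw [s1, s2, s3, s4, s5, s6]
  simp only [mul_add, Finset.sum_add_distrib]
  ring

end Electrovac

end

/-! ### Divergence form of Maxwell's equations and conformal change of curvature. -/

noncomputable section
open scoped Manifold ContDiff
open Set Filter Topology
namespace Electrovac

section Congr

variable {U : Set Coord} {g g' F F' : Coord → Matrix (Fin 4) (Fin 4) ℝ} (hU : IsOpen U)
  (h : ∀ y ∈ U, g y = g' y) {y : Coord} (hy : y ∈ U)

include hU h hy

theorem christoffel_congr (a b c : Fin 4) : christoffel g a b c y = christoffel g' a b c y := by
  have e : ∀ i j k, pd k (fun z => g z i j) y = pd k (fun z => g' z i j) y := fun i j k =>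
    pd_congr_of_isOpen hU (fun z hz => by rw [h z hz]) hy
  simp only [christoffel, e, h y hy]

theorem ricci_congr (b c : Fin 4) : ricci g b c y = ricci g' b c y := by
  have e : ∀ a b c d, pd d (christoffel g a b c) y = pd d (christoffel g' a b c) y :=
    fun a b c d => pd_congr_of_isOpen hU (fun z hz => christoffel_congr hU h hz a b c) hy
  simp only [ricci, e, christoffel_congr hU h hy]

theorem covDeriv_congr (hF : ∀ y ∈ U, F y = F' y) (c a b : Fin 4) :
    covDeriv g F c a b y = covDeriv g' F' c a b y := by
  rw [covDeriv, covDeriv, pd_congr_of_isOpen hU (fun z hz => by rw [hF z hz]) hy, hF y hy]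
  simp only [christoffel_congr hU h hy]

end Congr

namespace MetricOn

variable {U : Set Coord} {g H F : Coord → Matrix (Fin 4) (Fin 4) ℝ} (m : MetricOn U g H)

include m in
theorem smooth_christoffel (a b c : Fin 4) : ContDiffOn ℝ ∞ (christoffel g a b c) U := by
  have h : ContDiffOn ℝ ∞ (fun y => ∑ d, H y a d * christoffelFirst g d b c y) U := by
    refine ContDiffOn.sum fun d _ => (m.smooth_inv a d).mul ?_
    exact contDiffOn_const.mul ((((m.smooth d c).pderiv m.isOpen b).add
      ((m.smooth d b).pderiv m.isOpen c)).sub ((m.smooth b c).pderiv m.isOpen d))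
  exact h.congr fun y hy => m.christoffel_eq hy a b c

include m in
/-- The divergence of a 2-form as a density, `W` being a density that is compatible with the
metric. -/
theorem divergence {y : Coord} (hy : y ∈ U) (hF : ∀ i j, ContDiffOn ℝ ∞ (fun y => F y i j) U)
    (hFa : ∀ y ∈ U, ∀ i j, F y i j = - F y j i) {W : Coord → ℝ} (hW : DifferentiableAt ℝ W y)
    (hdW : ∀ c, pd c W y = W y * ∑ a, christoffel g a a c y) (b : Fin 4) :
    ∑ a, pd a (fun z => W z * ∑ c, ∑ d, H z a c * H z b d * F z c d) y
      = W y * ∑ e, H y b e * ∑ a, ∑ c, H y a c * covDeriv g F a c e y := by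
  have dH := fun i j => (m.smooth_inv i j).diffAt m.isOpen hy
  have dF := fun i j => (hF i j).diffAt m.isOpen hy
  have key := divergence_algebra (H := H y) (F := F y) (Γ := fun a b c => christoffel g a b c y)
    (dF := fun a c d => pd a (fun z => F z c d) y) (m.symm_inv hy) (hFa y hy)
    (m.christoffel_symm hy) b
  simp only [covDeriv]
  rw [← key, Finset.mul_sum]
  refine Finset.sum_congr rfl fun a _ => ?_
  have d1 : ∀ c d, DifferentiableAt ℝ (fun z => H z a c * H z b d) y := fun c d =>
    (dH a c).fun_mul (dH b d)
  have d2 : ∀ c d, DifferentiableAt ℝ (fun z => H z a c * H z b d * F z c d) y := fun c d =>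
    (d1 c d).fun_mul (dF c d)
  have d3 : ∀ c, DifferentiableAt ℝ (fun z => ∑ d, H z a c * H z b d * F z c d) y := fun c =>
    DifferentiableAt.fun_sum fun d _ => d2 c d
  rw [pd_mul hW (DifferentiableAt.fun_sum fun c _ => d3 c), hdW, pd_sum _ fun c _ => d3 c]
  have e1 : ∀ c d, pd a (fun z => H z a c * H z b d * F z c d) y
      = -(∑ e, christoffel g a a e y * H y e c + ∑ e, christoffel g c a e y * H y e a)
          * H y b d * F y c d
        - H y a c * (∑ e, christoffel g b a e y * H y e d + ∑ e, christoffel g d a e y * H y e b)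
          * F y c d
        + H y a c * H y b d * pd a (fun z => F z c d) y := by
    intro c d
    rw [pd_mul (d1 c d) (dF c d), pd_mul (dH a c) (dH b d), m.pd_inv hy, m.pd_inv hy]
    ring
  rw [Finset.sum_congr rfl fun c _ => (pd_sum _ fun d _ => d2 c d).trans
    (Finset.sum_congr rfl fun d _ => e1 c d)]
  ring

/-! ### Conformal transformations -/

section Conformal

variable {Ω : Coord → ℝ} (hΩ : ContDiffOn ℝ ∞ Ω U) (h0 : ∀ y ∈ U, Ω y ≠ 0)

include hΩ h0 m

theorem conformal : MetricOn U (fun y => (Ω y ^ 2)⁻¹ • g y) (fun y => Ω y ^ 2 • H y) where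
  isOpen := m.isOpen
  smooth i j := ((hΩ.pow 2).inv fun y hy => pow_ne_zero 2 (h0 y hy)).mul (m.smooth i j)
  smooth_inv i j := (hΩ.pow 2).mul (m.smooth_inv i j)
  symm y hy i j := by simp [m.symm y hy i j]
  mul_inv y hy := by
    rw [smul_mul_smul_comm, m.mul_inv y hy, inv_mul_cancel₀ (pow_ne_zero 2 (h0 y hy)), one_smul]

theorem christoffelFirst_conformal {y : Coord} (hy : y ∈ U) (d b c : Fin 4) :
    christoffelFirst (fun y => (Ω y ^ 2)⁻¹ • g y) d b c y = (Ω y ^ 2)⁻¹ *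
      (christoffelFirst g d b c y - (pd b Ω y / Ω y * g y d c + pd c Ω y / Ω y * g y d b
        - pd d Ω y / Ω y * g y b c)) := by
  have dΩ := hΩ.diffAt m.isOpen hy
  have hy0 := h0 y hy
  have e : ∀ i j k, pd k (fun z => ((Ω z ^ 2)⁻¹ • g z) i j) y
      = (Ω y ^ 2)⁻¹ * (pd k (fun z => g z i j) y - 2 * (pd k Ω y / Ω y * g y i j)) := by
    intro i j k
    have : (fun z => ((Ω z ^ 2)⁻¹ • g z) i j) = fun z => (Ω z ^ 2)⁻¹ * g z i j := rfl
    rw [this, pd_mul ((dΩ.fun_pow 2).fun_inv (pow_ne_zero 2 hy0))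
      ((m.smooth i j).diffAt m.isOpen hy), Electrovac.pd_inv (dΩ.fun_pow 2) (pow_ne_zero 2 hy0),
      pd_pow dΩ]
    field_simp
    push_cast
    ring
  rw [christoffelFirst, christoffelFirst, e, e, e]
  ring

theorem christoffel_conformal {y : Coord} (hy : y ∈ U) (a b c : Fin 4) :
    christoffel (fun y => (Ω y ^ 2)⁻¹ • g y) a b c y = christoffel g a b c y
      + (-(if a = b then pd c Ω y / Ω y else 0) - (if a = c then pd b Ω y / Ω y else 0)
        + g y b c * ∑ d, H y a d * (pd d Ω y / Ω y)) := by
  have hy0 := pow_ne_zero 2 (h0 y hy)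
  rw [(m.conformal hΩ h0).christoffel_eq hy, m.christoffel_eq hy]
  have hd : ∀ c, ∑ d, H y a d * g y d c = if a = c then 1 else 0 := by
    intro c
    have := congrFun (congrFun (m.inv_mul hy) a) c
    rw [Matrix.mul_apply, Matrix.one_apply] at this
    exact this
  have e : ∀ d, (Ω y ^ 2 • H y) a d * christoffelFirst (fun y => (Ω y ^ 2)⁻¹ • g y) d b c y
      = H y a d * christoffelFirst g d b c y - pd b Ω y / Ω y * (H y a d * g y d c)
        - pd c Ω y / Ω y * (H y a d * g y d b) + g y b c * (H y a d * (pd d Ω y / Ω y)) := by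
    intro d
    rw [m.christoffelFirst_conformal hΩ h0 hy, Matrix.smul_apply, smul_eq_mul]
    have h1 := mul_inv_cancel₀ hy0
    linear_combination (H y a d * (christoffelFirst g d b c y - (pd b Ω y / Ω y * g y d c
      + pd c Ω y / Ω y * g y d b - pd d Ω y / Ω y * g y b c))) * h1
  rw [Finset.sum_congr rfl fun d _ => e d]
  simp only [Finset.sum_add_distrib, Finset.sum_sub_distrib, ← Finset.mul_sum, hd]
  simp only [mul_ite, mul_one, mul_zero]
  ring

/-- The Ricci tensor of a conformally related metric. -/
theorem ricci_conformal {y : Coord} (hy : y ∈ U) (b c : Fin 4) :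
    ricci (fun y => (Ω y ^ 2)⁻¹ • g y) b c y = ricci g b c y
      + 2 * ((pd b (pd c Ω) y - ∑ d, christoffel g d b c y * pd d Ω y) / Ω y)
      + g y b c * (∑ a, pd a (fun z => ∑ d, H z a d * (pd d Ω z / Ω z)) y
        + ∑ d, (∑ a, christoffel g a a d y) * ∑ e, H y d e * (pd e Ω y / Ω y)
        - 2 * ∑ d, pd d Ω y / Ω y * ∑ e, H y d e * (pd e Ω y / Ω y)) := by
  set u : Fin 4 → Coord → ℝ := fun a z => pd a Ω z / Ω z with hu
  set V : Fin 4 → Coord → ℝ := fun a z => ∑ d, H z a d * u d z with hV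
  set C : Fin 4 → Fin 4 → Fin 4 → Coord → ℝ := fun a b c z =>
    -(if a = b then u c z else 0) - (if a = c then u b z else 0) + g z b c * V a z with hC
  have hy0 := h0 y hy
  have su : ∀ a, ContDiffOn ℝ ∞ (u a) U := fun a => (hΩ.pderiv m.isOpen a).div hΩ h0
  have sV : ∀ a, ContDiffOn ℝ ∞ (V a) U := fun a =>
    ContDiffOn.sum fun d _ => (m.smooth_inv a d).mul (su d)
  have du := fun a => (su a).diffAt m.isOpen hy
  have dV := fun a => (sV a).diffAt m.isOpen hy
  have dg := fun i j => (m.smooth i j).diffAt m.isOpen hy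
  have dΓ := fun a b c => (m.smooth_christoffel a b c).diffAt m.isOpen hy
  have ds : ∀ (P : Prop) [Decidable P] (a : Fin 4),
      DifferentiableAt ℝ (fun z => if P then u a z else 0) y := by
    intro P _ a
    split_ifs
    · exact du a
    · exact differentiableAt_const _
  have pds : ∀ (P : Prop) [Decidable P] (a i : Fin 4),
      pd i (fun z => if P then u a z else 0) y = if P then pd i (u a) y else 0 := by
    intro P _ a i
    split_ifs
    · rfl
    · exact pd_const _ _ _
  have dC : ∀ a b c, DifferentiableAt ℝ (C a b c) y := fun a b c =>
    (((ds _ _).fun_neg).fun_sub (ds _ _)).fun_add ((dg b c).fun_mul (dV a))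
  have hΓC : ∀ z ∈ U, ∀ a b c, christoffel (fun y => (Ω y ^ 2)⁻¹ • g y) a b c z
      = christoffel g a b c z + C a b c z := fun z hz a b c => m.christoffel_conformal hΩ h0 hz a b c
  have pdΓ : ∀ i a b c, pd i (christoffel (fun y => (Ω y ^ 2)⁻¹ • g y) a b c) y
      = pd i (christoffel g a b c) y + pd i (C a b c) y := by
    intro i a b c
    rw [← pd_add (dΓ a b c) (dC a b c)]
    exact pd_congr_of_isOpen m.isOpen (fun z hz => hΓC z hz a b c) hy
  have hgV : ∀ z ∈ U, ∀ a, ∑ d, g z a d * V d z = u a z := fun z hz a =>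
    m.contract hz (fun d => u d z) a
  have tr : ∀ z ∈ U, ∀ d, ∑ a, C a d a z = -4 * u d z := by
    intro z hz d
    simp only [hC, if_true, Finset.sum_add_distrib, Finset.sum_sub_distrib,
      Finset.sum_neg_distrib, Finset.sum_const, Finset.card_univ, Fintype.card_fin,
      Finset.sum_ite_eq', Finset.mem_univ, hgV z hz]
    simp
    ring
  -- The trace of the difference tensor is the exact form -4 d log Ω, so only second derivatives of
  -- log Ω enter from it.
  have pdtr : ∑ a, pd c (C a b a) y = -4 * pd c (u b) y := by
    rw [← pd_sum _ fun a _ => dC a b a,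
      pd_congr_of_isOpen (g := fun z => -4 * u b z) m.isOpen (fun z hz => tr z hz b) hy,
      pd_mul (differentiableAt_const _) (du b), pd_const]
    ring
  have pdC : ∑ a, pd a (C a b c) y = -pd b (u c) y - pd c (u b) y
      + ∑ a, V a y * (∑ d, g y c d * christoffel g d a b y
        + ∑ d, g y b d * christoffel g d a c y) + g y b c * ∑ a, pd a (V a) y := by
    have : ∀ a, pd a (C a b c) y = -(if a = b then pd a (u c) y else 0)
        - (if a = c then pd a (u b) y else 0) + (g y b c * pd a (V a) y
          + V a y * (∑ d, g y c d * christoffel g d a b y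
            + ∑ d, g y b d * christoffel g d a c y)) := by
      intro a
      rw [hC]
      simp only
      rw [pd_add (((ds _ _).fun_neg).fun_sub (ds _ _)) ((dg b c).fun_mul (dV a)),
        pd_sub ((ds _ _).fun_neg) (ds _ _), pd_neg, pds, pds, pd_mul (dg b c) (dV a),
        m.pd_metric hy a b c]
      ring
    rw [Finset.sum_congr rfl fun a _ => this a]
    simp only [Finset.sum_add_distrib, Finset.sum_sub_distrib, Finset.sum_neg_distrib,
      Finset.sum_ite_eq', Finset.mem_univ, if_true, ← Finset.mul_sum]
    ring
  have pdu : ∀ i j, pd i (u j) y = pd i (pd j Ω) y / Ω y - u i y * u j y := by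
    intro i j
    have d1 := (hΩ.pderiv m.isOpen j).diffAt m.isOpen hy
    have d2 := hΩ.diffAt m.isOpen hy
    have : u j = fun z => pd j Ω z * (Ω z)⁻¹ := by
      funext z
      simp only [hu, div_eq_mul_inv]
    rw [this, pd_mul d1 (d2.fun_inv hy0), Electrovac.pd_inv d2 hy0]
    simp only [hu]
    field_simp
    ring
  have alg := conformal_algebra (g := g y) (Γ := fun a b c => christoffel g a b c y)
    (u := fun a => u a y) (U := fun a => V a y) (C := fun a b c => C a b c y) (m.symm y hy)
    (m.christoffel_symm hy) (hgV y hy) (fun _ _ _ => rfl) b c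
  have alg' : ∑ d, V d y * (∑ a, g y b a * christoffel g a c d y
      + ∑ a, g y c a * christoffel g a b d y)
      = ∑ a, V a y * (∑ d, g y c d * christoffel g d a b y
        + ∑ d, g y b d * christoffel g d a c y) := by
    refine Finset.sum_congr rfl fun d _ => ?_
    simp only [m.christoffel_symm hy _ d]
    ring
  have e1 : ∑ d, christoffel g d b c y * pd d Ω y
      = Ω y * ∑ d, u d y * christoffel g d b c y := by
    rw [Finset.mul_sum]
    refine Finset.sum_congr rfl fun d _ => ?_
    simp only [hu]
    field_simp
  change _ = ricci g b c y
    + 2 * ((pd b (pd c Ω) y - ∑ d, christoffel g d b c y * pd d Ω y) / Ω y)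
    + g y b c * (∑ a, pd a (V a) y + ∑ d, (∑ a, christoffel g a a d y) * V d y
      - 2 * ∑ d, u d y * V d y)
  simp only [ricci, pdΓ, hΓC y hy]
  simp only [Finset.sum_add_distrib, Finset.sum_sub_distrib] at alg pdtr ⊢
  rw [alg'] at alg
  rw [e1, pdC, pdtr, pdu, pdu, pd_comm m.isOpen hΩ hy c b, sub_div, mul_div_cancel_left₀ _ hy0]
  linear_combination alg

end Conformal

end MetricOn

end Electrovac

end

/-! ### Stationary quantities and the data in one adapted chart. -/

noncomputable section
open scoped Manifold ContDiff
open Set Filter Topology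
namespace Electrovac

theorem pd_sqrt {i : Fin 4} {f : Coord → ℝ} {y : Coord} (hf : DifferentiableAt ℝ f y)
    (h0 : 0 < f y) : pd i (fun z => √(f z)) y = pd i f y / (2 * √(f y)) := by
  have h := (Real.hasDerivAt_sqrt h0.ne').comp_hasFDerivAt y hf.hasFDerivAt
  have h2 : (fun z => √(f z)) = (fun x : ℝ => √x) ∘ f := rfl
  simp only [pd]
  rw [h2, h.fderiv]
  simp
  ring

/-- Smooth functions that are invariant under `∂/∂v`. -/
def Stat (U : Set Coord) (f : Coord → ℝ) : Prop :=
  ContDiffOn ℝ ∞ f U ∧ ∀ y ∈ U, pd 0 f y = 0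

namespace Stat

variable {U : Set Coord} {f g : Coord → ℝ}

theorem congr (hU : IsOpen U) (hf : Stat U f) (h : ∀ y ∈ U, g y = f y) : Stat U g :=
  ⟨hf.1.congr h, fun y hy => (pd_congr_of_isOpen hU h hy).trans (hf.2 y hy)⟩

theorem const (a : ℝ) : Stat U fun _ => a := ⟨contDiffOn_const, fun _ _ => pd_const _ _ _⟩

theorem add (hU : IsOpen U) (hf : Stat U f) (hg : Stat U g) : Stat U fun y => f y + g y :=
  ⟨hf.1.add hg.1, fun y hy => by
    rw [pd_add (hf.1.diffAt hU hy) (hg.1.diffAt hU hy), hf.2 y hy, hg.2 y hy, add_zero]⟩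

theorem neg (hf : Stat U f) : Stat U fun y => - f y :=
  ⟨hf.1.neg, fun y hy => by rw [pd_neg, hf.2 y hy, neg_zero]⟩

theorem sub (hU : IsOpen U) (hf : Stat U f) (hg : Stat U g) : Stat U fun y => f y - g y := by
  simpa only [sub_eq_add_neg] using hf.add hU hg.neg

theorem mul (hU : IsOpen U) (hf : Stat U f) (hg : Stat U g) : Stat U fun y => f y * g y :=
  ⟨hf.1.mul hg.1, fun y hy => by
    rw [pd_mul (hf.1.diffAt hU hy) (hg.1.diffAt hU hy), hf.2 y hy, hg.2 y hy]; ring⟩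

theorem inv (hU : IsOpen U) (hf : Stat U f) (h0 : ∀ y ∈ U, f y ≠ 0) : Stat U fun y => (f y)⁻¹ :=
  ⟨hf.1.inv h0, fun y hy => by
    rw [pd_inv (hf.1.diffAt hU hy) (h0 y hy), hf.2 y hy]; simp⟩

theorem div (hU : IsOpen U) (hf : Stat U f) (hg : Stat U g) (h0 : ∀ y ∈ U, g y ≠ 0) :
    Stat U fun y => f y / g y := by
  simpa only [div_eq_mul_inv] using hf.mul hU (hg.inv hU h0)

theorem sqrt (hU : IsOpen U) (hf : Stat U f) (h0 : ∀ y ∈ U, 0 < f y) : Stat U fun y => √(f y) :=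
  ⟨hf.1.sqrt fun y hy => (h0 y hy).ne', fun y hy => by
    rw [pd_sqrt (hf.1.diffAt hU hy) (h0 y hy), hf.2 y hy, zero_div]⟩

theorem sum (hU : IsOpen U) {ι : Type*} (s : Finset ι) {f : ι → Coord → ℝ}
    (hf : ∀ a, Stat U (f a)) : Stat U fun y => ∑ a ∈ s, f a y :=
  ⟨ContDiffOn.sum fun a _ => (hf a).1, fun y hy => by
    rw [pd_sum _ fun a _ => (hf a).1.diffAt hU hy]
    exact Finset.sum_eq_zero fun a _ => (hf a).2 y hy⟩

theorem pd (hU : IsOpen U) (hf : Stat U f) (i : Fin 4) : Stat U (pd i f) :=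
  ⟨hf.1.pderiv hU i, fun y hy => by
    rw [pd_comm hU hf.1 hy 0 i, pd_congr_of_isOpen hU hf.2 hy, pd_const]⟩

end Stat

namespace MetricOn

variable {U : Set Coord} {g H : Coord → Matrix (Fin 4) (Fin 4) ℝ} (m : MetricOn U g H)
  (hg : ∀ i j, Stat U fun y => g y i j) (hH : ∀ i j, Stat U fun y => H y i j)

include m hg hH

theorem stat_christoffel (a b c : Fin 4) : Stat U (christoffel g a b c) := by
  refine Stat.congr m.isOpen (Stat.sum m.isOpen Finset.univ fun d => (hH a d).mul m.isOpen
    ((Stat.const (1 / 2)).mul m.isOpen ((((hg d c).pd m.isOpen b).add m.isOpen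
      ((hg d b).pd m.isOpen c)).sub m.isOpen ((hg b c).pd m.isOpen d)))) fun y hy => ?_
  rw [m.christoffel_eq hy]
  rfl

theorem stat_ricci (b c : Fin 4) : Stat U (ricci g b c) := by
  have h := m.stat_christoffel hg hH
  exact Stat.sum m.isOpen _ fun a => (((h a b c).pd m.isOpen a).sub m.isOpen
    ((h a b a).pd m.isOpen c)).add m.isOpen (Stat.sum m.isOpen _ fun d =>
      ((h a a d).mul m.isOpen (h d b c)).sub m.isOpen ((h a c d).mul m.isOpen (h d b a)))

end MetricOn

namespace MetricOn

variable {U : Set Coord} {g H : Coord → Matrix (Fin 4) (Fin 4) ℝ} (m : MetricOn U g H)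
  {Ω : Coord → ℝ} (hΩ : ContDiffOn ℝ ∞ Ω U) (h0 : ∀ y ∈ U, Ω y ≠ 0)

include hΩ h0 m

theorem trace_christoffel_conformal {y : Coord} (hy : y ∈ U) (c : Fin 4) :
    ∑ a, christoffel (fun y => (Ω y ^ 2)⁻¹ • g y) a a c y
      = ∑ a, christoffel g a a c y - 4 * (pd c Ω y / Ω y) := by
  have h := m.contract hy (fun d => pd d Ω y / Ω y) c
  simp only [m.christoffel_conformal hΩ h0 hy, if_true, Finset.sum_add_distrib,
    Finset.sum_sub_distrib, Finset.sum_neg_distrib, Finset.sum_const, Finset.card_univ,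
    Fintype.card_fin, Finset.sum_ite_eq', Finset.mem_univ]
  have h' : ∑ a, g y a c * ∑ d, H y a d * (pd d Ω y / Ω y) = pd c Ω y / Ω y := by
    rw [← h]
    exact Finset.sum_congr rfl fun a _ => by rw [m.symm y hy a c]
  rw [h']
  simp
  ring

omit h0 hΩ in
/-- The energy tensor is conformally invariant up to a factor. -/
theorem emTensor_conformal (F : Coord → Matrix (Fin 4) (Fin 4) ℝ) {y : Coord} (hy : y ∈ U)
    (h0 : Ω y ≠ 0) (a b : Fin 4) :
    emTensor (fun y => (Ω y ^ 2)⁻¹ • g y) F a b y = Ω y ^ 2 * emTensor g F a b y := by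
  have h1 : ((Ω y ^ 2)⁻¹ • g y)⁻¹ = Ω y ^ 2 • H y := by
    apply Matrix.inv_eq_right_inv
    rw [smul_mul_smul_comm, m.mul_inv y hy, inv_mul_cancel₀ (pow_ne_zero 2 h0), one_smul]
  have e1 : ∑ c, ∑ d, ∑ c', ∑ d', (Ω y ^ 2 * H y c c') * (Ω y ^ 2 * H y d d') * F y c d * F y c' d'
      = (Ω y ^ 2) ^ 2 * ∑ c, ∑ d, ∑ c', ∑ d', H y c c' * H y d d' * F y c d * F y c' d' := by
    simp only [Finset.mul_sum]
    exact Finset.sum_congr rfl fun c _ => Finset.sum_congr rfl fun d _ =>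
      Finset.sum_congr rfl fun c' _ => Finset.sum_congr rfl fun d' _ => by ring
  have e2 : ∑ c, ∑ d, (Ω y ^ 2 * H y c d) * F y a c * F y b d
      = Ω y ^ 2 * ∑ c, ∑ d, H y c d * F y a c * F y b d := by
    simp only [Finset.mul_sum]
    exact Finset.sum_congr rfl fun c _ => Finset.sum_congr rfl fun d _ => by ring
  simp only [emTensor, h1, m.inv_eq hy, Matrix.smul_apply, smul_eq_mul]
  rw [e1, e2]
  field_simp

end MetricOn

/-- The inverse of a matrix field `g` with `g_{1j} = δ_{0j}`. -/
def invMet (g : Coord → Matrix (Fin 4) (Fin 4) ℝ) (y : Coord) : Matrix (Fin 4) (Fin 4) ℝ :=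
  let d := g y 2 2 * g y 3 3 - g y 2 3 ^ 2
  let h2 := -(g y 3 3 * g y 0 2 - g y 2 3 * g y 0 3) / d
  let h3 := -(g y 2 2 * g y 0 3 - g y 2 3 * g y 0 2) / d
  !![0, 1, 0, 0;
     1, -(g y 0 0) - (h2 * g y 0 2 + h3 * g y 0 3), h2, h3;
     0, h2, g y 3 3 / d, -(g y 2 3) / d;
     0, h3, -(g y 2 3) / d, g y 2 2 / d]

/-- The data of a neighbourhood of past null infinity in one of the coordinate systems. -/
structure ChartData (D : Set Coord) (k : ℝ) (Ω : Coord → ℝ)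
    (g F : Coord → Matrix (Fin 4) (Fin 4) ℝ) : Prop where
  nbhd : ScriNbhd D
  smooth_conf : ContDiffOn ℝ ∞ Ω D
  smooth_met : ∀ i j, ContDiffOn ℝ ∞ (fun y => g y i j) D
  smooth_fld : ∀ i j, ContDiffOn ℝ ∞ (fun y => F y i j) D
  conf_pos : ∀ y ∈ D, 0 < y 1 → 0 < Ω y
  conf_factor : ∃ w : Coord → ℝ, ContDiffOn ℝ ∞ w D ∧ (∀ y ∈ D, w y ≠ 0) ∧
    ∀ y ∈ D, Ω y = y 1 * w y
  symm : ∀ y ∈ D, 0 < y 1 → ∀ i j, g y i j = g y j i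
  alt : ∀ y ∈ D, 0 < y 1 → ∀ i j, F y i j = - F y j i
  det_pos : ∀ y ∈ D, 0 < g y 2 2 * g y 3 3 - g y 2 3 ^ 2
  met_r : ∀ y ∈ D, 0 < y 1 → ∀ j, g y 1 j = if j = 0 then 1 else 0
  einstein : ∀ y ∈ D, 0 < y 1 → ∀ a b, ricci (fun z => (Ω z ^ 2)⁻¹ • g z) a b y
    = 2 * k * emTensor (fun z => (Ω z ^ 2)⁻¹ • g z) F a b y
  closed : ∀ y ∈ D, 0 < y 1 → ∀ a b c, pd a (fun z => F z b c) y + pd b (fun z => F z c a) y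
    + pd c (fun z => F z a b) y = 0
  coclosed : ∀ y ∈ D, 0 < y 1 → ∀ b, ∑ a, ∑ c, ((Ω y ^ 2)⁻¹ • g y)⁻¹ a c *
    covDeriv (fun z => (Ω z ^ 2)⁻¹ • g z) F c a b y = 0
  dv_conf : ∀ y ∈ D, 0 < y 1 → pd 0 Ω y = 0
  dv_met : ∀ y ∈ D, 0 < y 1 → ∀ i j, pd 0 (fun z => g z i j) y = 0
  conf_scri : ∀ y : Coord, y 1 = 0 → Ω y = 0
  conf_deriv_scri : ∀ y : Coord, y 1 = 0 → pd 1 Ω y = 1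
  met_vv_scri : ∀ y : Coord, y 1 = 0 → g y 0 0 = 0
  met_v2_scri : ∀ y : Coord, y 1 = 0 → g y 0 2 = 0
  met_v3_scri : ∀ y : Coord, y 1 = 0 → g y 0 3 = 0
  met_vv_deriv_scri : ∀ y : Coord, y 1 = 0 → pd 1 (fun z => g z 0 0) y = 0
  met_22_scri : ∀ y : Coord, y 1 = 0 → g y 2 2 = -(4 / (1 + y 2 ^ 2 + y 3 ^ 2) ^ 2)
  met_33_scri : ∀ y : Coord, y 1 = 0 → g y 3 3 = -(4 / (1 + y 2 ^ 2 + y 3 ^ 2) ^ 2)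
  met_23_scri : ∀ y : Coord, y 1 = 0 → g y 2 3 = 0

namespace ChartData

variable {D : Set Coord} {k : ℝ} {Ω : Coord → ℝ} {g F : Coord → Matrix (Fin 4) (Fin 4) ℝ}
  (c : ChartData D k Ω g F)

include c

theorem smooth_inv (i j : Fin 4) : ContDiffOn ℝ ∞ (fun y => invMet g y i j) D := by
  have s := c.smooth_met
  have hd : ContDiffOn ℝ ∞ (fun y => g y 2 2 * g y 3 3 - g y 2 3 ^ 2) D :=
    ((s 2 2).mul (s 3 3)).sub ((s 2 3).pow 2)
  have h0 : ∀ y ∈ D, g y 2 2 * g y 3 3 - g y 2 3 ^ 2 ≠ 0 := fun y hy => (c.det_pos y hy).ne'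
  have h2 := ((((s 3 3).mul (s 0 2)).sub ((s 2 3).mul (s 0 3))).neg).div hd h0
  have h3 := ((((s 2 2).mul (s 0 3)).sub ((s 2 3).mul (s 0 2))).neg).div hd h0
  have h11 := (s 0 0).neg.sub ((h2.mul (s 0 2)).add (h3.mul (s 0 3)))
  fin_cases i <;> fin_cases j
  all_goals first
    | exact contDiffOn_const
    | exact h2
    | exact h3
    | exact h11
    | exact (s 3 3).div hd h0
    | exact (s 2 2).div hd h0
    | exact (s 2 3).neg.div hd h0

theorem metricOn : MetricOn (D ∩ {y | 0 < y 1}) g (invMet g) where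
  isOpen := c.nbhd.isOpen_pos
  smooth i j := (c.smooth_met i j).mono inter_subset_left
  smooth_inv i j := (c.smooth_inv i j).mono inter_subset_left
  symm y hy := c.symm y hy.1 hy.2
  mul_inv y hy := by
    have h0 := (c.det_pos y hy.1).ne'
    have h1 := c.met_r y hy.1 hy.2
    have hs := c.symm y hy.1 hy.2
    have e10 : g y 1 0 = 1 := by simpa using h1 0
    have e11 : g y 1 1 = 0 := by simpa using h1 1
    have e12 : g y 1 2 = 0 := by simpa using h1 2
    have e13 : g y 1 3 = 0 := by simpa using h1 3
    have e01 : g y 0 1 = 1 := by rw [hs, e10]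
    have e21 : g y 2 1 = 0 := by rw [hs, e12]
    have e31 : g y 3 1 = 0 := by rw [hs, e13]
    ext i j
    fin_cases i <;> fin_cases j <;>
      simp [invMet, Matrix.mul_apply, Fin.sum_univ_four, e10, e11, e12, e13, e01, e21, e31,
        hs 3 2, hs 2 0, hs 3 0]
    all_goals first
      | (field_simp; done)
      | (field_simp; ring1)
      | linear_combination (-(g y 0 3)) * mul_inv_cancel₀ h0

theorem stat_met (i j : Fin 4) : Stat (D ∩ {y | 0 < y 1}) fun y => g y i j :=
  ⟨(c.smooth_met i j).mono inter_subset_left, fun y hy => c.dv_met y hy.1 hy.2 i j⟩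

theorem stat_conf : Stat (D ∩ {y | 0 < y 1}) Ω :=
  ⟨c.smooth_conf.mono inter_subset_left, fun y hy => c.dv_conf y hy.1 hy.2⟩

theorem stat_inv (i j : Fin 4) : Stat (D ∩ {y | 0 < y 1}) fun y => invMet g y i j := by
  have hU := c.nbhd.isOpen_pos
  have s := c.stat_met
  have hd : Stat (D ∩ {y | 0 < y 1}) (fun y => g y 2 2 * g y 3 3 - g y 2 3 ^ 2) := by
    simp only [sq]
    exact ((s 2 2).mul hU (s 3 3)).sub hU ((s 2 3).mul hU (s 2 3))
  have h0 : ∀ y ∈ (D ∩ {y | 0 < y 1}), g y 2 2 * g y 3 3 - g y 2 3 ^ 2 ≠ 0 :=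
    fun y hy => (c.det_pos y hy.1).ne'
  have h2 := ((((s 3 3).mul hU (s 0 2)).sub hU ((s 2 3).mul hU (s 0 3))).neg).div hU hd h0
  have h3 := ((((s 2 2).mul hU (s 0 3)).sub hU ((s 2 3).mul hU (s 0 2))).neg).div hU hd h0
  have h11 := (s 0 0).neg.sub hU ((h2.mul hU (s 0 2)).add hU (h3.mul hU (s 0 3)))
  fin_cases i <;> fin_cases j
  all_goals first
    | exact Stat.const _
    | exact h2
    | exact h3
    | exact h11
    | exact (s 3 3).div hU hd h0
    | exact (s 2 2).div hU hd h0
    | exact (s 2 3).neg.div hU hd h0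

end ChartData

end Electrovac

end

/-! ### Consequences of the Einstein equations for Ω and ĝ_{vI}. -/

noncomputable section
open scoped Manifold ContDiff
open Set Filter Topology
namespace Electrovac

/-- For `r > 0` the function `f` is `r ^ k` times a function that is smooth up to `r = 0`. -/
def VanishTo (D : Set Coord) (k : ℕ) (f : Coord → ℝ) : Prop := ∃ c, Lead D k f c

namespace VanishTo

variable {D : Set Coord} {k l : ℕ} {f g : Coord → ℝ}

theorem of_smooth (hf : ContDiffOn ℝ ∞ f D) : VanishTo D 0 f := ⟨f, Lead.of_smooth hf⟩

theorem zero (D : Set Coord) (k : ℕ) : VanishTo D k fun _ => 0 := ⟨_, Lead.zero D k⟩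

theorem congr (hf : VanishTo D k f) (h : ∀ y ∈ D, 0 < y 1 → g y = f y) : VanishTo D k g :=
  hf.imp fun _ hc => hc.congr h

theorem add (hf : VanishTo D k f) (hg : VanishTo D k g) : VanishTo D k fun y => f y + g y := by
  obtain ⟨_, hc⟩ := hf
  obtain ⟨_, hd⟩ := hg
  exact ⟨_, hc.add hd⟩

theorem sub (hf : VanishTo D k f) (hg : VanishTo D k g) : VanishTo D k fun y => f y - g y := by
  obtain ⟨_, hc⟩ := hf
  obtain ⟨_, hd⟩ := hg
  exact ⟨_, hc.sub hd⟩

theorem neg (hf : VanishTo D k f) : VanishTo D k fun y => - f y := hf.elim fun _ hc => ⟨_, hc.neg⟩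

theorem mul (hf : VanishTo D k f) (hg : VanishTo D l g) :
    VanishTo D (k + l) fun y => f y * g y := by
  obtain ⟨_, hc⟩ := hf
  obtain ⟨_, hd⟩ := hg
  exact ⟨_, hc.mul hd⟩

theorem mul_zero_right (hf : VanishTo D k f) (hg : VanishTo D 0 g) : VanishTo D k fun y => f y * g y :=
  hf.mul hg

theorem mul_zero_left (hf : VanishTo D 0 f) (hg : VanishTo D k g) :
    VanishTo D k fun y => f y * g y := by
  simpa using hf.mul hg

theorem const_mul (a : ℝ) (hf : VanishTo D k f) : VanishTo D k fun y => a * f y :=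
  hf.elim fun _ hc => ⟨_, hc.const_mul a⟩

theorem mono (hf : VanishTo D k f) (h : l ≤ k) : VanishTo D l f := hf.elim fun _ hc => hc.mono h

theorem lead (hf : VanishTo D k f) (h : l < k) : Lead D l f fun _ => 0 :=
  hf.elim fun _ hc => hc.of_le h

theorem pd_tan (hf : VanishTo D k f) (hD : ScriNbhd D) {i : Fin 4} (hi : i ≠ 1) :
    VanishTo D k (pd i f) := hf.elim fun _ hc => ⟨_, hc.pd_tan hD hi⟩

theorem pd_one (hf : VanishTo D (k + 1) f) (hD : ScriNbhd D) : VanishTo D k (pd 1 f) :=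
  hf.elim fun _ hc => ⟨_, hc.pd_one hD⟩

theorem pd_zero (hf : VanishTo D 0 f) (hD : ScriNbhd D) (i : Fin 4) : VanishTo D 0 (pd i f) :=
  hf.elim fun _ hc => hc.pd_zero hD i

theorem sum {ι : Type*} (s : Finset ι) {f : ι → Coord → ℝ} (hf : ∀ a ∈ s, VanishTo D k (f a)) :
    VanishTo D k fun y => ∑ a ∈ s, f a y := by
  classical
  induction s using Finset.induction_on with
  | empty => simpa using zero D k
  | insert a s ha ih =>
    simp only [Finset.sum_insert ha]
    exact (hf a (Finset.mem_insert_self _ _)).add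
      (ih fun b hb => hf b (Finset.mem_insert_of_mem hb))

end VanishTo

theorem Lead.vanishTo {D : Set Coord} {k : ℕ} {f c : Coord → ℝ} (h : Lead D k f c) :
    VanishTo D k f := ⟨c, h⟩

/-- The energy tensor in terms of the inverse metric. -/
def emOf (g H F : Matrix (Fin 4) (Fin 4) ℝ) (a b : Fin 4) : ℝ :=
  (1 / 2) * ((1 / 4) * g a b *
      (∑ c, ∑ d, ∑ c', ∑ d', H c c' * H d d' * F c d * F c' d')
    - ∑ c, ∑ d, H c d * F a c * F b d)

namespace ChartData

variable {D : Set Coord} {k : ℝ} {Ω : Coord → ℝ} {g F : Coord → Matrix (Fin 4) (Fin 4) ℝ}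
  (c : ChartData D k Ω g F)

/-- The Christoffel symbols of the unphysical metric, extended through `r = 0`. -/
def chr (g : Coord → Matrix (Fin 4) (Fin 4) ℝ) (a b e : Fin 4) (y : Coord) : ℝ :=
  ∑ d, invMet g y a d * christoffelFirst g d b e y

include c

theorem conf_ne {y : Coord} (hy : y ∈ D ∩ {y | 0 < y 1}) : Ω y ≠ 0 := (c.conf_pos y hy.1 hy.2).ne'

theorem christoffel_eq_chr {y : Coord} (hy : y ∈ D ∩ {y | 0 < y 1}) (a b e : Fin 4) :
    christoffel g a b e y = chr g a b e y := c.metricOn.christoffel_eq hy a b e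

theorem smooth_chr (a b e : Fin 4) : ContDiffOn ℝ ∞ (chr g a b e) D := by
  have hD := c.nbhd.isOpen
  refine ContDiffOn.sum fun d _ => (c.smooth_inv a d).mul ?_
  exact contDiffOn_const.mul ((((c.smooth_met d e).pderiv hD b).add
      ((c.smooth_met d b).pderiv hD e)).sub ((c.smooth_met b e).pderiv hD d))

theorem ricci_eq_chr {y : Coord} (hy : y ∈ D ∩ {y | 0 < y 1}) (b e : Fin 4) :
    ricci g b e y = ∑ a, (pd a (chr g a b e) y - pd e (chr g a b a) y
      + ∑ d, (chr g a a d y * chr g d b e y - chr g a e d y * chr g d b a y)) := by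
  have h : ∀ a b e d, pd d (christoffel g a b e) y = pd d (chr g a b e) y := fun a b e d =>
    pd_congr_of_isOpen c.nbhd.isOpen_pos (fun z hz => c.christoffel_eq_chr hz a b e) hy
  simp only [ricci, h, c.christoffel_eq_chr hy]

theorem vanishTo_ricci (b e : Fin 4) : VanishTo D 0 (ricci g b e) := by
  have hD := c.nbhd.isOpen
  have s := c.smooth_chr
  refine (VanishTo.of_smooth (f := fun y => ∑ a, (pd a (chr g a b e) y - pd e (chr g a b a) y
      + ∑ d, (chr g a a d y * chr g d b e y - chr g a e d y * chr g d b a y))) ?_).congr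
      fun y hy h0 => c.ricci_eq_chr ⟨hy, h0⟩ b e
  exact ContDiffOn.sum fun a _ => (((s a b e).pderiv hD a).sub ((s a b a).pderiv hD e)).add
    (ContDiffOn.sum fun d _ => ((s a a d).mul (s d b e)).sub ((s a e d).mul (s d b a)))

theorem lead_emTensor (a b : Fin 4) :
    Lead D 0 (emTensor g F a b) (fun y => emOf (g y) (invMet g y) (F y) a b) := by
  have sF := c.smooth_fld
  have sH := c.smooth_inv
  refine (Lead.of_smooth (f := fun y => emOf (g y) (invMet g y) (F y) a b) ?_).congr
      fun y hy h0 => ?_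
  · refine contDiffOn_const.mul (((contDiffOn_const.mul (c.smooth_met a b)).mul ?_).sub ?_)
    · exact ContDiffOn.sum fun p _ => ContDiffOn.sum fun q _ => ContDiffOn.sum fun p' _ =>
        ContDiffOn.sum fun q' _ => (((sH p p').mul (sH q q')).mul (sF p q)).mul (sF p' q')
    · exact ContDiffOn.sum fun p _ => ContDiffOn.sum fun q _ =>
        ((sH p q).mul (sF a p)).mul (sF b q)
  · rw [emTensor, c.metricOn.inv_eq ⟨hy, h0⟩]
    rfl

/-- The field equations in terms of the unphysical metric. -/
theorem einstein_conformal {y : Coord} (hy : y ∈ D ∩ {y | 0 < y 1}) (b e : Fin 4) :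
    ricci g b e y + 2 * ((pd b (pd e Ω) y - ∑ d, christoffel g d b e y * pd d Ω y) / Ω y)
      + g y b e * (∑ a, pd a (fun z => ∑ d, invMet g z a d * (pd d Ω z / Ω z)) y
        + ∑ d, (∑ a, christoffel g a a d y) * ∑ e, invMet g y d e * (pd e Ω y / Ω y)
        - 2 * ∑ d, pd d Ω y / Ω y * ∑ e, invMet g y d e * (pd e Ω y / Ω y))
      = 2 * k * (Ω y ^ 2 * emTensor g F b e y) := by
  have h := c.einstein y hy.1 hy.2 b e
  rw [c.metricOn.ricci_conformal (c.stat_conf).1 (fun y hy => c.conf_ne hy) hy,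
    c.metricOn.emTensor_conformal F hy (c.conf_ne hy)] at h
  exact h

/-- Ω = r w with w = 1 at r = 0 by the gauge condition ∂_r Ω = 1, so the coefficient is unchanged.
-/
theorem lead_div {n : ℕ} {f u : Coord → ℝ} (hf : Lead D (n + 1) f u) :
    Lead D n (fun y => f y / Ω y) u := by
  obtain ⟨w, h1, h2, h3⟩ := c.conf_factor
  obtain ⟨φ, p1, p2, p3⟩ := hf
  have hw : ∀ y : Coord, y 1 = 0 → w y = 1 := by
    intro y hy
    have hyD := c.nbhd.scri_mem y hy
    have := pd_congr_of_isOpen (i := 1) c.nbhd.isOpen h3 hyD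
    rw [c.conf_deriv_scri y hy, pd_mul (by fun_prop) (h1.diffAt c.nbhd.isOpen hyD), pd_coord,
      hy] at this
    simpa using this.symm
  refine ⟨fun y => φ y / w y, p1.div h1 h2, fun y hy h0 => ?_, fun y hy => ?_⟩
  · have := h2 y hy
    beta_reduce
    rw [p2 y hy h0, h3 y hy]
    field_simp
    ring
  · simp [hw y hy, p3 y hy]

theorem lead_conf : Lead D 1 Ω fun _ => 1 := by
  obtain ⟨c', hc⟩ := (Lead.of_smooth_zero c.smooth_conf c.conf_scri).raise c.nbhd fun _ _ => rfl
  refine hc.congr_lead fun y hy => ?_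
  have h1 := (hc.pd_one c.nbhd).unique c.nbhd
    (Lead.of_smooth (c.smooth_conf.pderiv c.nbhd.isOpen 1)) hy
  rw [c.conf_deriv_scri y hy] at h1
  simpa using h1.symm

theorem scri_eq {f g : Coord → ℝ} (hf : ContDiffOn ℝ ∞ f D) (hg : ContDiffOn ℝ ∞ g D)
    (h : ∀ y ∈ D ∩ {y | 0 < y 1}, f y = g y) {y : Coord} (hy : y 1 = 0) : f y = g y :=
  c.nbhd.eq_scri hf.continuousOn hg.continuousOn (fun z hz h0 => h z ⟨hz, h0⟩) hy

theorem symm_scri {y : Coord} (hy : y 1 = 0) (i j : Fin 4) : g y i j = g y j i :=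
  c.scri_eq (c.smooth_met i j) (c.smooth_met j i) (fun z hz => c.symm z hz.1 hz.2 i j) hy

/-- `∂_a g_{1j} = 0`. -/
theorem pd_met_r {y : Coord} (hy : y ∈ D ∩ {y | 0 < y 1}) (a j : Fin 4) :
    pd a (fun z => g z 1 j) y = 0 := by
  rw [pd_congr_of_isOpen c.nbhd.isOpen_pos (fun z hz => c.met_r z hz.1 hz.2 j) hy, pd_const]

theorem pd_met_r' {y : Coord} (hy : y ∈ D ∩ {y | 0 < y 1}) (a j : Fin 4) :
    pd a (fun z => g z j 1) y = 0 := by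
  rw [c.metricOn.pd_symm hy, c.pd_met_r hy]

theorem chr_zero_one {y : Coord} (hy : y ∈ D ∩ {y | 0 < y 1}) (b : Fin 4) :
    chr g 0 1 b y = 0 := by
  simp [chr, Fin.sum_univ_four, invMet, christoffelFirst, c.pd_met_r hy, c.pd_met_r' hy]

/-- The lines of r are affinely parametrized geodesics of the unphysical metric. -/
theorem chr_one_one {y : Coord} (hy : y ∈ D ∩ {y | 0 < y 1}) (a : Fin 4) :
    chr g a 1 1 y = 0 := by
  simp [chr, christoffelFirst, c.pd_met_r hy, c.pd_met_r' hy]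

/-- For components with ĝ_{be} = 0, twice the Hessian of Ω equals this expression by
`einstein_conformal`; so that Hessian component is O(r). -/
theorem vanishTo_ricci_em (b e : Fin 4) :
    VanishTo D 1 (fun y => Ω y * (2 * k * (Ω y ^ 2 * emTensor g F b e y) - ricci g b e y)) :=
  c.lead_conf.vanishTo.mul_zero_right
    ((((((c.lead_conf.pow 2).vanishTo.mul_zero_right (c.lead_emTensor b e).vanishTo).mono
      (Nat.zero_le _)).const_mul (2 * k))).sub (c.vanishTo_ricci b e))

/-- In the rr component ĝ_{rr} = 0 and Γ^a_{rr} = 0, so ∂_r²Ω = O(r); two integrations with Ω = 0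
and ∂_r Ω = 1 at r = 0 give the claim. -/
theorem vanishTo_conf_sub : VanishTo D 3 fun y => Ω y - y 1 := by
  have hO := c.nbhd.isOpen
  have s1 := c.smooth_conf.pderiv hO 1
  have h2 : VanishTo D 1 (pd 1 (pd 1 Ω)) := by
    refine ((c.vanishTo_ricci_em 1 1).const_mul (1 / 2)).congr fun y hy h0 => ?_
    have h := c.einstein_conformal ⟨hy, h0⟩ 1 1
    have hΩ := (c.conf_pos y hy h0).ne'
    simp only [c.christoffel_eq_chr ⟨hy, h0⟩, c.chr_one_one ⟨hy, h0⟩, c.met_r y hy h0 1] at h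
    simp at h
    field_simp at h
    linear_combination (1 / 2) * h
  have d : ∀ y ∈ D, pd 1 (fun y => Ω y - y 1) y = pd 1 Ω y - 1 := fun y hy => by
    rw [pd_sub (c.smooth_conf.diffAt hO hy) (by fun_prop), pd_coord]; simp
  have h1 : VanishTo D 2 (fun y => pd 1 Ω y - 1) := by
    obtain ⟨w, hw⟩ := h2
    refine (Lead.integrate c.nbhd (n := 1) (Lead.of_smooth_zero (s1.sub contDiffOn_const)
      fun y hy => by simp [c.conf_deriv_scri y hy]) (hw.congr fun y hy _ => ?_)).vanishTo
    rw [pd_sub (s1.diffAt hO hy) (by fun_prop), pd_const, sub_zero]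
  obtain ⟨w, hw⟩ := h1
  exact (Lead.integrate c.nbhd (n := 2) (Lead.of_smooth_zero (c.smooth_conf.sub (by fun_prop))
    fun y hy => by simp [c.conf_scri y hy, hy]) (hw.congr fun y hy _ => d y hy)).vanishTo

theorem vanishTo_pd_conf {i : Fin 4} (hi : i ≠ 1) : VanishTo D 3 (pd i Ω) := by
  refine (c.vanishTo_conf_sub.pd_tan c.nbhd hi).congr fun y hy _ => ?_
  rw [pd_sub (c.smooth_conf.diffAt c.nbhd.isOpen hy) (by fun_prop), pd_coord]
  simp [hi.symm]

theorem lead_pd_one_conf : Lead D 0 (pd 1 Ω) fun _ => 1 := by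
  simpa using c.lead_conf.pd_one c.nbhd

theorem invMet_scri {y : Coord} (hy : y 1 = 0) : invMet g y =
    !![0, 1, 0, 0; 1, 0, 0, 0;
      0, 0, -((1 + y 2 ^ 2 + y 3 ^ 2) ^ 2 / 4), 0;
      0, 0, 0, -((1 + y 2 ^ 2 + y 3 ^ 2) ^ 2 / 4)] := by
  have h : 1 + y 2 ^ 2 + y 3 ^ 2 ≠ 0 := by positivity
  rw [invMet, c.met_vv_scri y hy, c.met_v2_scri y hy, c.met_v3_scri y hy, c.met_22_scri y hy,
    c.met_33_scri y hy, c.met_23_scri y hy]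
  ext i j
  fin_cases i <;> fin_cases j <;> simp
  all_goals field_simp

theorem vanishTo_of_scri {f : Coord → ℝ} (hf : ContDiffOn ℝ ∞ f D)
    (h : ∀ y : Coord, y 1 = 0 → f y = 0) : VanishTo D 1 f :=
  (Lead.of_smooth_zero hf h).raise c.nbhd fun _ _ => rfl

theorem vanishTo_invMet {i j : Fin 4} (hij : (i, j) = (1, 1) ∨ (i, j) = (1, 2) ∨ (i, j) = (1, 3)) :
    VanishTo D 1 fun y => invMet g y i j := by
  refine c.vanishTo_of_scri (c.smooth_inv i j) fun y hy => ?_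
  rw [c.invMet_scri hy]
  rcases hij with h | h | h <;> (simp only [Prod.mk.injEq] at h; obtain ⟨rfl, rfl⟩ := h; simp)

theorem vanishTo_chr (a b e : Fin 4) : VanishTo D 0 (chr g a b e) :=
  VanishTo.of_smooth (c.smooth_chr a b e)

/-- `∂_r g_{vI} = 0` at `r = 0`. -/
theorem vanishTo_met_v {i : Fin 4} (hi : i = 2 ∨ i = 3) : VanishTo D 2 fun y => g y 0 i := by
  have hO := c.nbhd.isOpen
  have i1 : i ≠ 1 := by rcases hi with rfl | rfl <;> decide
  have i0 : i ≠ 0 := by rcases hi with rfl | rfl <;> decide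
  have h0 : ∀ y : Coord, y 1 = 0 → g y 0 i = 0 := by
    rcases hi with rfl | rfl
    exacts [c.met_v2_scri, c.met_v3_scri]
  have hI := c.vanishTo_pd_conf i1
  -- In the rI component of the Einstein equations every term except Γ^r_{rI} ∂_r Ω is already O(r),
  -- and Γ^r_{rI} is half of ∂_r ĝ_{vI} up to O(r).
  have e1 : VanishTo D 1 fun y => pd 1 Ω y * chr g 1 1 i y := by
    refine (((((hI.pd_one c.nbhd).mono (l := 1) (by norm_num)).sub
      ((((c.vanishTo_chr 2 1 i).mul_zero_left (c.vanishTo_pd_conf (i := 2) (by decide))).add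
      ((c.vanishTo_chr 3 1 i).mul_zero_left (c.vanishTo_pd_conf (i := 3) (by decide)))).mono
        (l := 1) (by norm_num))).sub
      ((c.vanishTo_ricci_em 1 i).const_mul (1 / 2)))).congr fun y hy hr => ?_
    have h := c.einstein_conformal ⟨hy, hr⟩ 1 i
    have hΩ := (c.conf_pos y hy hr).ne'
    simp only [c.christoffel_eq_chr ⟨hy, hr⟩, Fin.sum_univ_four (fun d => chr g d 1 i y * pd d Ω y),
      c.chr_zero_one ⟨hy, hr⟩, c.met_r y hy hr i, if_neg i0] at h
    simp only [zero_mul, zero_add, add_zero] at h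
    field_simp at h
    linear_combination (-1 / 2) * h
  have e2 : VanishTo D 1 (chr g 1 1 i) := by
    refine (e1.sub ((c.vanishTo_chr 1 1 i).mul_zero_left
      ((c.vanishTo_conf_sub.pd_one c.nbhd).mono (l := 1) (by norm_num)))).congr ?_
    intro y hy _
    rw [pd_sub (c.smooth_conf.diffAt hO hy) (by fun_prop), pd_coord]
    simp
    ring
  have e3 : VanishTo D 1 (pd 1 fun y => g y 0 i) := by
    refine ((e2.const_mul 2).sub (((c.vanishTo_invMet (i := 1) (j := 2) (by simp)).mul_zero_right
      (VanishTo.of_smooth ((c.smooth_met 2 i).pderiv hO 1))).add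
      ((c.vanishTo_invMet (i := 1) (j := 3) (by simp)).mul_zero_right
      (VanishTo.of_smooth ((c.smooth_met 3 i).pderiv hO 1))))).congr fun y hy hr => ?_
    simp only [chr, Fin.sum_univ_four, christoffelFirst, c.pd_met_r ⟨hy, hr⟩,
      c.pd_met_r' ⟨hy, hr⟩]
    simp [invMet]
    ring
  obtain ⟨w, hw⟩ := e3
  exact ((Lead.of_smooth_zero (c.smooth_met 0 i) h0).integrate c.nbhd hw).vanishTo

end ChartData

end Electrovac

end

/-! ### The unphysical curvature at r = 0. -/

noncomputable section
open scoped Manifold ContDiff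
open Set Filter Topology
namespace Electrovac

theorem pd_stereo (i : Fin 4) (y : Coord) : pd i (fun z : Coord => 1 + z 2 ^ 2 + z 3 ^ 2) y
    = (if i = 2 then 2 * y 2 else 0) + if i = 3 then 2 * y 3 else 0 := by
  rw [pd_add (by fun_prop) (by fun_prop), pd_add (by fun_prop) (by fun_prop), pd_const,
    pd_pow (by fun_prop), pd_pow (by fun_prop), pd_coord, pd_coord]
  fin_cases i <;> simp

theorem pd_coord_div_stereo (a : ℝ) (i j : Fin 4) (y : Coord) :
    pd i (fun z : Coord => a * z j * (1 + z 2 ^ 2 + z 3 ^ 2)⁻¹) y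
    = (if j = i then a else 0) / (1 + y 2 ^ 2 + y 3 ^ 2)
      - a * y j * ((if i = 2 then 2 * y 2 else 0) + if i = 3 then 2 * y 3 else 0)
        / (1 + y 2 ^ 2 + y 3 ^ 2) ^ 2 := by
  have h : 1 + y 2 ^ 2 + y 3 ^ 2 ≠ 0 := by positivity
  have d : DifferentiableAt ℝ (fun z : Coord => 1 + z 2 ^ 2 + z 3 ^ 2) y := by fun_prop
  have d2 : DifferentiableAt ℝ (fun z : Coord => (1 + z 2 ^ 2 + z 3 ^ 2)⁻¹) y := d.inv h
  rw [pd_mul (by fun_prop) d2, pd_mul (by fun_prop) (by fun_prop), pd_inv d h, pd_stereo,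
    pd_const, pd_coord]
  split_ifs <;> ring

theorem pd_round (i : Fin 4) (y : Coord) :
    pd i (fun z : Coord => -(4 / (1 + z 2 ^ 2 + z 3 ^ 2) ^ 2)) y
    = 8 * ((if i = 2 then 2 * y 2 else 0) + if i = 3 then 2 * y 3 else 0)
      / (1 + y 2 ^ 2 + y 3 ^ 2) ^ 3 := by
  have h : 1 + y 2 ^ 2 + y 3 ^ 2 ≠ 0 := by positivity
  have d : DifferentiableAt ℝ (fun z : Coord => 1 + z 2 ^ 2 + z 3 ^ 2) y := by fun_prop
  have d3 : DifferentiableAt ℝ (fun z : Coord => (1 + z 2 ^ 2 + z 3 ^ 2) ^ 2) y := by fun_prop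
  have d2 : DifferentiableAt ℝ (fun z : Coord => ((1 + z 2 ^ 2 + z 3 ^ 2) ^ 2)⁻¹) y :=
    d3.inv (pow_ne_zero 2 h)
  simp only [div_eq_mul_inv]
  rw [pd_neg, pd_mul (by fun_prop) d2, pd_const, pd_inv d3 (pow_ne_zero 2 h), pd_pow d, pd_stereo]
  field_simp
  norm_num
  ring

namespace ChartData

variable {D : Set Coord} {k : ℝ} {Ω : Coord → ℝ} {g F : Coord → Matrix (Fin 4) (Fin 4) ℝ}
  (c : ChartData D k Ω g F)

include c

theorem scri_eq_zero {f : Coord → ℝ} (hf : ContDiffOn ℝ ∞ f D) (h : VanishTo D 1 f) {y : Coord}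
    (hy : y 1 = 0) : f y = 0 :=
  (Lead.of_smooth hf).unique c.nbhd (h.lead one_pos) hy

theorem pd_scri {f v : Coord → ℝ} (hf : ContDiffOn ℝ ∞ f D)
    (h : ∀ y : Coord, y 1 = 0 → f y = v y) {i : Fin 4} (hi : i ≠ 1) {y : Coord} (hy : y 1 = 0)
    (hv : DifferentiableAt ℝ v y) : pd i f y = pd i v y := by
  rw [← tpd_eq_pd (hf.diffAt c.nbhd.isOpen (c.nbhd.scri_mem y hy)), ← tpd_eq_pd hv]
  exact tpd_congr hi h hy

theorem vanishTo_met_vv : VanishTo D 2 fun y => g y 0 0 := by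
  obtain ⟨w, hw⟩ := c.vanishTo_of_scri ((c.smooth_met 0 0).pderiv c.nbhd.isOpen 1)
    c.met_vv_deriv_scri
  exact ((Lead.of_smooth_zero (c.smooth_met 0 0) c.met_vv_scri).integrate c.nbhd hw).vanishTo

theorem vanishTo_met {i : Fin 4} (hi : i ≠ 1) : VanishTo D 2 fun y => g y 0 i := by
  fin_cases i
  exacts [c.vanishTo_met_vv, absurd rfl hi, c.vanishTo_met_v (Or.inl rfl),
    c.vanishTo_met_v (Or.inr rfl)]

theorem vanishTo_pd_met (a i : Fin 4) : VanishTo D 1 (pd a fun y => g y 0 i) := by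
  by_cases hi : i = 1
  · subst hi
    exact (VanishTo.zero D 1).congr fun y hy h0 => c.pd_met_r' ⟨hy, h0⟩ a 0
  by_cases ha : a = 1
  · subst ha
    exact (c.vanishTo_met hi).pd_one c.nbhd
  · exact ((c.vanishTo_met hi).pd_tan c.nbhd ha).mono (by norm_num)

section Scri

variable {y : Coord} (hy : y 1 = 0)

include hy

theorem pd_met_zero_scri (a i : Fin 4) : pd a (fun z => g z 0 i) y = 0 :=
  c.scri_eq_zero ((c.smooth_met 0 i).pderiv c.nbhd.isOpen a) (c.vanishTo_pd_met a i) hy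

theorem pd_met_zero_scri' (a i : Fin 4) : pd a (fun z => g z i 0) y = 0 := by
  rw [← c.pd_met_zero_scri hy a i]
  exact c.scri_eq ((c.smooth_met i 0).pderiv c.nbhd.isOpen a)
    ((c.smooth_met 0 i).pderiv c.nbhd.isOpen a) (fun z hz => c.metricOn.pd_symm hz a i 0) hy

theorem dv_met_scri (i j : Fin 4) : pd 0 (fun z => g z i j) y = 0 :=
  c.scri_eq ((c.smooth_met i j).pderiv c.nbhd.isOpen 0) contDiffOn_const
    (fun _ hz => c.dv_met _ hz.1 hz.2 i j) hy

omit hy c in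
theorem differentiable_round :
    Differentiable ℝ (fun z : Coord => -(4 / (1 + z 2 ^ 2 + z 3 ^ 2) ^ 2)) := by
  intro z
  have h : 1 + z 2 ^ 2 + z 3 ^ 2 ≠ 0 := by positivity
  fun_prop (disch := positivity)

theorem pd_met_22_scri {i : Fin 4} (hi : i ≠ 1) : pd i (fun z => g z 2 2) y
    = 8 * ((if i = 2 then 2 * y 2 else 0) + if i = 3 then 2 * y 3 else 0)
      / (1 + y 2 ^ 2 + y 3 ^ 2) ^ 3 := by
  rw [c.pd_scri (c.smooth_met 2 2) c.met_22_scri hi hy (differentiable_round y), pd_round]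

theorem pd_met_33_scri {i : Fin 4} (hi : i ≠ 1) : pd i (fun z => g z 3 3) y
    = 8 * ((if i = 2 then 2 * y 2 else 0) + if i = 3 then 2 * y 3 else 0)
      / (1 + y 2 ^ 2 + y 3 ^ 2) ^ 3 := by
  rw [c.pd_scri (c.smooth_met 3 3) c.met_33_scri hi hy (differentiable_round y), pd_round]

theorem pd_met_23_scri {i : Fin 4} (hi : i ≠ 1) : pd i (fun z => g z 2 3) y = 0 := by
  rw [c.pd_scri (c.smooth_met 2 3) (v := fun _ => 0) c.met_23_scri hi hy (by fun_prop), pd_const]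

theorem pd_met_32_scri {i : Fin 4} (hi : i ≠ 1) : pd i (fun z => g z 3 2) y = 0 := by
  rw [c.pd_scri (c.smooth_met 3 2) (v := fun _ => 0)
    (fun y hy => by rw [c.symm_scri hy, c.met_23_scri y hy]) hi hy (by fun_prop), pd_const]

theorem chr_one_scri (b e : Fin 4) : chr g 1 b e y = 0 := by
  simp [chr, Fin.sum_univ_four, christoffelFirst, c.invMet_scri hy, c.pd_met_zero_scri hy,
    c.dv_met_scri hy]

theorem chr_zero_scri (a b : Fin 4) : chr g a 0 b y = 0 := by
  simp [chr, christoffelFirst, c.pd_met_zero_scri hy, c.pd_met_zero_scri' hy,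
    c.dv_met_scri hy]

theorem chr_zero_scri' (a b : Fin 4) : chr g a b 0 y = 0 := by
  simp [chr, christoffelFirst, c.pd_met_zero_scri' hy,
    c.dv_met_scri hy]

theorem chr_222_scri : chr g 2 2 2 y = -2 * y 2 * (1 + y 2 ^ 2 + y 3 ^ 2)⁻¹ := by
  have h : 1 + y 2 ^ 2 + y 3 ^ 2 ≠ 0 := by positivity
  simp [chr, Fin.sum_univ_four, christoffelFirst, c.invMet_scri hy, c.pd_met_22_scri hy]
  field_simp
  ring

theorem chr_322_scri : chr g 3 2 2 y = 2 * y 3 * (1 + y 2 ^ 2 + y 3 ^ 2)⁻¹ := by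
  have h : 1 + y 2 ^ 2 + y 3 ^ 2 ≠ 0 := by positivity
  simp [chr, Fin.sum_univ_four, christoffelFirst, c.invMet_scri hy, c.pd_met_22_scri hy,
    c.pd_met_32_scri hy]
  field_simp
  ring

theorem chr_223_scri : chr g 2 2 3 y = -2 * y 3 * (1 + y 2 ^ 2 + y 3 ^ 2)⁻¹ := by
  have h : 1 + y 2 ^ 2 + y 3 ^ 2 ≠ 0 := by positivity
  simp [chr, Fin.sum_univ_four, christoffelFirst, c.invMet_scri hy, c.pd_met_22_scri hy,
    c.pd_met_23_scri hy]
  field_simp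
  ring

theorem chr_323_scri : chr g 3 2 3 y = -2 * y 2 * (1 + y 2 ^ 2 + y 3 ^ 2)⁻¹ := by
  have h : 1 + y 2 ^ 2 + y 3 ^ 2 ≠ 0 := by positivity
  simp [chr, Fin.sum_univ_four, christoffelFirst, c.invMet_scri hy, c.pd_met_33_scri hy,
    c.pd_met_23_scri hy, c.pd_met_32_scri hy]
  field_simp
  ring

theorem chr_332_scri : chr g 3 3 2 y = -2 * y 2 * (1 + y 2 ^ 2 + y 3 ^ 2)⁻¹ := by
  have h : 1 + y 2 ^ 2 + y 3 ^ 2 ≠ 0 := by positivity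
  simp [chr, Fin.sum_univ_four, christoffelFirst, c.invMet_scri hy, c.pd_met_33_scri hy,
    c.pd_met_23_scri hy, c.pd_met_32_scri hy]
  field_simp
  ring

theorem chr_333_scri : chr g 3 3 3 y = -2 * y 3 * (1 + y 2 ^ 2 + y 3 ^ 2)⁻¹ := by
  have h : 1 + y 2 ^ 2 + y 3 ^ 2 ≠ 0 := by positivity
  simp [chr, Fin.sum_univ_four, christoffelFirst, c.invMet_scri hy, c.pd_met_33_scri hy]
  field_simp
  ring

end Scri

theorem vanishTo_invMet_two {i : Fin 4} (hi : i = 2 ∨ i = 3) :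
    VanishTo D 2 (fun y => invMet g y 1 i) ∧ VanishTo D 2 (fun y => invMet g y i 1) := by
  have s := c.smooth_met
  have hd : ContDiffOn ℝ ∞ (fun y => (g y 2 2 * g y 3 3 - g y 2 3 ^ 2)⁻¹) D :=
    (((s 2 2).mul (s 3 3)).sub ((s 2 3).pow 2)).inv fun y hy => (c.det_pos y hy).ne'
  have v := fun i j => VanishTo.of_smooth (s i j)
  have m2 := c.vanishTo_met (i := 2) (by decide)
  have m3 := c.vanishTo_met (i := 3) (by decide)
  have h2 := ((((v 3 3).mul_zero_left m2).sub ((v 2 3).mul_zero_left m3)).neg).mul_zero_right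
    (VanishTo.of_smooth hd)
  have h3 := ((((v 2 2).mul_zero_left m3).sub ((v 2 3).mul_zero_left m2)).neg).mul_zero_right
    (VanishTo.of_smooth hd)
  rcases hi with rfl | rfl
  · exact ⟨h2.congr fun y _ _ => div_eq_mul_inv _ _, h2.congr fun y _ _ => div_eq_mul_inv _ _⟩
  · exact ⟨h3.congr fun y _ _ => div_eq_mul_inv _ _, h3.congr fun y _ _ => div_eq_mul_inv _ _⟩

/-- Stationarity removes the term -½ ∂_v ĝ_{22}; what remains contains ĝ^{rr}, ĝ^{rI} or a
tangential derivative of ĝ_{v2}, all O(r²). -/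
theorem vanishTo_chr_122 : VanishTo D 2 (chr g 1 2 2) := by
  have hO := c.nbhd.isOpen
  have v (d : Fin 4) : VanishTo D 0 (christoffelFirst g d 2 2) :=
    VanishTo.of_smooth (contDiffOn_const.mul ((((c.smooth_met d 2).pderiv hO 2).add
      ((c.smooth_met d 2).pderiv hO 2)).sub ((c.smooth_met 2 2).pderiv hO d)))
  have h11 : VanishTo D 2 fun y => invMet g y 1 1 :=
    c.vanishTo_met_vv.neg.sub
      (((c.vanishTo_invMet_two (Or.inl rfl)).1.mul_zero_right (VanishTo.of_smooth (c.smooth_met 0 2))).add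
      ((c.vanishTo_invMet_two (Or.inr rfl)).1.mul_zero_right (VanishTo.of_smooth (c.smooth_met 0 3))))
  refine ((((c.vanishTo_met (i := 2) (by decide)).pd_tan c.nbhd (i := 2) (by decide)).add
    (h11.mul_zero_right (v 1))).add
    (((c.vanishTo_invMet_two (Or.inl rfl)).1.mul_zero_right (v 2)).add
    ((c.vanishTo_invMet_two (Or.inr rfl)).1.mul_zero_right (v 3)))).congr fun y hy h0 => ?_
  have e : christoffelFirst g 0 2 2 y = pd 2 (fun z => g z 0 2) y := by
    rw [christoffelFirst, c.dv_met y hy h0]; ring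
  have e2 : invMet g y 1 0 = 1 := rfl
  rw [chr, Fin.sum_univ_four, e, e2]
  ring

/-- The contributions of the v and r directions vanish at r = 0, leaving the Ricci tensor of the
unit sphere, which equals its metric. -/
theorem lead_ricci_22 :
    Lead D 0 (ricci g 2 2) fun y => 4 / (1 + y 2 ^ 2 + y 3 ^ 2) ^ 2 := by
  have hO := c.nbhd.isOpen
  have s := c.smooth_chr
  have hs : ContDiffOn ℝ ∞ (fun y => ∑ a, (pd a (chr g a 2 2) y - pd 2 (chr g a 2 a) y
      + ∑ d, (chr g a a d y * chr g d 2 2 y - chr g a 2 d y * chr g d 2 a y))) D :=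
    ContDiffOn.sum fun a _ => (((s a 2 2).pderiv hO a).sub ((s a 2 a).pderiv hO 2)).add
    (ContDiffOn.sum fun d _ => ((s a a d).mul (s d 2 2)).sub ((s a 2 d).mul (s d 2 a)))
  refine ((Lead.of_smooth hs).congr fun y hy h0 => c.ricci_eq_chr ⟨hy, h0⟩ 2 2).congr_lead ?_
  intro y hy
  have h : 1 + y 2 ^ 2 + y 3 ^ 2 ≠ 0 := by positivity
  have p0 : pd 0 (chr g 0 2 2) y = 0 :=
    c.scri_eq ((s 0 2 2).pderiv hO 0) contDiffOn_const (fun z hz => by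
      rw [← pd_congr_of_isOpen c.nbhd.isOpen_pos (fun w hw => c.christoffel_eq_chr hw 0 2 2) hz]
      exact (c.metricOn.stat_christoffel c.stat_met c.stat_inv 0 2 2).2 z hz) hy
  have p1 : pd 1 (chr g 1 2 2) y = 0 :=
    c.scri_eq_zero ((s 1 2 2).pderiv hO 1) (c.vanishTo_chr_122.pd_one c.nbhd) hy
  have q0 : pd 2 (chr g 0 2 0) y = 0 := by
    rw [c.pd_scri (s 0 2 0) (v := fun _ => 0) (fun y hy => c.chr_zero_scri' hy 0 2) (by decide) hy
      (by fun_prop), pd_const]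
  have q1 : pd 2 (chr g 1 2 1) y = 0 := by
    rw [c.pd_scri (s 1 2 1) (v := fun _ => 0) (fun y hy => c.chr_one_scri hy 2 1) (by decide) hy
      (by fun_prop), pd_const]
  have dv (a : ℝ) (j : Fin 4) :
      DifferentiableAt ℝ (fun z : Coord => a * z j * (1 + z 2 ^ 2 + z 3 ^ 2)⁻¹) y := by
    fun_prop (disch := positivity)
  have q3 : pd 2 (chr g 3 2 3) y = -2 / (1 + y 2 ^ 2 + y 3 ^ 2)
      + 4 * y 2 ^ 2 / (1 + y 2 ^ 2 + y 3 ^ 2) ^ 2 := by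
    rw [c.pd_scri (s 3 2 3) (fun y hy => c.chr_323_scri hy) (by decide) hy (dv (-2) 2),
      pd_coord_div_stereo]
    simp
    ring
  have p3 : pd 3 (chr g 3 2 2) y = 2 / (1 + y 2 ^ 2 + y 3 ^ 2)
      - 4 * y 3 ^ 2 / (1 + y 2 ^ 2 + y 3 ^ 2) ^ 2 := by
    rw [c.pd_scri (s 3 2 2) (fun y hy => c.chr_322_scri hy) (by decide) hy (dv 2 3),
      pd_coord_div_stereo]
    simp
    ring
  simp only [Fin.sum_univ_four, p0, p1, q0, q1, q3, p3, c.chr_zero_scri hy, c.chr_zero_scri' hy,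
    c.chr_one_scri hy, c.chr_222_scri hy, c.chr_322_scri hy, c.chr_223_scri hy,
    c.chr_323_scri hy, c.chr_332_scri hy, c.chr_333_scri hy]
  field_simp
  ring

end ChartData

end Electrovac

end

/-! ### The expansion of ĝ_{vv} and the absence of incoming radiation. -/

noncomputable section
open scoped Manifold ContDiff
open Set Filter Topology
namespace Electrovac
namespace ChartData

variable {D : Set Coord} {k : ℝ} {Ω : Coord → ℝ} {g F : Coord → Matrix (Fin 4) (Fin 4) ℝ}
  (c : ChartData D k Ω g F)

/-- The gradient of `log Ω` with respect to the unphysical metric. -/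
def gradLog (g : Coord → Matrix (Fin 4) (Fin 4) ℝ) (Ω : Coord → ℝ) (a : Fin 4) (y : Coord) : ℝ :=
  ∑ d, invMet g y a d * (pd d Ω y / Ω y)

include c

theorem dv_gradLog {y : Coord} (hy : y ∈ D ∩ {y | 0 < y 1}) (a : Fin 4) :
    pd 0 (gradLog g Ω a) y = 0 := by
  have hU := c.nbhd.isOpen_pos
  exact (Stat.sum hU Finset.univ fun d => (c.stat_inv a d).mul hU
    ((c.stat_conf.pd hU d).div hU c.stat_conf fun y hy => c.conf_ne hy)).2 y hy

theorem lead_invMet_rr {n : Coord → ℝ} (hn : Lead D 2 (fun y => g y 0 0) n) :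
    Lead D 2 (fun y => invMet g y 1 1) fun y => - n y := by
  have h2 := (c.vanishTo_invMet_two (Or.inl rfl)).1.mul (c.vanishTo_met (i := 2) (by decide))
  have h3 := (c.vanishTo_invMet_two (Or.inr rfl)).1.mul (c.vanishTo_met (i := 3) (by decide))
  exact (hn.neg.sub ((h2.add h3).lead (by norm_num))).congr_lead fun y _ => by ring

theorem vanishTo_pd_log {i : Fin 4} (hi : i ≠ 1) : VanishTo D 2 fun y => pd i Ω y / Ω y :=
  (c.vanishTo_pd_conf hi).elim fun _ h => (c.lead_div h).vanishTo

theorem lead_gradLog_one {n : Coord → ℝ} (hn : Lead D 2 (fun y => g y 0 0) n) :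
    Lead D 1 (gradLog g Ω 1) fun y => - n y := by
  have h1 := c.lead_div (n := 1) ((c.lead_invMet_rr hn).mul c.lead_pd_one_conf)
  have h2 := (VanishTo.of_smooth (c.smooth_inv 1 2)).mul (c.vanishTo_pd_log (i := 2) (by decide))
  have h3 := (VanishTo.of_smooth (c.smooth_inv 1 3)).mul (c.vanishTo_pd_log (i := 3) (by decide))
  refine ((h1.add ((h2.add h3).lead (l := 1) (by norm_num))).congr fun y hy h0 => ?_).congr_lead
    fun y _ => by ring
  rw [gradLog, Fin.sum_univ_four, c.dv_conf y hy h0]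
  ring

theorem vanishTo_gradLog {i : Fin 4} (hi : i = 2 ∨ i = 3) : VanishTo D 1 (gradLog g Ω i) := by
  have h1 : VanishTo D 1 fun y => invMet g y i 1 * pd 1 Ω y / Ω y :=
    ((c.vanishTo_invMet_two hi).2.mul c.lead_pd_one_conf.vanishTo).elim
      fun _ h => (c.lead_div (n := 1) h).vanishTo
  have h2 := (VanishTo.of_smooth (c.smooth_inv i 2)).mul (c.vanishTo_pd_log (i := 2) (by decide))
  have h3 := (VanishTo.of_smooth (c.smooth_inv i 3)).mul (c.vanishTo_pd_log (i := 3) (by decide))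
  refine (h1.add ((h2.add h3).mono (l := 1) (by norm_num))).congr fun y hy h0 => ?_
  rw [gradLog, Fin.sum_univ_four, c.dv_conf y hy h0]
  ring

theorem trace_christoffel_zero {y : Coord} (hy : y ∈ D ∩ {y | 0 < y 1}) :
    ∑ a, christoffel g a a 0 y = 0 := by
  simp [c.metricOn.trace_christoffel hy, c.dv_met y hy.1 hy.2]

theorem vanishTo_trace_christoffel (i : Fin 4) :
    VanishTo D 0 fun y => ∑ a, christoffel g a a i y :=
  (VanishTo.sum Finset.univ fun a _ => c.vanishTo_chr a a i).congr fun _ hy h0 =>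
    Finset.sum_congr rfl fun a _ => c.christoffel_eq_chr ⟨hy, h0⟩ a a i

/-- If ĝ_{vv} = n r² + ..., then ĝ^{rr} = -n r² + ... and the r component of grad log Ω is -n r +
.... The divergence contributes -n and the quadratic term 2n. -/
theorem lead_gauge {n : Coord → ℝ} (hn : Lead D 2 (fun y => g y 0 0) n) :
    Lead D 0 (fun y => ∑ a, pd a (gradLog g Ω a) y
        + ∑ d, (∑ a, christoffel g a a d y) * gradLog g Ω d y
        - 2 * ∑ d, pd d Ω y / Ω y * gradLog g Ω d y) n := by
  have hD := c.nbhd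
  have u1 := c.lead_gradLog_one hn
  have u2 := c.vanishTo_gradLog (i := 2) (Or.inl rfl)
  have u3 := c.vanishTo_gradLog (i := 3) (Or.inr rfl)
  have t := c.vanishTo_trace_christoffel
  have a1 := (u1.pd_one (k := 0) hD).add
    (((u2.pd_tan hD (i := 2) (by decide)).add (u3.pd_tan hD (i := 3) (by decide))).lead one_pos)
  have a2 := (((t 1).mul u1.vanishTo).add (((t 2).mul u2).add ((t 3).mul u3))).lead
    (l := 0) (by norm_num)
  have a3 := (c.lead_div (n := 0) (c.lead_pd_one_conf.mul u1)).add
    ((((c.vanishTo_pd_log (i := 2) (by decide)).mul u2).add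
    ((c.vanishTo_pd_log (i := 3) (by decide)).mul u3)).lead (l := 0) (by norm_num))
  refine (((a1.add a2).sub (a3.const_mul 2)).congr fun y hy h0 => ?_).congr_lead fun y _ => ?_
  · rw [Fin.sum_univ_four (fun a => pd a (gradLog g Ω a) y),
      Fin.sum_univ_four (fun d => (∑ a, christoffel g a a d y) * gradLog g Ω d y),
      Fin.sum_univ_four (fun d => pd d Ω y / Ω y * gradLog g Ω d y), c.dv_gradLog ⟨hy, h0⟩,
      c.trace_christoffel_zero ⟨hy, h0⟩, c.dv_conf y hy h0]
    ring
  · push_cast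
    ring

/-- `g_{vv} = r ^ 2 + O(r ^ 3)`. -/
theorem lead_met_vv : Lead D 2 (fun y => g y 0 0) fun _ => 1 := by
  obtain ⟨n, hn⟩ := c.vanishTo_met_vv
  refine hn.congr_lead fun y hy => ?_
  have hD := c.nbhd
  have e1 : VanishTo D 2 fun y =>
      pd 2 (pd 2 Ω) y - ∑ d, christoffel g d 2 2 y * pd d Ω y := by
    refine (((c.vanishTo_pd_conf (i := 2) (by decide)).pd_tan hD (i := 2) (by decide)).mono
      (l := 2) (by norm_num) |>.sub
      ((c.vanishTo_chr_122.mul_zero_right c.lead_pd_one_conf.vanishTo).add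
      (((c.vanishTo_chr 2 2 2).mul_zero_left (c.vanishTo_pd_conf (i := 2) (by decide))).add
      ((c.vanishTo_chr 3 2 2).mul_zero_left (c.vanishTo_pd_conf (i := 3) (by decide))) |>.mono
        (l := 2) (by norm_num)))).congr fun y hy h0 => ?_
    simp only [c.christoffel_eq_chr ⟨hy, h0⟩]
    rw [Fin.sum_univ_four, c.dv_conf y hy h0]
    ring
  obtain ⟨w, hw⟩ := e1
  have e2 := ((c.lead_div (n := 1) hw).of_le one_pos).const_mul 2
  have e3 := (c.lead_ricci_22.add e2).add
    ((Lead.of_smooth (c.smooth_met 2 2)).mul (c.lead_gauge hn))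
  have e4 := (((c.lead_conf.pow 2).vanishTo.mul_zero_right
    (c.lead_emTensor 2 2).vanishTo).const_mul (2 * k)).lead (l := 0) (by norm_num)
  -- At r = 0 the 22 component reads s - n s = 0, where s = 4/(1+|z|²)² is the 22 component of the
  -- round metric.
  have h := e3.unique hD (e4.congr fun y hy h0 => c.einstein_conformal ⟨hy, h0⟩ 2 2) hy
  simp only [c.met_22_scri y hy] at h
  have h1 : 1 + y 2 ^ 2 + y 3 ^ 2 ≠ 0 := by positivity
  field_simp at h
  linarith

end ChartData

namespace ChartData

variable {D : Set Coord} {k : ℝ} {Ω : Coord → ℝ} {g F : Coord → Matrix (Fin 4) (Fin 4) ℝ}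
  (c : ChartData D k Ω g F)

/-- The physical metric. -/
def physMet (Ω : Coord → ℝ) (g : Coord → Matrix (Fin 4) (Fin 4) ℝ) (y : Coord) :
    Matrix (Fin 4) (Fin 4) ℝ := (Ω y ^ 2)⁻¹ • g y

include c

theorem metricOn_phys :
    MetricOn (D ∩ {y | 0 < y 1}) (physMet Ω g) (fun y => Ω y ^ 2 • invMet g y) :=
  c.metricOn.conformal c.stat_conf.1 fun _ hy => c.conf_ne hy

theorem stat_phys (i j : Fin 4) : Stat (D ∩ {y | 0 < y 1}) fun y => physMet Ω g y i j := by
  have hU := c.nbhd.isOpen_pos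
  have h2 : Stat (D ∩ {y | 0 < y 1}) fun y => Ω y ^ 2 := by
    simpa only [sq] using c.stat_conf.mul hU c.stat_conf
  exact (h2.inv hU fun y hy => pow_ne_zero 2 (c.conf_ne hy)).mul hU (c.stat_met i j)

theorem stat_phys_inv (i j : Fin 4) :
    Stat (D ∩ {y | 0 < y 1}) fun y => (Ω y ^ 2 • invMet g y) i j := by
  have hU := c.nbhd.isOpen_pos
  have h2 : Stat (D ∩ {y | 0 < y 1}) fun y => Ω y ^ 2 := by
    simpa only [sq] using c.stat_conf.mul hU c.stat_conf
  exact h2.mul hU (c.stat_inv i j)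

theorem lead_div_sq {n : ℕ} {f u : Coord → ℝ} (hf : Lead D (n + 2) f u) :
    Lead D n (fun y => (Ω y ^ 2)⁻¹ * f y) u := by
  refine (c.lead_div (c.lead_div hf)).congr fun y hy h0 => ?_
  have := (c.conf_pos y hy h0).ne'
  field_simp

/-- The excluded derivative is ∂_r of Ω^{-2}, which is singular. In ∂_i Ω^{-2} with i ≠ r the factor
∂_i Ω = O(r³) compensates Ω^{-3}. -/
theorem vanishTo_pd_phys (i a : Fin 4) (h : ¬ (i = 1 ∧ a = 1)) :
    VanishTo D 0 (pd i fun y => physMet Ω g y 0 a) := by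
  by_cases i0 : i = 0
  · subst i0
    exact (VanishTo.zero D 0).congr fun y hy h0 => (c.stat_phys 0 a).2 y ⟨hy, h0⟩
  by_cases ha : a = 1
  · subst ha
    have hi : i ≠ 1 := fun hi => h ⟨hi, rfl⟩
    obtain ⟨w, hw⟩ := c.vanishTo_pd_conf hi
    refine ((c.lead_div (n := 0) (c.lead_div_sq (n := 1) hw)).vanishTo.const_mul (-2)).congr ?_
    intro y hy h0
    have hΩ := (c.conf_pos y hy h0).ne'
    have dΩ := c.smooth_conf.diffAt c.nbhd.isOpen hy
    have e : ∀ z ∈ D ∩ {y | 0 < y 1}, physMet Ω g z 0 1 = (Ω z ^ 2)⁻¹ := fun z hz => by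
      simp [physMet, c.symm z hz.1 hz.2 0 1, c.met_r z hz.1 hz.2]
    rw [pd_congr_of_isOpen c.nbhd.isOpen_pos e ⟨hy, h0⟩, pd_inv (dΩ.fun_pow 2) (pow_ne_zero 2 hΩ),
      pd_pow dΩ]
    field_simp
    norm_num
    ring
  · obtain ⟨w, hw⟩ := c.vanishTo_met ha
    exact (c.lead_div_sq (n := 0) hw).vanishTo.pd_zero c.nbhd i

theorem vanishTo_pd_phys_zero {i : Fin 4} (hi : i ≠ 1) :
    VanishTo D 1 (pd i fun y => physMet Ω g y 0 0) :=
  (((c.lead_div_sq (n := 0) c.lead_met_vv).pd_tan c.nbhd hi).congr_lead (c' := fun _ => 0)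
    fun y _ => by simp).raise c.nbhd fun _ _ => rfl

/-- Up to a factor this is the exterior derivative of the 1-form dual to the Killing vector. Its
antisymmetry eliminates the one singular derivative of `vanishTo_pd_phys`. -/
theorem christoffelFirst_phys {y : Coord} (hy : y ∈ D ∩ {y | 0 < y 1}) (e d : Fin 4) :
    christoffelFirst (physMet Ω g) e 0 d y = (1 / 2) * (pd d (fun z => physMet Ω g z 0 e) y
      - pd e (fun z => physMet Ω g z 0 d) y) := by
  rw [christoffelFirst, (c.stat_phys e d).2 y hy, c.metricOn_phys.pd_symm hy d e 0]
  ring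

theorem vanishTo_christoffelFirst_phys (e d : Fin 4) :
    VanishTo D 0 (christoffelFirst (physMet Ω g) e 0 d) := by
  by_cases h : e = d
  · subst h
    refine (VanishTo.zero D 0).congr fun y hy h0 => ?_
    rw [c.christoffelFirst_phys ⟨hy, h0⟩]
    ring
  · exact (((c.vanishTo_pd_phys d e fun h' => h (h'.2.trans h'.1.symm)).sub
      (c.vanishTo_pd_phys e d fun h' => h (h'.1.trans h'.2.symm))).const_mul (1 / 2)).congr
        fun y hy h0 => c.christoffelFirst_phys ⟨hy, h0⟩ e d

theorem vanishTo_christoffel_phys (a d : Fin 4) :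
    VanishTo D 2 (christoffel (physMet Ω g) a 0 d) := by
  refine ((c.lead_conf.pow 2).vanishTo.mul_zero_right (VanishTo.sum Finset.univ fun e _ =>
    (VanishTo.of_smooth (c.smooth_inv a e)).mul (c.vanishTo_christoffelFirst_phys e d))).congr
    fun y hy h0 => ?_
  rw [c.metricOn_phys.christoffel_eq ⟨hy, h0⟩, Finset.mul_sum]
  exact Finset.sum_congr rfl fun e _ => by simp only [Matrix.smul_apply, smul_eq_mul]; ring

/-- The acceleration of the Killing vector. -/
theorem christoffel_phys_zero {y : Coord} (hy : y ∈ D ∩ {y | 0 < y 1}) (a : Fin 4) :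
    christoffel (physMet Ω g) a 0 0 y = (-1 / 2) * (Ω y ^ 2 * (invMet g y a 1 *
      pd 1 (fun z => physMet Ω g z 0 0) y + (invMet g y a 2 * pd 2 (fun z => physMet Ω g z 0 0) y
        + invMet g y a 3 * pd 3 (fun z => physMet Ω g z 0 0) y))) := by
  rw [c.metricOn_phys.christoffel_eq hy, Fin.sum_univ_four]
  simp only [c.christoffelFirst_phys hy, (c.stat_phys 0 _).2 y hy, Matrix.smul_apply, smul_eq_mul]
  ring

theorem vanishTo_christoffel_phys_100 :
    VanishTo D 4 (christoffel (physMet Ω g) 1 0 0) := by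
  have p (i : Fin 4) (h : i ≠ 1) := c.vanishTo_pd_phys_zero h
  refine (((c.lead_conf.pow 2).vanishTo.mul
    (((c.lead_invMet_rr c.lead_met_vv).vanishTo.mul (c.vanishTo_pd_phys 1 0 (by decide))).add
    ((((c.vanishTo_invMet_two (Or.inl rfl)).1.mul (p 2 (by decide))).add
    ((c.vanishTo_invMet_two (Or.inr rfl)).1.mul (p 3 (by decide)))).mono
      (l := 2) (by norm_num)))).const_mul (-1 / 2)).congr
    fun y hy h0 => c.christoffel_phys_zero ⟨hy, h0⟩ 1

theorem vanishTo_christoffel_phys_i00 {i : Fin 4} (hi : i = 2 ∨ i = 3) :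
    VanishTo D 3 (christoffel (physMet Ω g) i 0 0) := by
  have p (i : Fin 4) (h : i ≠ 1) := c.vanishTo_pd_phys_zero h
  have s (j : Fin 4) := VanishTo.of_smooth (c.smooth_inv i j)
  refine (((c.lead_conf.pow 2).vanishTo.mul
    ((((c.vanishTo_invMet_two hi).2.mul (c.vanishTo_pd_phys 1 0 (by decide))).mono
      (l := 1) (by norm_num)).add (((s 2).mul_zero_left (p 2 (by decide))).add
      ((s 3).mul_zero_left (p 3 (by decide)))))).const_mul (-1 / 2)).congr
    fun y hy h0 => c.christoffel_phys_zero ⟨hy, h0⟩ i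

/-- By stationarity R_{vv} is the divergence of Γ^a_{vv} minus a product of two symbols of order r².
Here Γ^r_{vv} = O(r⁴) and Γ^I_{vv} = O(r³); ∂_r, and the singular part -4 ∂_r Ω/Ω of the trace, each
cost one power of r. -/
theorem vanishTo_ricci_phys : VanishTo D 3 (ricci (physMet Ω g) 0 0) := by
  have hD := c.nbhd
  have x1 := c.vanishTo_christoffel_phys_100
  have x2 := c.vanishTo_christoffel_phys_i00 (i := 2) (Or.inl rfl)
  have x3 := c.vanishTo_christoffel_phys_i00 (i := 3) (Or.inr rfl)
  have st := c.metricOn_phys.stat_christoffel c.stat_phys c.stat_phys_inv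
  have tr {y : Coord} (hy : y ∈ D ∩ {y | 0 < y 1}) (d : Fin 4) :=
    c.metricOn.trace_christoffel_conformal c.stat_conf.1 (fun y hy => c.conf_ne hy) hy d
  have t := c.vanishTo_trace_christoffel
  have a1 := (x1.pd_one hD).add ((x2.pd_tan hD (i := 2) (by decide)).add
    (x3.pd_tan hD (i := 3) (by decide)))
  have q : VanishTo D 3 fun y => pd 1 Ω y * christoffel (physMet Ω g) 1 0 0 y / Ω y :=
    (c.lead_pd_one_conf.vanishTo.mul_zero_left x1).elim
      fun _ h => (c.lead_div (n := 3) h).vanishTo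
  have a2 := ((((t 1).mul_zero_left x1).mono (l := 3) (by norm_num)).sub (q.const_mul 4)).add
    ((((t 2).sub (((c.vanishTo_pd_log (i := 2) (by decide)).const_mul 4).mono
      (l := 0) (by norm_num))).mul_zero_left x2).add
    (((t 3).sub (((c.vanishTo_pd_log (i := 3) (by decide)).const_mul 4).mono
      (l := 0) (by norm_num))).mul_zero_left x3))
  have a3 : VanishTo D 3 fun y => ∑ a, ∑ d,
      christoffel (physMet Ω g) a 0 d y * christoffel (physMet Ω g) d 0 a y :=
    (VanishTo.sum Finset.univ fun a _ => VanishTo.sum Finset.univ fun d _ =>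
      (c.vanishTo_christoffel_phys a d).mul (c.vanishTo_christoffel_phys d a)).mono
      (l := 3) (by norm_num)
  refine ((a1.add a2).sub a3).congr fun y hy h0 => ?_
  have hu : y ∈ D ∩ {y | 0 < y 1} := ⟨hy, h0⟩
  have e : ∑ a, ∑ d, christoffel (physMet Ω g) a a d y * christoffel (physMet Ω g) d 0 0 y
      = ∑ d, (∑ a, christoffel (physMet Ω g) a a d y) * christoffel (physMet Ω g) d 0 0 y := by
    rw [Finset.sum_comm]
    simp only [Finset.sum_mul]
  have tr' : ∀ d, ∑ a, christoffel (physMet Ω g) a a d y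
      = ∑ a, christoffel g a a d y - 4 * (pd d Ω y / Ω y) := fun d => tr hu d
  simp only [ricci, (st _ _ _).2 y hu, sub_zero, Finset.sum_add_distrib, Finset.sum_sub_distrib]
  rw [e]
  simp only [tr']
  rw [Fin.sum_univ_four (fun a => pd a (christoffel (physMet Ω g) a 0 0) y),
    Fin.sum_univ_four (fun d => (∑ a, christoffel g a a d y - 4 * (pd d Ω y / Ω y))
      * christoffel (physMet Ω g) d 0 0 y), (st 0 0 0).2 y hu, c.trace_christoffel_zero hu,
    c.dv_conf y hy h0]
  ring

/-- `F_{vI} = 0` at `r = 0`. -/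
theorem fld_vI_scri (hk : 0 < k) {y : Coord} (hy : y 1 = 0) : F y 0 2 = 0 ∧ F y 0 3 = 0 := by
  have h1 := ((c.lead_conf.pow 2).mul (c.lead_emTensor 0 0)).const_mul (2 * k)
  have h2 : Lead D 2 (ricci (physMet Ω g) 0 0) fun _ => 0 :=
    c.vanishTo_ricci_phys.lead (by norm_num)
  -- The r² coefficients in R_{vv} = 2k Ω² T_{vv} are compared. At r = 0 the unphysical T_{vv} is a
  -- positive multiple of F_{v2}² + F_{v3}².
  have h3 := h1.unique c.nbhd (h2.congr fun z hz h0 => by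
    rw [← c.metricOn.emTensor_conformal F ⟨hz, h0⟩ (c.conf_ne ⟨hz, h0⟩)]
    exact (c.einstein z hz h0 0 0).symm) hy
  have f0 : F y 0 0 = 0 := c.scri_eq (c.smooth_fld 0 0) contDiffOn_const (fun z hz => by
    linarith [c.alt z hz.1 hz.2 0 0]) hy
  simp only [emOf, c.met_vv_scri y hy, c.invMet_scri hy, Fin.sum_univ_four] at h3
  simp [f0] at h3
  have hP : 1 + y 2 ^ 2 + y 3 ^ 2 ≠ 0 := by positivity
  have h4 : F y 0 2 ^ 2 + F y 0 3 ^ 2 = 0 := by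
    have := h3.resolve_left hk.ne'
    field_simp at this
    rcases mul_eq_zero.1 (this.trans (mul_zero 4)) with h | h
    · exact absurd h (pow_ne_zero 2 hP)
    · linarith
  constructor <;> nlinarith [sq_nonneg (F y 0 2), sq_nonneg (F y 0 3)]

end ChartData
end Electrovac

end

/-! ### Maxwell's equations and the energy tensor in the adapted chart. -/

noncomputable section
open scoped Manifold ContDiff
open Set Filter Topology
namespace Electrovac

/-- The components of a 2-form as a `Field`. -/
def fieldOf (F : Coord → Matrix (Fin 4) (Fin 4) ℝ) : Field where
  E y := F y 1 0
  P2 y := F y 1 2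
  P3 y := F y 1 3
  Q2 y := F y 0 2
  Q3 y := F y 0 3
  B y := F y 2 3

/-- The volume density of a metric `g` with `g_{1j} = δ_{0j}`. -/
def vol (g : Coord → Matrix (Fin 4) (Fin 4) ℝ) (y : Coord) : ℝ :=
  √(g y 2 2 * g y 3 3 - g y 2 3 ^ 2)

namespace ChartData

variable {D : Set Coord} {k : ℝ} {Ω : Coord → ℝ} {g F : Coord → Matrix (Fin 4) (Fin 4) ℝ}
  (c : ChartData D k Ω g F)

include c

theorem smooth_det : ContDiffOn ℝ ∞ (fun y => g y 2 2 * g y 3 3 - g y 2 3 ^ 2) D :=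
  ((c.smooth_met 2 2).mul (c.smooth_met 3 3)).sub ((c.smooth_met 2 3).pow 2)

theorem smooth_vol : ContDiffOn ℝ ∞ (vol g) D :=
  c.smooth_det.sqrt fun y hy => (c.det_pos y hy).ne'

theorem vol_pos {y : Coord} (hy : y ∈ D) : 0 < vol g y := Real.sqrt_pos.2 (c.det_pos y hy)

theorem vol_sq {y : Coord} (hy : y ∈ D) :
    vol g y ^ 2 = g y 2 2 * g y 3 3 - g y 2 3 ^ 2 := Real.sq_sqrt (c.det_pos y hy).le

theorem vol_scri {y : Coord} (hy : y 1 = 0) : vol g y = 4 / (1 + y 2 ^ 2 + y 3 ^ 2) ^ 2 := by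
  have h : 0 < 1 + y 2 ^ 2 + y 3 ^ 2 := by positivity
  rw [vol, c.met_22_scri y hy, c.met_33_scri y hy, c.met_23_scri y hy, zero_pow two_ne_zero,
    sub_zero, neg_mul_neg, ← sq]
  exact Real.sqrt_sq (by positivity)

theorem stat_vol : Stat (D ∩ {y | 0 < y 1}) (vol g) := by
  have hU := c.nbhd.isOpen_pos
  have s := c.stat_met
  refine Stat.sqrt hU ?_ fun y hy => c.det_pos y hy.1
  simp only [sq]
  exact ((s 2 2).mul hU (s 3 3)).sub hU ((s 2 3).mul hU (s 2 3))

theorem pd_vol {y : Coord} (hy : y ∈ D ∩ {y | 0 < y 1}) (e : Fin 4) :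
    pd e (vol g) y = vol g y * ∑ a, christoffel g a a e y := by
  have hd := c.det_pos y hy.1
  have d := fun i j => (c.smooth_met i j).diffAt c.nbhd.isOpen hy.1
  have hv := c.vol_pos hy.1
  unfold vol
  rw [pd_sqrt (c.smooth_det.diffAt c.nbhd.isOpen hy.1) hd,
    pd_sub ((d 2 2).fun_mul (d 3 3)) ((d 2 3).fun_pow 2), pd_mul (d 2 2) (d 3 3), pd_pow (d 2 3),
    c.metricOn.trace_christoffel hy]
  have e1 : √(g y 2 2 * g y 3 3 - g y 2 3 ^ 2) = vol g y := rfl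
  rw [e1]
  simp only [Fin.sum_univ_four, c.pd_met_r hy, c.pd_met_r' hy, c.metricOn.pd_symm hy e 3 2]
  simp [invMet]
  rw [← c.vol_sq hy.1]
  field_simp
  ring

/-- `vol` · Ω^{-4} is the physical volume density. Raising two indices with the physical metric
costs Ω⁴, so the densities √det · F^{ab} are conformally invariant. -/
theorem pd_vol_phys {y : Coord} (hy : y ∈ D ∩ {y | 0 < y 1}) (e : Fin 4) :
    DifferentiableAt ℝ (fun z => vol g z * (Ω z ^ 4)⁻¹) y ∧
    pd e (fun z => vol g z * (Ω z ^ 4)⁻¹) y = vol g y * (Ω y ^ 4)⁻¹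
      * ∑ a, christoffel (physMet Ω g) a a e y := by
  have hΩ := c.conf_ne hy
  have dΩ := c.smooth_conf.diffAt c.nbhd.isOpen hy.1
  have dv := c.smooth_vol.diffAt c.nbhd.isOpen hy.1
  have d4 := dΩ.fun_pow 4
  have di : DifferentiableAt ℝ (fun z => (Ω z ^ 4)⁻¹) y := d4.inv (pow_ne_zero 4 hΩ)
  have tr : ∑ a, christoffel (physMet Ω g) a a e y
      = ∑ a, christoffel g a a e y - 4 * (pd e Ω y / Ω y) :=
    c.metricOn.trace_christoffel_conformal c.stat_conf.1 (fun y hy => c.conf_ne hy) hy e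
  refine ⟨dv.fun_mul di, ?_⟩
  rw [pd_mul dv di, pd_inv d4 (pow_ne_zero 4 hΩ), pd_pow dΩ, c.pd_vol hy, tr]
  field_simp
  norm_num
  ring

/-- The Maxwell equation `∇^a F_{ab} = 0` in divergence form. -/
theorem divergence {y : Coord} (hy : y ∈ D ∩ {y | 0 < y 1}) (b : Fin 4) :
    ∑ a, pd a (fun z => vol g z * ∑ p, ∑ q, invMet g z a p * invMet g z b q * F z p q) y = 0 := by
  have h := c.metricOn_phys.divergence hy (F := F)
    (fun i j => (c.smooth_fld i j).mono inter_subset_left)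
    (fun z hz => c.alt z hz.1 hz.2) (c.pd_vol_phys hy 0).1 (fun e => (c.pd_vol_phys hy e).2) b
  have h2 : ∀ e, ∑ a, ∑ p, (Ω y ^ 2 • invMet g y) a p * covDeriv (physMet Ω g) F a p e y = 0 := by
    intro e
    rw [← c.coclosed y hy.1 hy.2 e, Finset.sum_comm]
    refine Finset.sum_congr rfl fun a _ => Finset.sum_congr rfl fun p _ => ?_
    rw [c.metricOn_phys.symm_inv hy p a, ← c.metricOn_phys.inv_eq hy]
    rfl
  simp only [h2, mul_zero, Finset.sum_const_zero] at h
  rw [← h]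
  refine Finset.sum_congr rfl fun a _ => pd_congr_of_isOpen c.nbhd.isOpen_pos (fun z hz => ?_) hy
  have hΩ := c.conf_ne hz
  simp only [Finset.mul_sum, Matrix.smul_apply, smul_eq_mul]
  refine Finset.sum_congr rfl fun p _ => Finset.sum_congr rfl fun q _ => ?_
  field_simp

omit c in
theorem coeff_of_smooth {f v : Coord → ℝ} (hf : ContDiffOn ℝ ∞ f D)
    (hs : Stat (D ∩ {y | 0 < y 1}) f) (h : ∀ y : Coord, y 1 = 0 → f y = v y) : Coeff D 0 f v :=
  ⟨(Lead.of_smooth hf).congr_lead fun y hy => (h y hy).symm, fun y hy h0 => hs.2 y ⟨hy, h0⟩⟩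

omit c in
theorem coeff_of_lead {f v : Coord → ℝ} {n : ℕ} (hf : Lead D n f v)
    (hs : Stat (D ∩ {y | 0 < y 1}) f) : Coeff D n f v := ⟨hf, fun y hy h0 => hs.2 y ⟨hy, h0⟩⟩

theorem vol_mul_inv_scri {y : Coord} (hy : y 1 = 0) :
    vol g y * invMet g y 2 2 = -1 ∧ vol g y * invMet g y 2 3 = 0 ∧
      vol g y * invMet g y 3 3 = -1 := by
  have h : 1 + y 2 ^ 2 + y 3 ^ 2 ≠ 0 := by positivity
  rw [c.vol_scri hy, c.invMet_scri hy]
  refine ⟨?_, ?_, ?_⟩ <;> simp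
  all_goals
    field_simp
    exact h

theorem vanishTo_vol_mul {n : ℕ} {f : Coord → ℝ} (hf : VanishTo D n f) :
    VanishTo D n fun y => vol g y * f y := (VanishTo.of_smooth c.smooth_vol).mul_zero_left hf

/-- Since ĝ^{rr} = -r² + ... by `lead_met_vv`, this yields the normalization r² of `A22` and `A33`.
-/
theorem lead_vol_invMet_rr {i j : Fin 4} {v : ℝ}
    (hv : ∀ y : Coord, y 1 = 0 → vol g y * invMet g y i j = v) :
    Lead D 2 (fun y => invMet g y 1 1 * (vol g y * invMet g y i j)) fun _ => -v := by
  have := (c.lead_invMet_rr c.lead_met_vv).mul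
    (Lead.of_smooth (c.smooth_vol.mul (c.smooth_inv i j)))
  exact this.congr_lead fun y hy => by rw [hv y hy]; ring

/-- The relation between a 2-form and its dual. -/
def coeffs : Coeffs D :=
  have hU := c.nbhd.isOpen_pos
  have H := c.stat_inv
  have w := c.stat_vol
  have sm := fun i j => c.smooth_vol.mul (c.smooth_inv i j)
  have st := fun i j => w.mul hU (H i j)
  have st2 := fun i j k l => w.mul hU ((H i j).mul hU (H k l))
  have v2 := c.vanishTo_invMet_two (Or.inl rfl)
  have v3 := c.vanishTo_invMet_two (Or.inr rfl)
  have v := fun i j => VanishTo.of_smooth (c.smooth_inv i j)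
  { s := vol g
    K22 := fun y => vol g y * invMet g y 2 2
    K23 := fun y => vol g y * invMet g y 2 3
    K33 := fun y => vol g y * invMet g y 3 3
    S2 := fun y => vol g y * invMet g y 1 2
    S3 := fun y => vol g y * invMet g y 1 3
    A2E := fun y => -(vol g y * invMet g y 1 2)
    A22 := fun y => vol g y * (invMet g y 1 1 * invMet g y 2 2 - invMet g y 1 2 * invMet g y 1 2)
    A23 := fun y => vol g y * (invMet g y 1 1 * invMet g y 2 3 - invMet g y 1 3 * invMet g y 1 2)
    A2B := fun y => vol g y * (invMet g y 1 2 * invMet g y 2 3 - invMet g y 1 3 * invMet g y 2 2)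
    A3E := fun y => -(vol g y * invMet g y 1 3)
    A32 := fun y => vol g y * (invMet g y 1 1 * invMet g y 2 3 - invMet g y 1 2 * invMet g y 1 3)
    A33 := fun y => vol g y * (invMet g y 1 1 * invMet g y 3 3 - invMet g y 1 3 * invMet g y 1 3)
    A3B := fun y => vol g y * (invMet g y 1 2 * invMet g y 3 3 - invMet g y 1 3 * invMet g y 2 3)
    R2 := fun y => vol g y * (invMet g y 1 2 * invMet g y 2 3 - invMet g y 2 2 * invMet g y 1 3)
    R3 := fun y => vol g y * (invMet g y 1 2 * invMet g y 3 3 - invMet g y 2 3 * invMet g y 1 3)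
    smooth_s := c.smooth_vol
    pos_s := fun y hy => c.vol_pos hy
    dv_s := fun y hy h0 => w.2 y ⟨hy, h0⟩
    lead_K22 := coeff_of_smooth (sm 2 2) (st 2 2) fun y hy => (c.vol_mul_inv_scri hy).1
    lead_K23 := coeff_of_smooth (sm 2 3) (st 2 3) fun y hy => (c.vol_mul_inv_scri hy).2.1
    lead_K33 := coeff_of_smooth (sm 3 3) (st 3 3) fun y hy => (c.vol_mul_inv_scri hy).2.2
    lead_S2 := coeff_of_lead ((c.vanishTo_vol_mul v2.1).lead one_lt_two) (st 1 2)
    lead_S3 := coeff_of_lead ((c.vanishTo_vol_mul v3.1).lead one_lt_two) (st 1 3)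
    lead_A2E := coeff_of_lead ((c.vanishTo_vol_mul v2.1).neg.lead one_lt_two) (st 1 2).neg
    lead_A3E := coeff_of_lead ((c.vanishTo_vol_mul v3.1).neg.lead one_lt_two) (st 1 3).neg
    lead_A2B := coeff_of_lead ((c.vanishTo_vol_mul ((v2.1.mul_zero_right (v 2 3)).sub
      (v3.1.mul_zero_right (v 2 2)))).lead one_lt_two)
      (w.mul hU (((H 1 2).mul hU (H 2 3)).sub hU ((H 1 3).mul hU (H 2 2))))
    lead_A3B := coeff_of_lead ((c.vanishTo_vol_mul ((v2.1.mul_zero_right (v 3 3)).sub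
      (v3.1.mul_zero_right (v 2 3)))).lead one_lt_two)
      (w.mul hU (((H 1 2).mul hU (H 3 3)).sub hU ((H 1 3).mul hU (H 2 3))))
    lead_A22 := coeff_of_lead (((c.lead_vol_invMet_rr
      (fun y hy => (c.vol_mul_inv_scri hy).1)).sub ((c.vanishTo_vol_mul
        (v2.1.mul v2.1)).lead (l := 2) (by norm_num))).congr (fun y _ _ => by ring)
          |>.congr_lead fun y _ => by ring)
      (w.mul hU (((H 1 1).mul hU (H 2 2)).sub hU ((H 1 2).mul hU (H 1 2))))
    lead_A23 := coeff_of_lead (((c.lead_vol_invMet_rr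
      (fun y hy => (c.vol_mul_inv_scri hy).2.1)).sub ((c.vanishTo_vol_mul
        (v3.1.mul v2.1)).lead (l := 2) (by norm_num))).congr (fun y _ _ => by ring)
          |>.congr_lead fun y _ => by ring)
      (w.mul hU (((H 1 1).mul hU (H 2 3)).sub hU ((H 1 3).mul hU (H 1 2))))
    lead_A32 := coeff_of_lead (((c.lead_vol_invMet_rr
      (fun y hy => (c.vol_mul_inv_scri hy).2.1)).sub ((c.vanishTo_vol_mul
        (v2.1.mul v3.1)).lead (l := 2) (by norm_num))).congr (fun y _ _ => by ring)
          |>.congr_lead fun y _ => by ring)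
      (w.mul hU (((H 1 1).mul hU (H 2 3)).sub hU ((H 1 2).mul hU (H 1 3))))
    lead_A33 := coeff_of_lead (((c.lead_vol_invMet_rr
      (fun y hy => (c.vol_mul_inv_scri hy).2.2)).sub ((c.vanishTo_vol_mul
        (v3.1.mul v3.1)).lead (l := 2) (by norm_num))).congr (fun y _ _ => by ring)
          |>.congr_lead fun y _ => by ring)
      (w.mul hU (((H 1 1).mul hU (H 3 3)).sub hU ((H 1 3).mul hU (H 1 3))))
    lead_R2 := coeff_of_lead ((c.vanishTo_vol_mul ((v2.1.mul_zero_right (v 2 3)).sub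
      ((v 2 2).mul_zero_left v3.1))).lead one_lt_two)
      (w.mul hU (((H 1 2).mul hU (H 2 3)).sub hU ((H 2 2).mul hU (H 1 3))))
    lead_R3 := coeff_of_lead ((c.vanishTo_vol_mul ((v2.1.mul_zero_right (v 3 3)).sub
      ((v 2 3).mul_zero_left v3.1))).lead one_lt_two)
      (w.mul hU (((H 1 2).mul hU (H 3 3)).sub hU ((H 2 3).mul hU (H 1 3)))) }

section Dual

variable {y : Coord} (hy : y ∈ D ∩ {y | 0 < y 1})

include hy

theorem alt_self (i : Fin 4) : F y i i = 0 := by linarith [c.alt y hy.1 hy.2 i i]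

theorem dual_expand (a b : Fin 4) :
    vol g y * ∑ p, ∑ q, invMet g y a p * invMet g y b q * F y p q
    = vol g y * ((invMet g y a 1 * invMet g y b 0 - invMet g y a 0 * invMet g y b 1) * F y 1 0
      + (invMet g y a 1 * invMet g y b 2 - invMet g y a 2 * invMet g y b 1) * F y 1 2
      + (invMet g y a 1 * invMet g y b 3 - invMet g y a 3 * invMet g y b 1) * F y 1 3
      + (invMet g y a 0 * invMet g y b 2 - invMet g y a 2 * invMet g y b 0) * F y 0 2
      + (invMet g y a 0 * invMet g y b 3 - invMet g y a 3 * invMet g y b 0) * F y 0 3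
      + (invMet g y a 2 * invMet g y b 3 - invMet g y a 3 * invMet g y b 2) * F y 2 3) := by
  have al := c.alt y hy.1 hy.2
  simp only [Fin.sum_univ_four, c.alt_self hy, al 0 1, al 2 1, al 3 1, al 2 0, al 3 0, al 3 2]
  ring

theorem inv_det : vol g y * (invMet g y 2 2 * invMet g y 3 3 - invMet g y 2 3 * invMet g y 2 3)
    = 1 / vol g y := by
  have hv := (c.vol_pos hy.1).ne'
  simp only [invMet]
  simp
  rw [← c.vol_sq hy.1]
  have := c.vol_sq hy.1
  field_simp
  linear_combination -this

end Dual

omit c in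
theorem invMet_zero (y : Coord) (j : Fin 4) : invMet g y 0 j = (if j = 1 then 1 else 0) ∧
    invMet g y j 0 = (if j = 1 then 1 else 0) := by
  fin_cases j <;> simp [invMet]

omit c in
theorem invMet_symm (y : Coord) : invMet g y 2 1 = invMet g y 1 2 ∧
    invMet g y 3 1 = invMet g y 1 3 ∧ invMet g y 3 2 = invMet g y 2 3 := ⟨rfl, rfl, rfl⟩

theorem maxwell : c.coeffs.Maxwell (fieldOf F) := by
  have hU := c.nbhd.isOpen_pos
  have neg (a i j : Fin 4) {y : Coord} (hy : y ∈ D ∩ {y | 0 < y 1}) :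
      pd a (fun z => F z i j) y = - pd a (fun z => F z j i) y := by
    rw [pd_congr_of_isOpen hU (fun z hz => c.alt z hz.1 hz.2 i j) hy, pd_neg]
  -- For each b the family `N` lists the densities √det · F^{ab} in terms of the fluxes.
  have div {y : Coord} (hy : y ∈ D ∩ {y | 0 < y 1}) (b : Fin 4) (N : Fin 4 → Coord → ℝ)
      (hN : ∀ z ∈ D ∩ {y | 0 < y 1}, ∀ a,
        vol g z * ∑ p, ∑ q, invMet g z a p * invMet g z b q * F z p q = N a z) :
      ∑ a, pd a (N a) y = 0 := by
    rw [← c.divergence hy b]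
    exact Finset.sum_congr rfl fun a _ => (pd_congr_of_isOpen hU (fun z hz => hN z hz a) hy).symm
  have hz := fun y j => invMet_zero (g := g) y j
  have hs := fun y => invMet_symm (g := g) y
  refine ⟨?_, ?_, ?_, ?_, ?_, ?_, ?_, ?_⟩
  · intro y hy h0
    have h := c.closed y hy h0 1 2 3
    rw [neg 2 3 1 ⟨hy, h0⟩] at h
    simp only [fieldOf]
    linarith
  · intro y hy h0
    have h := c.closed y hy h0 0 2 3
    rw [neg 2 3 0 ⟨hy, h0⟩] at h
    simp only [fieldOf]
    linarith
  · intro y hy h0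
    have h := c.closed y hy h0 0 1 2
    rw [neg 1 2 0 ⟨hy, h0⟩, neg 2 0 1 ⟨hy, h0⟩] at h
    simp only [fieldOf]
    linarith
  · intro y hy h0
    have h := c.closed y hy h0 0 1 3
    rw [neg 1 3 0 ⟨hy, h0⟩, neg 3 0 1 ⟨hy, h0⟩] at h
    simp only [fieldOf]
    linarith
  · intro y hy h0
    have h := div ⟨hy, h0⟩ 0 ![fun _ => 0, fun z => -(c.coeffs.fluxVR (fieldOf F) z),
      fun z => -(c.coeffs.fluxV2 (fieldOf F) z), fun z => -(c.coeffs.fluxV3 (fieldOf F) z)]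
      (fun z hzD a => by
        rw [c.dual_expand hzD]
        fin_cases a <;> simp [-mul_eq_zero, hz, hs, Coeffs.fluxVR, Coeffs.fluxV2, Coeffs.fluxV3, fieldOf, coeffs]
        all_goals ring)
    simp [Fin.sum_univ_four, pd_neg] at h
    linarith
  · intro y hy h0
    have h := div ⟨hy, h0⟩ 1 ![fun z => c.coeffs.fluxVR (fieldOf F) z, fun _ => 0,
      fun z => -(c.coeffs.fluxR2 (fieldOf F) z), fun z => -(c.coeffs.fluxR3 (fieldOf F) z)]
      (fun z hzD a => by
        rw [c.dual_expand hzD]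
        fin_cases a <;> simp [-mul_eq_zero, hz, hs, Coeffs.fluxVR, Coeffs.fluxR2, Coeffs.fluxR3, fieldOf, coeffs]
        all_goals ring)
    simp [Fin.sum_univ_four, pd_neg] at h
    linarith
  · intro y hy h0
    have h := div ⟨hy, h0⟩ 2 ![fun z => c.coeffs.fluxV2 (fieldOf F) z,
      fun z => c.coeffs.fluxR2 (fieldOf F) z, fun _ => 0,
      fun z => -(c.coeffs.flux23 (fieldOf F) z)]
      (fun z hzD a => by
        have hd := c.inv_det hzD
        rw [c.dual_expand hzD]
        fin_cases a <;> simp [-mul_eq_zero, hz, hs, Coeffs.fluxV2, Coeffs.fluxR2, Coeffs.flux23, fieldOf, coeffs]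
        · ring
        · ring
        · ring
        · linear_combination (-(F z 2 3)) * hd)
    simp [Fin.sum_univ_four, pd_neg] at h
    linarith
  · intro y hy h0
    have h := div ⟨hy, h0⟩ 3 ![fun z => c.coeffs.fluxV3 (fieldOf F) z,
      fun z => c.coeffs.fluxR3 (fieldOf F) z,
      fun z => c.coeffs.flux23 (fieldOf F) z, fun _ => 0]
      (fun z hzD a => by
        have hd := c.inv_det hzD
        rw [c.dual_expand hzD]
        fin_cases a <;> simp [-mul_eq_zero, hz, hs, Coeffs.fluxV3, Coeffs.fluxR3, Coeffs.flux23, fieldOf, coeffs]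
        · ring
        · ring
        · linear_combination (F z 2 3) * hd
        · ring)
    simp [Fin.sum_univ_four] at h
    linarith

/-- The energy tensor is the physical Ricci tensor divided by 2k Ω²; k ≠ 0 is needed here. -/
theorem stat_emTensor (hk : 0 < k) (a b : Fin 4) :
    Stat (D ∩ {y | 0 < y 1}) (emTensor g F a b) := by
  have hU := c.nbhd.isOpen_pos
  have h2 : Stat (D ∩ {y | 0 < y 1}) fun y => 2 * k * (Ω y * Ω y) :=
    (Stat.const (2 * k)).mul hU (c.stat_conf.mul hU c.stat_conf)
  have hne : ∀ y ∈ D ∩ {y | 0 < y 1}, 2 * k * (Ω y * Ω y) ≠ 0 := fun y hy => by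
    have := c.conf_ne hy
    positivity
  refine ((c.metricOn_phys.stat_ricci c.stat_phys c.stat_phys_inv a b).div hU h2 hne).congr hU
    fun y hy => ?_
  have h := c.einstein y hy.1 hy.2 a b
  rw [c.metricOn.emTensor_conformal F hy (c.conf_ne hy)] at h
  rw [eq_div_iff (hne y hy)]
  unfold physMet
  rw [h]
  ring

theorem energy (hk : 0 < k) : c.coeffs.Energy (fieldOf F) := by
  have hU := c.nbhd.isOpen_pos
  have hz := fun y j => invMet_zero (g := g) y j
  have hs := fun y => invMet_symm (g := g) y
  -- The trace part of T_{rj} drops out because ĝ_{rj} = 0 for j ≠ v.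
  have key (j : Fin 4) (hj : j ≠ 0) {y : Coord} (hy : y ∈ D ∩ {y | 0 < y 1}) :
      emTensor g F 1 j y = (-1 / 2) * ∑ p, ∑ q, invMet g y p q * F y 1 p * F y j q := by
    rw [emTensor, c.met_r y hy.1 hy.2, if_neg hj, c.metricOn.inv_eq hy]
    ring
  have st (a : ℝ) (j : Fin 4) : Stat (D ∩ {y | 0 < y 1})
      fun y => a * (vol g y * emTensor g F 1 j y) :=
    (Stat.const a).mul hU (c.stat_vol.mul hU (c.stat_emTensor hk 1 j))
  refine ⟨fun y hy h0 => ((st (-2) 1).congr hU fun z hzD => ?_).2 y ⟨hy, h0⟩,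
    fun y hy h0 => ((st 2 2).congr hU fun z hzD => ?_).2 y ⟨hy, h0⟩,
    fun y hy h0 => ((st 2 3).congr hU fun z hzD => ?_).2 y ⟨hy, h0⟩⟩
  all_goals
    have al := c.alt z hzD.1 hzD.2
    rw [key _ (by decide) hzD]
    simp [Fin.sum_univ_four, hz, hs, c.alt_self hzD, al 2 1, al 3 1, al 3 2, Coeffs.fluxVR,
      Coeffs.fluxV2, Coeffs.fluxV3, fieldOf, coeffs]
    ring

end ChartData
end Electrovac

end

/-! ### From the manifold to the two adapted charts. -/

noncomputable section
open scoped Manifold ContDiff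
open Set Filter Topology
namespace Electrovac

variable {M : Type*} [TopologicalSpace M] [ChartedSpace Coord M]
  {k : ℝ} {g F : ∀ p : M, LinearMap.BilinForm ℝ (TangentSpace 𝓘(ℝ, Coord) p)}

theorem IsLorentzMetric.symm (hg : IsLorentzMetric g) (p : M) (u v : TangentSpace 𝓘(ℝ, Coord) p) :
    g p u v = g p v u := by
  obtain ⟨b, hb⟩ := hg.signature p
  have h : g p = (g p).flip := by
    refine LinearMap.BilinForm.ext_basis b fun i j => ?_
    rw [LinearMap.BilinForm.flip_apply, hb, hb]
    by_cases hij : i = j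
    · subst hij; rfl
    · rw [if_neg hij, if_neg (Ne.symm hij)]
  conv_lhs => rw [h]
  rfl

theorem emTensor_congr {G G' F F' : Coord → Matrix (Fin 4) (Fin 4) ℝ} {y : Coord}
    (h : G y = G' y) (h' : F y = F' y) (a b : Fin 4) : emTensor G F a b y = emTensor G' F' a b y := by
  simp only [emTensor, h, h']

namespace PastNullInfinity

theorem comp_fld (A : PastNullInfinity g F) (s : Bool) {y : Coord} (hy : y ∈ (A.chart s).target) :
    comp (A.chart s) F y = A.fld s y := by
  ext i j
  exact (A.fld_eq s y hy i j).symm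

theorem conf_pos (A : PastNullInfinity g F) (s : Bool) {y : Coord}
    (hy : y ∈ (A.chart s).target) : 0 < A.conf s y := by
  rw [A.conf_eq s y hy]
  exact A.Ω_pos s _ ((A.chart s).map_target hy)

theorem comp_met (A : PastNullInfinity g F) (s : Bool) {y : Coord} (hy : y ∈ (A.chart s).target) :
    comp (A.chart s) g y = (A.conf s y ^ 2)⁻¹ • A.met s y := by
  have h := (A.conf_pos s hy).ne'
  ext i j
  rw [Matrix.smul_apply, A.met_eq s y hy, ← A.conf_eq s y hy, smul_eq_mul]
  field_simp

theorem alt_fld (A : PastNullInfinity g F) (hF : ∀ p : M, (F p).IsAlt) (s : Bool) {y : Coord}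
    (hy : y ∈ (A.chart s).target) (i j : Fin 4) : A.fld s y i j = - A.fld s y j i := by
  rw [A.fld_eq s y hy, A.fld_eq s y hy]
  exact (LinearMap.BilinForm.IsAlt.neg_eq (hF _) _ _).symm

theorem stat_comp (A : PastNullInfinity g F) (hg : IsLorentzMetric g) (hs : A.IsStationary g)
    (s : Bool) (i j : Fin 4) : Stat (A.chart s).target fun y => comp (A.chart s) g y i j :=
  ⟨hg.smooth _ (A.chart_mem s) i j, fun y hy => hs s y hy i j⟩

theorem target_subset (A : PastNullInfinity g F) (s : Bool) : (A.chart s).target ⊆ A.dom s := by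
  rw [A.target_eq]
  exact inter_subset_left

/-- The physical g_{rv} is Ω^{-2}, so stationarity of g includes that of Ω, and with it that of the
unphysical metric. -/
theorem dv_conf (A : PastNullInfinity g F) (hg : IsLorentzMetric g) (hs : A.IsStationary g)
    (s : Bool) {y : Coord} (hy : y ∈ (A.chart s).target) : pd 0 (A.conf s) y = 0 := by
  have hU := (A.chart s).open_target
  have hΩ := (A.conf_pos s hy).ne'
  have dΩ := (A.conf_smooth s).diffAt (A.isOpen_dom s) (A.target_subset s hy)
  have h := (A.stat_comp hg hs s 1 0).2 y hy
  rw [pd_congr_of_isOpen (g := fun z => (A.conf s z ^ 2)⁻¹) hU (fun z hz => by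
    rw [A.comp_met s hz, Matrix.smul_apply]
    rw [A.target_eq] at hz
    simp [A.met_r s z hz.1 hz.2.le]) hy, pd_inv (dΩ.fun_pow 2) (pow_ne_zero 2 hΩ), pd_pow dΩ] at h
  simpa [hΩ] using h

theorem stat_met (A : PastNullInfinity g F) (hg : IsLorentzMetric g) (hs : A.IsStationary g)
    (s : Bool) (i j : Fin 4) : Stat (A.chart s).target fun y => A.met s y i j := by
  have hU := (A.chart s).open_target
  have h1 : Stat (A.chart s).target (A.conf s) :=
    ⟨(A.conf_smooth s).mono (A.target_subset s), fun y hy => A.dv_conf hg hs s hy⟩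
  refine ((h1.mul hU h1).mul hU (A.stat_comp hg hs s i j)).congr hU fun y hy => ?_
  rw [A.met_eq s y hy, ← A.conf_eq s y hy, sq]

/-- Nondegeneracy of the angular block and positivity of Ω/r are open conditions that hold at r = 0;
the set they cut out is shrunk to one that contains whole segments to r = 0. -/
theorem exists_nbhd (A : PastNullInfinity g F) (s : Bool) : ∃ D, ScriNbhd D ∧ D ⊆ A.dom s ∧
    (∀ y ∈ D, 0 < A.met s y 2 2 * A.met s y 3 3 - A.met s y 2 3 ^ 2) ∧
    ∃ w : Coord → ℝ, ContDiffOn ℝ ∞ w D ∧ (∀ y ∈ D, w y ≠ 0) ∧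
      ∀ y ∈ D, A.conf s y = y 1 * w y := by
  have star_sub {O : Set Coord} : {y : Coord | ∀ t ∈ Icc (0 : ℝ) 1,
      Function.update y 1 (t * y 1) ∈ O} ⊆ O := by
    intro y hy
    simpa using hy 1 ⟨zero_le_one, le_rfl⟩
  have h0 := scriNbhd_star (A.isOpen_dom s) (A.scri_mem s)
  set D₀ := {y : Coord | ∀ t ∈ Icc (0 : ℝ) 1, Function.update y 1 (t * y 1) ∈ A.dom s}
  have hD₀ : D₀ ⊆ A.dom s := star_sub
  obtain ⟨w, hw, hw'⟩ := h0.exists_eq_mul ((A.conf_smooth s).mono hD₀) (A.conf_scri s)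
  have hw1 : ∀ y : Coord, y 1 = 0 → w y = 1 := by
    intro y hy
    have hyD := h0.scri_mem y hy
    have := pd_congr_of_isOpen (i := 1) h0.isOpen hw' hyD
    rw [A.conf_deriv_scri s y hy, pd_mul (by fun_prop) (hw.diffAt h0.isOpen hyD), pd_coord,
      hy] at this
    simpa using this.symm
  have hm := A.met_smooth s
  have hd : ContDiffOn ℝ ∞ (fun y => A.met s y 2 2 * A.met s y 3 3 - A.met s y 2 3 ^ 2) D₀ :=
    (((hm 2 2).mul (hm 3 3)).sub ((hm 2 3).pow 2)).mono hD₀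
  have hO : IsOpen ((D₀ ∩ w ⁻¹' Ioi 0) ∩ (D₀ ∩ (fun y => A.met s y 2 2 * A.met s y 3 3
      - A.met s y 2 3 ^ 2) ⁻¹' Ioi 0)) :=
    (hw.continuousOn.isOpen_inter_preimage h0.isOpen isOpen_Ioi).inter
      (hd.continuousOn.isOpen_inter_preimage h0.isOpen isOpen_Ioi)
  refine ⟨_, scriNbhd_star hO fun y hy => ⟨⟨h0.scri_mem y hy, ?_⟩, h0.scri_mem y hy, ?_⟩,
    fun y hy => hD₀ (star_sub hy).1.1, fun y hy => (star_sub hy).2.2, w,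
    hw.mono fun y hy => (star_sub hy).1.1, fun y hy => ne_of_gt (star_sub hy).1.2,
    fun y hy => hw' y (star_sub hy).1.1⟩
  · rw [mem_preimage, hw1 y hy]
    exact mem_Ioi.2 (one_pos (α := ℝ))
  · rw [mem_preimage, mem_Ioi, A.met_22_scri s y hy, A.met_33_scri s y hy, A.met_23_scri s y hy]
    have : 0 < 4 / (1 + y 2 ^ 2 + y 3 ^ 2) ^ 2 := by positivity
    nlinarith

theorem exists_chartData (A : PastNullInfinity g F) (h : IsElectrovac k g F)
    (hs : A.IsStationary g) (s : Bool) :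
    ∃ D, D ⊆ A.dom s ∧ ChartData D k (A.conf s) (A.met s) (A.fld s) := by
  obtain ⟨D, hD, hDO, hdet, hw⟩ := A.exists_nbhd s
  have hU := (A.chart s).open_target
  have mem {y : Coord} (hy : y ∈ D) (h0 : 0 < y 1) : y ∈ (A.chart s).target := by
    rw [A.target_eq]
    exact ⟨hDO hy, h0⟩
  have hm := A.chart_mem s
  have eg := fun y (hy : y ∈ (A.chart s).target) => (A.comp_met s hy).symm
  have eF := fun y (hy : y ∈ (A.chart s).target) => (A.comp_fld s hy).symm
  refine ⟨D, hDO, ⟨hD, (A.conf_smooth s).mono hDO, fun i j => (A.met_smooth s i j).mono hDO,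
    fun i j => (A.fld_smooth s i j).mono hDO, fun y hy h0 => A.conf_pos s (mem hy h0), hw, ?_,
    fun y hy h0 => A.alt_fld h.alternating s (mem hy h0), hdet,
    fun y hy h0 => A.met_r s y (hDO hy) h0.le, ?_, ?_, ?_,
    fun y hy h0 => A.dv_conf h.metric hs s (mem hy h0),
    fun y hy h0 i j => (A.stat_met h.metric hs s i j).2 y (mem hy h0), A.conf_scri s,
    A.conf_deriv_scri s, A.met_vv_scri s, A.met_v2_scri s, A.met_v3_scri s,
    A.met_vv_deriv_scri s, A.met_22_scri s, A.met_33_scri s, A.met_23_scri s⟩⟩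
  · intro y hy h0 i j
    rw [A.met_eq s y (mem hy h0), A.met_eq s y (mem hy h0)]
    congr 1
    exact h.metric.symm _ _ _
  · intro y hy h0 a b
    have hy' := mem hy h0
    rw [ricci_congr hU eg hy', emTensor_congr (eg y hy') (eF y hy')]
    exact h.einstein _ hm y hy' a b
  · intro y hy h0 a b e
    have hy' := mem hy h0
    have p : ∀ i j l, pd i (fun z => A.fld s z j l) y = pd i (fun z => comp (A.chart s) F z j l) y :=
      fun i j l => pd_congr_of_isOpen hU (fun z hz => A.fld_eq s z hz j l) hy'
    rw [p, p, p]
    exact h.maxwell_closed _ hm y hy' a b e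
  · intro y hy h0 b
    have hy' := mem hy h0
    rw [← h.maxwell_coclosed _ hm y hy' b]
    refine Finset.sum_congr rfl fun a _ => Finset.sum_congr rfl fun e _ => ?_
    rw [covDeriv_congr hU eg hy' eF, eg y hy']

end PastNullInfinity

theorem inversion_hasFDerivAt {y : Coord} (hy : y 2 ^ 2 + y 3 ^ 2 ≠ 0) :
    DifferentiableAt ℝ inversion y ∧
    fderiv ℝ inversion y (Pi.single 1 1) = Pi.single 1 1 ∧
    fderiv ℝ inversion y (Pi.single 2 1)
      = ((y 3 ^ 2 - y 2 ^ 2) / (y 2 ^ 2 + y 3 ^ 2) ^ 2) • Pi.single 2 1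
        + (-2 * y 2 * y 3 / (y 2 ^ 2 + y 3 ^ 2) ^ 2) • Pi.single 3 1 ∧
    fderiv ℝ inversion y (Pi.single 3 1)
      = (-2 * y 2 * y 3 / (y 2 ^ 2 + y 3 ^ 2) ^ 2) • Pi.single 2 1
        + ((y 2 ^ 2 - y 3 ^ 2) / (y 2 ^ 2 + y 3 ^ 2) ^ 2) • Pi.single 3 1 := by
  have d (i : Fin 4) : DifferentiableAt ℝ (fun z => inversion z i) y := by
    fin_cases i <;> simp [inversion] <;> fun_prop (disch := assumption)
  have dd : DifferentiableAt ℝ inversion y := differentiableAt_pi.2 d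
  have e (j i : Fin 4) : fderiv ℝ inversion y (Pi.single j 1) i
      = pd j (fun z => inversion z i) y := by
    rw [pd, (hasFDerivAt_pi'.1 dd.hasFDerivAt i).fderiv]
    rfl
  have p (j : Fin 4) : pd j (fun z : Coord => z 2 ^ 2 + z 3 ^ 2) y
      = (if j = 2 then 2 * y 2 else 0) + if j = 3 then 2 * y 3 else 0 := by
    rw [pd_add (by fun_prop) (by fun_prop), pd_pow (by fun_prop), pd_pow (by fun_prop), pd_coord,
      pd_coord]
    fin_cases j <;> simp
  have q (j i : Fin 4) : pd j (fun z : Coord => z i * (z 2 ^ 2 + z 3 ^ 2)⁻¹) y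
      = (if i = j then 1 else 0) / (y 2 ^ 2 + y 3 ^ 2) - y i *
        ((if j = 2 then 2 * y 2 else 0) + if j = 3 then 2 * y 3 else 0)
          / (y 2 ^ 2 + y 3 ^ 2) ^ 2 := by
    have d1 : DifferentiableAt ℝ (fun z : Coord => z 2 ^ 2 + z 3 ^ 2) y := by fun_prop
    have d2 : DifferentiableAt ℝ (fun z : Coord => (z 2 ^ 2 + z 3 ^ 2)⁻¹) y := d1.inv hy
    rw [pd_mul (by fun_prop) d2, pd_inv d1 hy, p, pd_coord]
    ring
  refine ⟨dd, ?_, ?_, ?_⟩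
  all_goals
    ext i
    rw [e]
    fin_cases i <;> simp [inversion, div_eq_mul_inv, q, pd_coord, -mul_eq_zero, -mul_eq_mul_left_iff,
      -mul_eq_mul_right_iff]
  all_goals
    field_simp
    try ring


namespace PastNullInfinity

theorem inversion_mem (A : PastNullInfinity g F) (s : Bool) {y : Coord}
    (hy : y ∈ (A.chart s).target) (h0 : y 2 ^ 2 + y 3 ^ 2 ≠ 0) :
    inversion y ∈ (A.chart (!s)).target ∧
      (A.chart (!s)).symm (inversion y) = (A.chart s).symm y := by
  have hp := (A.chart s).map_target hy
  have e := (A.chart s).right_inv hy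
  have hp' : (A.chart s).symm y ∈ (A.chart (!s)).source := by
    rw [A.overlap s _ hp, e]
    rintro ⟨h2, h3⟩
    exact h0 (by rw [h2, h3]; ring)
  have ht := A.transition s _ hp hp'
  rw [e] at ht
  rw [← ht]
  exact ⟨(A.chart (!s)).map_source hp', (A.chart (!s)).left_inv hp'⟩

theorem mfderiv_chart_symm (A : PastNullInfinity g F) (s : Bool) {y : Coord}
    (hy : y ∈ (A.chart s).target) (h0 : y 2 ^ 2 + y 3 ^ 2 ≠ 0) (u : Coord) :
    (mfderiv 𝓘(ℝ, Coord) 𝓘(ℝ, Coord) (A.chart s).symm y u : Coord)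
      = (mfderiv 𝓘(ℝ, Coord) 𝓘(ℝ, Coord) (A.chart (!s)).symm (inversion y)
        (fderiv ℝ inversion y u : Coord) : Coord) := by
  have hi := (A.inversion_mem s hy h0).1
  have ev : (A.chart s).symm =ᶠ[𝓝 y] (A.chart (!s)).symm ∘ inversion := by
    have hc : ContinuousAt (fun z : Coord => z 2 ^ 2 + z 3 ^ 2) y := by fun_prop
    filter_upwards [(A.chart s).open_target.mem_nhds hy, hc.eventually_ne h0] with z hz hz0
    exact (A.inversion_mem s hz hz0).2.symm
  have d1 : MDifferentiableAt 𝓘(ℝ, Coord) 𝓘(ℝ, Coord) (A.chart (!s)).symm (inversion y) :=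
    ((contMDiffOn_symm_of_mem_maximalAtlas (A.chart_mem (!s))).contMDiffAt
      ((A.chart (!s)).open_target.mem_nhds hi)).mdifferentiableAt (by simp)
  have d2 := (inversion_hasFDerivAt h0).1.mdifferentiableAt
  rw [ev.mfderiv_eq, mfderiv_comp y d1 d2, mfderiv_eq_fderiv]
  rfl

theorem transforms (A : PastNullInfinity g F) :
    Transforms A.dom fun s => fieldOf (A.fld s) := by
  intro s y hy hr h0
  have ht : y ∈ (A.chart s).target := by
    rw [A.target_eq]
    exact ⟨hy, hr⟩
  obtain ⟨hi, hs⟩ := A.inversion_mem s ht h0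
  obtain ⟨-, i1, i2, i3⟩ := inversion_hasFDerivAt h0
  -- `T` and `L` retype `F` and the chart differential on the fixed space `Coord`, so that base
  -- points can be rewritten without dependent types in the way.
  let T : M → Coord → Coord → ℝ := fun p u v => F p u v
  have add (p : M) (u v w : Coord) (a b : ℝ) : T p u (a • v + b • w) = a * T p u v + b * T p u w :=
    ((F p u).map_add (a • v : Coord) (b • w : Coord)).trans
      (congrArg₂ (· + ·) ((F p u).map_smul a (v : Coord)) ((F p u).map_smul b (w : Coord)))
  let L : Coord → Coord := fun u =>
    mfderiv 𝓘(ℝ, Coord) 𝓘(ℝ, Coord) (A.chart (!s)).symm (inversion y) u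
  have hL (a b : ℝ) (u v : Coord) : L (a • u + b • v) = a • L u + b • L v := by
    have h := (mfderiv 𝓘(ℝ, Coord) 𝓘(ℝ, Coord) (A.chart (!s)).symm (inversion y)).map_add
      (a • u : Coord) (b • v : Coord)
    refine h.trans (congrArg₂ (fun x y : Coord => x + y) ?_ ?_)
    · exact (mfderiv 𝓘(ℝ, Coord) 𝓘(ℝ, Coord) (A.chart (!s)).symm (inversion y)).map_smul a u
    · exact (mfderiv 𝓘(ℝ, Coord) 𝓘(ℝ, Coord) (A.chart (!s)).symm (inversion y)).map_smul b v
  have e1 (i j : Fin 4) : A.fld s y i j = T ((A.chart s).symm y)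
      (L (fderiv ℝ inversion y (Pi.single i 1))) (L (fderiv ℝ inversion y (Pi.single j 1))) := by
    rw [A.fld_eq s y ht]
    exact congrArg₂ (T ((A.chart s).symm y)) (A.mfderiv_chart_symm s ht h0 (Pi.single i 1))
      (A.mfderiv_chart_symm s ht h0 (Pi.single j 1))
  have e2 (i j : Fin 4) : A.fld (!s) (inversion y) i j = T ((A.chart (!s)).symm (inversion y))
      (L (Pi.single i 1)) (L (Pi.single j 1)) := A.fld_eq (!s) _ hi i j
  refine ⟨A.target_subset _ hi, ?_, ?_⟩
  · simp only [fieldOf]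
    rw [e1, e2, e2, hs, i1, i2, hL, add]
  · simp only [fieldOf]
    rw [e1, e2, e2, hs, i1, i3, hL, add]

/-- On a stationary electrovac space-time with an analytic past null infinity, the Maxwell field
is stationary. -/
theorem isStationary_field (A : PastNullInfinity g F) (hk : 0 < k) (hgF : IsElectrovac k g F)
    (hA : A.IsAnalytic) (hg : A.IsStationary g) : A.IsStationary F := by
  choose D hDO c using fun s => A.exists_chartData hgF hg s
  intro s y hy
  have hU := (A.chart s).open_target
  have hy' := hy
  rw [A.target_eq] at hy'
  obtain ⟨h1, h2, h3, h4, h5, h6⟩ := Coeffs.dv_eq_zero (D := D) (O := A.dom)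
    (X := fun s => fieldOf (A.fld s)) (C := fun s => (c s).coeffs)
    (fun s => (c s).nbhd) hDO A.isOpen_dom A.ray_mem
    (fun s => ⟨hA.fld s 1 0, hA.fld s 1 2, hA.fld s 1 3, hA.fld s 0 2, hA.fld s 0 3,
      hA.fld s 2 3⟩) (fun s => (c s).maxwell) (fun s => (c s).energy hk)
    (fun s y hy => (c s).vol_scri hy) (fun s y hy => ((c s).fld_vI_scri hk hy).1)
    (fun s y hy => ((c s).fld_vI_scri hk hy).2) A.transforms s hy'.1 hy'.2
  have e : ∀ i j, pd 0 (fun z => comp (A.chart s) F z i j) y = pd 0 (fun z => A.fld s z i j) y :=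
    fun i j => pd_congr_of_isOpen hU (fun z hz => (A.fld_eq s z hz i j).symm) hy
  have n : ∀ i j, pd 0 (fun z => A.fld s z i j) y = - pd 0 (fun z => A.fld s z j i) y := by
    intro i j
    rw [pd_congr_of_isOpen hU (fun z hz => A.alt_fld hgF.alternating s hz i j) hy, pd_neg]
  have z : ∀ i, pd 0 (fun z => A.fld s z i i) y = 0 := fun i => by linarith [n i i]
  simp only [Field.dv, fieldOf] at h1 h2 h3 h4 h5 h6
  intro i j
  rw [e]
  fin_cases i <;> fin_cases j
  exacts [z 0, by rw [n]; simpa using h1, h4, h5, h1, z 1, h2, h3, by rw [n]; simpa using h4,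
    by rw [n]; simpa using h2, z 2, h6, by rw [n]; simpa using h5, by rw [n]; simpa using h3,
    by rw [n]; simpa using h6, z 3]

end PastNullInfinity

end Electrovac

end

open scoped Manifold ContDiff in
theorem corollary1p2 {M : Type*} [TopologicalSpace M] [ChartedSpace Electrovac.Coord M]
    [IsManifold 𝓘(ℝ, Electrovac.Coord) ∞ M]
    (k : ℝ) (hk : 0 < k)
    (g F : ∀ p : M, LinearMap.BilinForm ℝ (TangentSpace 𝓘(ℝ, Electrovac.Coord) p))
    (hgF : Electrovac.IsElectrovac k g F)
    (A : Electrovac.PastNullInfinity g F)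
    (hA : A.IsAnalytic)
    (hg : A.IsStationary g) :
    A.IsStationary F :=
  A.isStationary_field hk hgF hA hg
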